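/- **Theorem 2.2 (weak–strong uniqueness for the Maxwell–Landau–Lifshitz equations).** Consider on $\mathbb{R}^3$ the Maxwell–Landau–Lifshitz (MLL) system, in Gilbert form, $$\partial_t m+m\wedge\partial_t m=2\sum_{i=1}^3\partial_i(m\wedge\partial_i m)+2\,m\wedge H,\qquad \partial_t H+\operatorname{curl}E=-\partial_t m,$$ $$\partial_t E-\operatorname{curl}H=0,\qquad \operatorname{div}E=\operatorname{div}(H+m)=0 .$$ Let $m_0,E_0,H_0:\mathbb{R}^3\to\mathbb{R}^3$ be $C^\infty$ with $|m_0|=1$, $\nabla m_0\in L^2$, $E_0,H_0\in L^2$ and $\operatorname{div}E_0=\operatorname{div}(H_0+m_0)=0$. (a) Let $(m_2,E_2,H_2):(0,\infty)\times\mathbb{R}^3\to\mathbb{R}^9$ be a global weak solution with initial value $(m_0,E_0,H_0)$ satisfying the energy inequality. That is: $m_2$ is measurable with $|m_2|=1$ a.e. and has weak derivatives such that, for all $S>0$, $\nabla m_2\in L^\infty((0,S);L^2(\mathbb{R}^3))$ and $\partial_t m_2\in L^2((0,S)\times\mathbb{R}^3)$; $E_2,H_2\in L^\infty((0,S);L^2(\mathbb{R}^3))$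 for all $S>0$; $m_2$ has trace $m_0$ at $t=0$; for all $\Psi\in C_c^\infty([0,\infty)\times\mathbb{R}^3;\mathbb{R}^3)$, $$\int_0^\infty\!\!\int(\partial_t m_2+m_2\wedge\partial_t m_2)\cdot\Psi=-2\sum_i\int_0^\infty\!\!\int(m_2\wedge\partial_i m_2)\cdot\partial_i\Psi+2\int_0^\infty\!\!\int(m_2\wedge H_2)\cdot\Psi,$$ $$-\int_0^\infty\!\!\int(H_2+m_2)\cdot\partial_t\Psi+\int_0^\infty\!\!\int E_2\cdot\operatorname{curl}\Psi=\int(H_0+m_0)\cdot\Psi(0,\cdot),$$ $$-\int_0^\infty\!\!\int E_2\cdot\partial_t\Psi-\int_0^\infty\!\!\int H_2\cdot\operatorname{curl}\Psi=\int E_0\cdot\Psi(0,\cdot);$$ $\operatorname{div}E_2=\operatorname{div}(H_2+m_2)=0$ in the sense of distributions; and, for almost every $S>0$, $$\int\big(|E_2|^2+|H_2|^2+|\nabla m_2|^2\big)(S,x)\,dx+\int_0^S\!\!\int|\partial_t m_2|^2\,dx\,dt\le\int\big(|E_0|^2+|H_0|^2+|\nabla m_0|^2\big)\,dx .$$ (b)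 Let $T>0$ and let $(m_1,E_1,H_1)$ be a smooth solution of the MLL system up to time $T$ with the same initial value: $m_1,E_1,H_1$ are $C^\infty$ on $(0,T)\times\mathbb{R}^3$, their derivatives of every order (order $0$ included) are bounded on $(0,T')\times\mathbb{R}^3$ for every $T'<T$, the equations hold pointwise on $(0,T)\times\mathbb{R}^3$, and $(m_1,E_1,H_1)(t,x)\to(m_0,E_0,H_0)(x)$ as $t\to0^+$ for every $x$. Then $(m_2,E_2,H_2)=(m_1,E_1,H_1)$ almost everywhere on $(0,T)\times\mathbb{R}^3$. -/

import Mathlib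

namespace MLL

open MeasureTheory Filter Topology Set
open scoped ContDiff ENNReal NNReal Matrix

noncomputable section

/-- Physical space `ℝ³` with the Euclidean norm. -/
abbrev R3 : Type := EuclideanSpace ℝ (Fin 3)

/-- Time-space points `(t, x)`. -/
abbrev ST : Type := ℝ × R3

/-- The cross product `a ∧ b` on `ℝ³`. -/
def cross (a b : R3) : R3 := WithLp.toLp 2 (a.ofLp ⨯₃ b.ofLp)

/-- The `i`-th vector of the canonical basis. -/
def e (i : Fin 3) : R3 := EuclideanSpace.single i 1

/-- Classical partial derivative `∂ᵢ u` of a function of `x ∈ ℝ³`. -/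
def pd (i : Fin 3) (u : R3 → R3) (x : R3) : R3 := fderiv ℝ u x (e i)

/-- Classical time derivative of a function of `(t, x)`. -/
def dt {F : Type} [NormedAddCommGroup F] [NormedSpace ℝ F] (u : ST → F) (p : ST) : F :=
  fderiv ℝ u p (1, 0)

/-- Classical space derivative `∂ᵢ u` of a function of `(t, x)`. -/
def dx {F : Type} [NormedAddCommGroup F] [NormedSpace ℝ F] (i : Fin 3) (u : ST → F) (p : ST) : F :=
  fderiv ℝ u p (0, e i)

/-- The curl in the space variables. -/
def curl (u : ST → R3) (p : ST) : R3 :=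
  !₂[dx 1 u p 2 - dx 2 u p 1, dx 2 u p 0 - dx 0 u p 2, dx 0 u p 1 - dx 1 u p 0]

/-- The divergence in the space variables. -/
def div (u : ST → R3) (p : ST) : ℝ := ∑ i, dx i u p i

/-- The open slab `(0, T) × ℝ³`. -/
def slab (T : ℝ) : Set ST := Ioo 0 T ×ˢ univ

/-- The half space `(0, ∞) × ℝ³`. -/
def future : Set ST := Ioi 0 ×ˢ univ

/-- Smooth initial data of finite energy, with `|m₀| = 1` and `div E₀ = div (H₀ + m₀) = 0`. -/
structure IsSmoothData (m₀ E₀ H₀ : R3 → R3) : Prop where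
  smooth_m : ContDiff ℝ ∞ m₀
  smooth_E : ContDiff ℝ ∞ E₀
  smooth_H : ContDiff ℝ ∞ H₀
  norm_m : ∀ᵐ x, ‖m₀ x‖ = 1
  grad_m : ∀ i, MemLp (pd i m₀) 2 volume
  memLp_E : MemLp E₀ 2 volume
  memLp_H : MemLp H₀ 2 volume
  div_E : ∀ x, ∑ i, pd i E₀ x i = 0
  div_Hm : ∀ x, ∑ i, pd i (fun y => H₀ y + m₀ y) x i = 0

/-- Test functions: restrictions to `[0, ∞) × ℝ³` are exactly the elements of
`C_c^∞([0, ∞) × ℝ³)`, so they need not vanish at `t = 0`. -/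
def IsTest {F : Type} [NormedAddCommGroup F] [NormedSpace ℝ F] (Ψ : ST → F) : Prop :=
  ContDiff ℝ ∞ Ψ ∧ HasCompactSupport Ψ

/-- `u ∈ L^∞((0, T); L²(ℝ³))` for every finite `T > 0`. -/
def LocLinftyL2 (u : ST → R3) : Prop :=
  AEStronglyMeasurable u (volume.restrict future) ∧
    ∀ T : ℝ, 0 < T → ∃ C : ℝ≥0, ∀ᵐ t ∂(volume.restrict (Ioo 0 T)),
      ∫⁻ x : R3, ‖u (t, x)‖ₑ ^ 2 ≤ C

/-- `g` is the weak derivative `∂ᵢ u` on `(0, ∞) × ℝ³`. -/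
def IsWeakDx (i : Fin 3) (u g : ST → R3) : Prop :=
  ∀ Ψ : ST → R3, IsTest Ψ →
    ∫ p in future, inner ℝ (u p) (dx i Ψ p) = - ∫ p in future, inner ℝ (g p) (Ψ p)

/-- `g` is the weak time derivative of `u` on `(0, ∞) × ℝ³`, and `u` has trace `u₀` at `t = 0`
(Green's formula in time, the boundary term being given by the trace). -/
def IsWeakDtWithTrace (u g : ST → R3) (u₀ : R3 → R3) : Prop :=
  ∀ Ψ : ST → R3, IsTest Ψ →
    ∫ p in future, inner ℝ (u p) (dt Ψ p) =
      - (∫ x : R3, inner ℝ (u₀ x) (Ψ (0, x))) - ∫ p in future, inner ℝ (g p) (Ψ p)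

/-- `(m, E, H)` is a global weak solution of the Maxwell-Landau-Lifshitz equations with initial
value `(m₀, E₀, H₀)`, in the energy class and satisfying the energy inequality; `mt` and `G i` are
the weak derivatives `∂ₜ m` and `∂ᵢ m`. -/
structure IsWeakSolutionWith (m₀ E₀ H₀ : R3 → R3) (m E H : ST → R3)
    (mt : ST → R3) (G : Fin 3 → ST → R3) : Prop where
  meas_m : AEStronglyMeasurable m (volume.restrict future)
  norm_m : ∀ᵐ p ∂(volume.restrict future), ‖m p‖ = 1
  weak_dt : IsWeakDtWithTrace m mt m₀
  weak_dx : ∀ i, IsWeakDx i m (G i)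
  grad_m : ∀ i, LocLinftyL2 (G i)
  memLp_mt : ∀ T : ℝ, 0 < T → MemLp mt 2 (volume.restrict (slab T))
  class_E : LocLinftyL2 E
  class_H : LocLinftyL2 H
  /-- `∂ₜ m + m ∧ ∂ₜ m = 2 ∑ᵢ ∂ᵢ (m ∧ ∂ᵢ m) + 2 m ∧ H` -/
  gilbert : ∀ Ψ : ST → R3, IsTest Ψ →
    ∫ p in future, inner ℝ (mt p + cross (m p) (mt p)) (Ψ p) =
      - 2 * (∑ i, ∫ p in future, inner ℝ (cross (m p) (G i p)) (dx i Ψ p))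
        + 2 * ∫ p in future, inner ℝ (cross (m p) (H p)) (Ψ p)
  /-- `∂ₜ (H + m) + curl E = 0`, with initial value `H₀ + m₀` -/
  faraday : ∀ Ψ : ST → R3, IsTest Ψ →
    - (∫ p in future, inner ℝ (H p + m p) (dt Ψ p)) + ∫ p in future, inner ℝ (E p) (curl Ψ p) =
      ∫ x : R3, inner ℝ (H₀ x + m₀ x) (Ψ (0, x))
  /-- `∂ₜ E - curl H = 0`, with initial value `E₀` -/
  ampere : ∀ Ψ : ST → R3, IsTest Ψ →
    - (∫ p in future, inner ℝ (E p) (dt Ψ p)) - ∫ p in future, inner ℝ (H p) (curl Ψ p) =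
      ∫ x : R3, inner ℝ (E₀ x) (Ψ (0, x))
  div_E : ∀ φ : ST → ℝ, IsTest φ → ∫ p in future, ∑ i, E p i * dx i φ p = 0
  div_Hm : ∀ φ : ST → ℝ, IsTest φ → ∫ p in future, ∑ i, (H p + m p) i * dx i φ p = 0
  energy : ∀ᵐ T ∂(volume.restrict (Ioi (0 : ℝ))),
    (∫⁻ x : R3, (‖E (T, x)‖ₑ ^ 2 + ‖H (T, x)‖ₑ ^ 2 + ∑ i, ‖G i (T, x)‖ₑ ^ 2))
        + ∫⁻ t in Ioo 0 T, ∫⁻ x : R3, ‖mt (t, x)‖ₑ ^ 2 ≤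
      ∫⁻ x : R3, (‖E₀ x‖ₑ ^ 2 + ‖H₀ x‖ₑ ^ 2 + ∑ i, ‖pd i m₀ x‖ₑ ^ 2)

/-- Global weak solutions with the energy inequality. -/
def IsWeakSolution (m₀ E₀ H₀ : R3 → R3) (m E H : ST → R3) : Prop :=
  ∃ (mt : ST → R3) (G : Fin 3 → ST → R3), IsWeakSolutionWith m₀ E₀ H₀ m E H mt G

/-- `u` is smooth on `(0, T) × ℝ³`, all its derivatives being bounded on `(0, T') × ℝ³` for every
`T' < T` (hence `u` extends smoothly to `[0, T) × ℝ³`), and `u` has initial value `u₀`. -/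
structure IsSmoothUpTo (T : ℝ) (u : ST → R3) (u₀ : R3 → R3) : Prop where
  smooth : ContDiffOn ℝ ∞ u (slab T)
  bounded : ∀ T' < T, ∀ n : ℕ, ∃ C : ℝ, ∀ p ∈ slab T', ‖iteratedFDeriv ℝ n u p‖ ≤ C
  initial : ∀ x, Tendsto (fun t : ℝ => u (t, x)) (𝓝[>] 0) (𝓝 (u₀ x))

/-- `(m, E, H)` is a smooth solution of the Maxwell-Landau-Lifshitz equations up to time `T`, with
initial value `(m₀, E₀, H₀)`. -/
structure IsSmoothSolution (T : ℝ) (m₀ E₀ H₀ : R3 → R3) (m E H : ST → R3) : Prop where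
  smooth_m : IsSmoothUpTo T m m₀
  smooth_E : IsSmoothUpTo T E E₀
  smooth_H : IsSmoothUpTo T H H₀
  gilbert : ∀ p ∈ slab T,
    dt m p + cross (m p) (dt m p) =
      (2 : ℝ) • (∑ i, dx i (fun q => cross (m q) (dx i m q)) p) + (2 : ℝ) • cross (m p) (H p)
  faraday : ∀ p ∈ slab T, dt H p + curl E p = - dt m p
  ampere : ∀ p ∈ slab T, dt E p - curl H p = 0
  div_E : ∀ p ∈ slab T, div E p = 0
  div_Hm : ∀ p ∈ slab T, div (fun q => H q + m q) p = 0

end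

end MLL

/-!
The proof is a relative-energy argument. The smooth solution satisfies the weighted energy
inequality, the weak solution its own, and the mixed terms are computed by testing the weak
equations with `E₁`, `H₁`, `∂ᵢm₁`, the field `w = -m₁ ∧ ∂ₜm₁` and `∂ᵢm₁ ∧ w`, cut off in space; the
cutoffs disappear in the limit because only square integrable products remain. Since `|m₁| = 1` and
`∂ₜm₁ = m₁ ∧ w`, all mixed terms collapse to products of two differences times bounded functions of
the smooth solution.

The differences of the fields are absorbed by a weight `ζ` in time with `-ζ' ≥ lam ζ`. The only
term that this cannot absorb directly is `|m₁ - m₂|²`, which is not part of the energy; but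
`m₁ - m₂` vanishes at `t = 0`, so it is controlled by `∂ₜm₁ - ∂ₜm₂`, with the small constant
`S / lam`, and is absorbed by the dissipation.
-/

namespace MLL

open MeasureTheory Filter Topology Set
open scoped ContDiff ENNReal NNReal Matrix

noncomputable section

variable {F F' F'' : Type} [NormedAddCommGroup F] [NormedSpace ℝ F] [NormedAddCommGroup F']
  [NormedSpace ℝ F'] [NormedAddCommGroup F''] [NormedSpace ℝ F'']
  {V : Type} [NormedAddCommGroup V] [InnerProductSpace ℝ V]

/-! ### Vector algebra in `ℝ³` -/

lemma inner_eq_coords (a b : R3) : inner ℝ a b = a 0 * b 0 + a 1 * b 1 + a 2 * b 2 := by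
  simp only [PiLp.inner_apply, Fin.sum_univ_three, RCLike.inner_apply, conj_trivial]; ring

lemma norm_sq_eq_coords (a : R3) : ‖a‖ ^ 2 = a 0 ^ 2 + a 1 ^ 2 + a 2 ^ 2 := by
  rw [EuclideanSpace.real_norm_sq_eq, Fin.sum_univ_three]

lemma ext_coords {a b : R3} (h0 : a 0 = b 0) (h1 : a 1 = b 1) (h2 : a 2 = b 2) : a = b := by
  ext i; fin_cases i <;> assumption

@[simp] lemma norm_e (i : Fin 3) : ‖e i‖ = 1 := by simp [e]

@[simp] lemma cross_apply_zero (a b : R3) : cross a b 0 = a 1 * b 2 - a 2 * b 1 := by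
  simp [cross, cross_apply]

@[simp] lemma cross_apply_one (a b : R3) : cross a b 1 = a 2 * b 0 - a 0 * b 2 := by
  simp [cross, cross_apply]

@[simp] lemma cross_apply_two (a b : R3) : cross a b 2 = a 0 * b 1 - a 1 * b 0 := by
  simp [cross, cross_apply]

/-- The cross product as a continuous bilinear map. -/
def crossL : R3 →L[ℝ] R3 →L[ℝ] R3 :=
  LinearMap.toContinuousBilinearMap (LinearMap.mk₂ ℝ cross
    (fun a b c => ext_coords (by simp; ring) (by simp; ring) (by simp; ring))
    (fun a b c => ext_coords (by simp; ring) (by simp; ring) (by simp; ring))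
    (fun a b c => ext_coords (by simp; ring) (by simp; ring) (by simp; ring))
    (fun a b c => ext_coords (by simp; ring) (by simp; ring) (by simp; ring)))

lemma cross_add_right (a b c : R3) : cross a (b + c) = cross a b + cross a c :=
  (crossL a).map_add b c

lemma cross_smul_right (a : R3) (r : ℝ) (b : R3) : cross a (r • b) = r • cross a b :=
  (crossL a).map_smul r b

lemma cross_neg_right (a b : R3) : cross a (-b) = -cross a b := (crossL a).map_neg b

lemma cross_self_eq_zero (a : R3) : cross a a = 0 := by
  apply ext_coords <;> simp <;> ring

lemma inner_cross_self (a b : R3) : inner ℝ a (cross a b) = 0 := by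
  simp only [inner_eq_coords, cross_apply_zero, cross_apply_one, cross_apply_two]; ring

lemma inner_cross_self_right (a b : R3) : inner ℝ b (cross a b) = 0 := by
  simp only [inner_eq_coords, cross_apply_zero, cross_apply_one, cross_apply_two]; ring

lemma inner_cross_rotate (a b c : R3) : inner ℝ a (cross b c) = inner ℝ (cross a b) c := by
  simp only [inner_eq_coords, cross_apply_zero, cross_apply_one, cross_apply_two]; ring

lemma inner_cross_swap (a b c : R3) : inner ℝ a (cross b c) = - inner ℝ (cross b a) c := by
  simp only [inner_eq_coords, cross_apply_zero, cross_apply_one, cross_apply_two]; ring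

lemma norm_cross_le (a b : R3) : ‖cross a b‖ ≤ ‖a‖ * ‖b‖ := by
  have lagrange : ‖cross a b‖ ^ 2 + inner ℝ a b ^ 2 = (‖a‖ * ‖b‖) ^ 2 := by
    simp only [mul_pow, norm_sq_eq_coords, inner_eq_coords, cross_apply_zero, cross_apply_one,
      cross_apply_two]
    ring
  refine (sq_le_sq₀ (by positivity) (by positivity)).1 ?_
  linarith [sq_nonneg (inner ℝ a b)]

lemma abs_inner_cross_le (a b c : R3) : |inner ℝ a (cross b c)| ≤ ‖c‖ * (‖a‖ * ‖b‖) :=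
  calc |inner ℝ a (cross b c)| ≤ ‖a‖ * ‖cross b c‖ := abs_real_inner_le_norm _ _
    _ ≤ ‖a‖ * (‖b‖ * ‖c‖) := by gcongr; exact norm_cross_le b c
    _ = ‖c‖ * (‖a‖ * ‖b‖) := by ring

lemma cross_cross_self (a b : R3) : cross a (cross a b) = inner ℝ a b • a - ‖a‖ ^ 2 • b := by
  rw [inner_eq_coords, norm_sq_eq_coords]
  apply ext_coords <;> simp <;> ring

lemma cross_cross_of_unit {a v : R3} (ha : ‖a‖ = 1) (hv : inner ℝ a v = 0) :
    cross a (cross a v) = -v := by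
  simp [cross_cross_self, ha, hv]

/-! ### The algebra of the Gilbert equation -/

lemma two_mul_inner_of_gilbert {m v h : R3} (hg : v + cross m v = (2 : ℝ) • cross m h) :
    2 * inner ℝ v h = ‖v‖ ^ 2 := by
  have along_h : inner ℝ h v + inner ℝ h (cross m v) = 0 := by
    rw [← inner_add_right, hg, real_inner_smul_right, inner_cross_self_right, mul_zero]
  have along_v : ‖v‖ ^ 2 = 2 * inner ℝ v (cross m h) := by
    rw [← real_inner_smul_right, ← hg, inner_add_right, inner_cross_self_right, add_zero,
      real_inner_self_eq_norm_sq]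
  rw [inner_cross_swap, real_inner_comm] at along_v
  rw [real_inner_comm]
  linarith

lemma field_eq_of_gilbert {m v h : R3} (hm : ‖m‖ = 1) (hv : inner ℝ m v = 0)
    (hg : v + cross m v = (2 : ℝ) • cross m h) :
    h = (1 / 2 : ℝ) • (v - cross m v) + inner ℝ m h • m := by
  have rotated : cross m v - v = (2 : ℝ) • (inner ℝ m h • m - h) := by
    have := congrArg (cross m) hg
    rwa [cross_add_right, cross_cross_of_unit hm hv, cross_smul_right, cross_cross_self, hm,
      one_pow, one_smul, ← sub_eq_add_neg] at this
  rw [← neg_sub, rotated, smul_neg, smul_smul]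
  norm_num

/-- The gradient terms of the cross identity collapse to products of differences, up to the term
`⟨m₁ - m₂, L ∧ w⟩` in the Laplacian `L = Δ m₁`, which `exchange_terms_field` absorbs. -/
lemma exchange_terms_gradient (m₁ m₂ g G L w wi : R3) :
    - inner ℝ G (cross g w + cross m₁ wi) - inner ℝ (cross m₂ G) wi
      + inner ℝ m₂ (cross L w + cross g wi) + inner ℝ G (cross g w)
      - inner ℝ m₁ (cross L w + cross g wi)
      = - inner ℝ (G - g) (cross (m₁ - m₂) wi) - inner ℝ (m₁ - m₂) (cross L w) := by
  simp [inner_eq_coords]; ring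

lemma exchange_terms_field {m₁ m₂ v₁ v₂ w L H₁ H₂ : R3} {c : ℝ} (hw : v₁ = cross m₁ w)
    (hh : L + H₁ = (1 / 2 : ℝ) • (v₁ + w) + c • m₁) (hv : inner ℝ m₂ v₂ = 0) :
    inner ℝ H₂ v₁ + inner ℝ H₁ v₂ + inner ℝ v₂ L - (1 / 2) * inner ℝ (v₂ + cross m₂ v₂) w
      + inner ℝ (cross m₂ H₂) w - inner ℝ (m₁ - m₂) (cross L w)
      = inner ℝ v₁ v₂ - ((1 / 2) * inner ℝ (v₂ - v₁) (cross (m₁ - m₂) w)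
        + c * inner ℝ (m₁ - m₂) (v₁ - v₂) - inner ℝ (H₂ - H₁) (cross (m₁ - m₂) w)) := by
  obtain rfl : L = (1 / 2 : ℝ) • (v₁ + w) + c • m₁ - H₁ := eq_sub_of_add_eq hh
  subst hw
  simp only [inner_eq_coords] at hv
  simp only [inner_eq_coords, cross_apply_zero, cross_apply_one, cross_apply_two, smul_add,
    PiLp.sub_apply, PiLp.add_apply, PiLp.smul_apply, smul_eq_mul]
  linear_combination c * hv

/-! ### Bounded smooth functions on a slab -/

lemma isOpen_slab (T : ℝ) : IsOpen (slab T) := isOpen_Ioo.prod isOpen_univ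

lemma isOpen_future : IsOpen future := isOpen_Ioi.prod isOpen_univ

lemma mem_slab {T : ℝ} {p : ST} : p ∈ slab T ↔ 0 < p.1 ∧ p.1 < T := by simp [slab]

lemma mem_future {p : ST} : p ∈ future ↔ 0 < p.1 := by simp [future]

lemma slab_mono {S T : ℝ} (h : S ≤ T) : slab S ⊆ slab T := fun _ hp =>
  mem_slab.2 ⟨(mem_slab.1 hp).1, (mem_slab.1 hp).2.trans_le h⟩

lemma slab_subset_future (T : ℝ) : slab T ⊆ future := fun _ hp => mem_future.2 (mem_slab.1 hp).1

/-- Smooth on `(0, T) × ℝ³`, with all derivatives bounded on `(0, S) × ℝ³` for every `S < T`. -/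
structure BddSmooth (T : ℝ) (u : ST → F) : Prop where
  smooth : ContDiffOn ℝ ∞ u (slab T)
  bounded : ∀ S < T, ∀ n : ℕ, ∃ C : ℝ, ∀ p ∈ slab S, ‖iteratedFDeriv ℝ n u p‖ ≤ C

lemma IsSmoothUpTo.bddSmooth {T : ℝ} {u : ST → R3} {u₀ : R3 → R3} (h : IsSmoothUpTo T u u₀) :
    BddSmooth T u := ⟨h.smooth, h.bounded⟩

namespace BddSmooth

variable {T : ℝ} {u : ST → F}

lemma contDiffAt (h : BddSmooth T u) {p : ST} (hp : p ∈ slab T) : ContDiffAt ℝ ∞ u p :=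
  (h.smooth p hp).contDiffAt ((isOpen_slab T).mem_nhds hp)

lemma differentiableAt (h : BddSmooth T u) {p : ST} (hp : p ∈ slab T) : DifferentiableAt ℝ u p :=
  (h.contDiffAt hp).differentiableAt (by simp)

lemma continuousOn (h : BddSmooth T u) : ContinuousOn u (slab T) := h.smooth.continuousOn

lemma exists_bound (h : BddSmooth T u) {S : ℝ} (hS : S < T) :
    ∃ C : ℝ, 0 ≤ C ∧ ∀ p ∈ slab S, ‖u p‖ ≤ C := by
  obtain ⟨C, hC⟩ := h.bounded S hS 0
  exact ⟨max C 0, le_max_right _ _, fun p hp => by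
    have := hC p hp; rw [norm_iteratedFDeriv_zero] at this; exact this.trans (le_max_left _ _)⟩

lemma aestronglyMeasurable (h : BddSmooth T u) {S : ℝ} (hS : S ≤ T) :
    AEStronglyMeasurable u (volume.restrict (slab S)) :=
  (h.continuousOn.mono (slab_mono hS)).aestronglyMeasurable (isOpen_slab S).measurableSet

lemma memLp_top (h : BddSmooth T u) {S : ℝ} (hS : S < T) :
    MemLp u ⊤ (volume.restrict (slab S)) := by
  obtain ⟨C, _, hC⟩ := h.exists_bound hS
  exact memLp_top_of_bound (h.aestronglyMeasurable hS.le) C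
    (ae_restrict_of_forall_mem (isOpen_slab S).measurableSet hC)

lemma exists_bound_fderiv (h : BddSmooth T u) {S : ℝ} (hS : S < T) :
    ∃ C : ℝ, 0 ≤ C ∧ ∀ p ∈ slab S, ‖fderiv ℝ u p‖ ≤ C := by
  obtain ⟨C, hC⟩ := h.bounded S hS 1
  exact ⟨max C 0, le_max_right _ _, fun p hp => by
    have := hC p hp; rw [norm_iteratedFDeriv_one] at this; exact this.trans (le_max_left _ _)⟩

protected lemma fderiv (h : BddSmooth T u) : BddSmooth T (fderiv ℝ u) := by
  refine ⟨h.smooth.fderiv_of_isOpen (isOpen_slab T) (by simp), fun S hS n => ?_⟩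
  obtain ⟨C, hC⟩ := h.bounded S hS (n + 1)
  exact ⟨C, fun p hp => by rw [norm_iteratedFDeriv_fderiv]; exact hC p hp⟩

lemma clm (h : BddSmooth T u) (L : F →L[ℝ] F') : BddSmooth T (fun p => L (u p)) := by
  refine ⟨L.contDiff.comp_contDiffOn h.smooth, fun S hS n => ?_⟩
  obtain ⟨C, hC⟩ := h.bounded S hS n
  refine ⟨‖L‖ * C, fun p hp => ?_⟩
  have hp' := slab_mono hS.le hp
  refine (L.norm_iteratedFDeriv_comp_left (h.contDiffAt hp') (n := n)
    (by exact_mod_cast le_top)).trans ?_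
  gcongr
  exact hC p hp

lemma bilin {v : ST → F'} (h : BddSmooth T u) (hv : BddSmooth T v) (B : F →L[ℝ] F' →L[ℝ] F'') :
    BddSmooth T (fun p => B (u p) (v p)) := by
  refine ⟨B.isBoundedBilinearMap.contDiff.comp_contDiffOn (h.smooth.prodMk hv.smooth),
    fun S hS n => ?_⟩
  choose C hC using h.bounded S hS
  choose D hD using hv.bounded S hS
  refine ⟨‖B‖ * ∑ i ∈ Finset.range (n + 1), (n.choose i : ℝ) * C i * D (n - i), fun p hp => ?_⟩
  have hp' := slab_mono hS.le hp
  have ho := isOpen_slab T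
  have := B.norm_iteratedFDerivWithin_le_of_bilinear h.smooth hv.smooth ho.uniqueDiffOn hp'
    (n := n) (by exact_mod_cast le_top)
  simp only [iteratedFDerivWithin_of_isOpen _ ho hp'] at this
  refine this.trans ?_
  have h0 : ∀ i, 0 ≤ C i := fun i => (norm_nonneg _).trans (hC i p hp)
  gcongr with i
  · exact mul_nonneg (by positivity) (h0 i)
  · exact hC i p hp
  · exact hD _ p hp

protected lemma add {v : ST → F} (h : BddSmooth T u) (hv : BddSmooth T v) :
    BddSmooth T (fun p => u p + v p) := by
  refine ⟨h.smooth.add hv.smooth, fun S hS n => ?_⟩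
  obtain ⟨C, hC⟩ := h.bounded S hS n
  obtain ⟨D, hD⟩ := hv.bounded S hS n
  refine ⟨C + D, fun p hp => ?_⟩
  have hp' := slab_mono hS.le hp
  rw [fun_iteratedFDeriv_add_apply ((h.contDiffAt hp').of_le (by exact_mod_cast le_top))
    ((hv.contDiffAt hp').of_le (by exact_mod_cast le_top))]
  exact (norm_add_le _ _).trans (add_le_add (hC p hp) (hD p hp))

protected lemma neg (h : BddSmooth T u) : BddSmooth T (fun p => - u p) :=
  h.clm (-ContinuousLinearMap.id ℝ F)

protected lemma dt (h : BddSmooth T u) : BddSmooth T (dt u) :=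
  h.fderiv.clm (ContinuousLinearMap.apply ℝ F ((1, 0) : ST))

protected lemma dx (h : BddSmooth T u) (i : Fin 3) : BddSmooth T (dx i u) :=
  h.fderiv.clm (ContinuousLinearMap.apply ℝ F ((0, e i) : ST))

protected lemma cross {u v : ST → R3} (h : BddSmooth T u) (hv : BddSmooth T v) :
    BddSmooth T (fun p => cross (u p) (v p)) := h.bilin hv crossL

protected lemma inner {u v : ST → V} (h : BddSmooth T u) (hv : BddSmooth T v) :
    BddSmooth T (fun p => inner ℝ (u p) (v p)) := h.bilin hv (innerSL ℝ)

end BddSmooth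

section Calculus

variable {u : ST → F} {v : ST → F'} {p : ST}

lemma dt_bilin (B : F →L[ℝ] F' →L[ℝ] F'') (hu : DifferentiableAt ℝ u p)
    (hv : DifferentiableAt ℝ v p) :
    dt (fun q => B (u q) (v q)) p = B (dt u p) (v p) + B (u p) (dt v p) := by
  have := (B.hasFDerivAt_of_bilinear hu.hasFDerivAt hv.hasFDerivAt).fderiv
  simp [dt, this, add_comm]

lemma dx_bilin (i : Fin 3) (B : F →L[ℝ] F' →L[ℝ] F'') (hu : DifferentiableAt ℝ u p)
    (hv : DifferentiableAt ℝ v p) :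
    dx i (fun q => B (u q) (v q)) p = B (dx i u p) (v p) + B (u p) (dx i v p) := by
  have := (B.hasFDerivAt_of_bilinear hu.hasFDerivAt hv.hasFDerivAt).fderiv
  simp [dx, this, add_comm]

lemma dx_inner (i : Fin 3) {u v : ST → V} (hu : DifferentiableAt ℝ u p)
    (hv : DifferentiableAt ℝ v p) :
    dx i (fun q => inner ℝ (u q) (v q)) p = inner ℝ (dx i u p) (v p) + inner ℝ (u p) (dx i v p) :=
  dx_bilin i (innerSL ℝ) hu hv

lemma dx_cross (i : Fin 3) {u v : ST → R3} (hu : DifferentiableAt ℝ u p)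
    (hv : DifferentiableAt ℝ v p) :
    dx i (fun q => cross (u q) (v q)) p = cross (dx i u p) (v p) + cross (u p) (dx i v p) :=
  dx_bilin i crossL hu hv

lemma dt_dx_comm (i : Fin 3) (hu : ContDiffAt ℝ ∞ u p) : dt (dx i u) p = dx i (dt u) p := by
  have hd : DifferentiableAt ℝ (fderiv ℝ u) p :=
    (hu.fderiv_right (m := 1)
      (by rw [one_add_one_eq_two]; exact ENat.LEInfty.out)).differentiableAt (by simp)
  have hs := (hu.isSymmSndFDerivAt (by simpa using ENat.LEInfty.out)).eq (1, 0) (0, e i)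
  have h1 : ∀ a b : ST, fderiv ℝ (fun q => fderiv ℝ u q a) p b = fderiv ℝ (fderiv ℝ u) p b a := by
    intro a b
    rw [fderiv_clm_apply hd (by fun_prop)]; simp
  exact (h1 _ _).trans (hs.trans (h1 _ _).symm)

end Calculus

/-! ### Local integrability on the half space -/

/-- Integrable on the bounded parts of the half space. -/
def LocIntegrable {F : Type} [NormedAddCommGroup F] (f : ST → F) : Prop :=
  ∀ R : ℝ, IntegrableOn f (future ∩ Metric.ball 0 R) volume

lemma measurableSet_future : MeasurableSet future := isOpen_future.measurableSet

lemma measurableSet_future_inter_ball (R : ℝ) :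
    MeasurableSet (future ∩ Metric.ball (0 : ST) R) :=
  measurableSet_future.inter measurableSet_ball

lemma future_inter_ball_subset (R : ℝ) : future ∩ Metric.ball (0 : ST) R ⊆ slab R := by
  rintro p ⟨hp, hb⟩
  refine mem_slab.2 ⟨mem_future.1 hp, (le_abs_self _).trans_lt ?_⟩
  exact (norm_fst_le p).trans_lt (by simpa using hb)

lemma volume_restrict_slab (S : ℝ) : (volume : Measure ST).restrict (slab S)
    = ((volume : Measure ℝ).restrict (Ioo 0 S)).prod (volume : Measure R3) := by
  rw [slab, Measure.volume_eq_prod, ← Measure.prod_restrict, Measure.restrict_univ]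

lemma lintegral_slab (S : ℝ) {f : ST → ℝ≥0∞} (hf : AEMeasurable f (volume.restrict (slab S))) :
    ∫⁻ p in slab S, f p = ∫⁻ t in Ioo 0 S, ∫⁻ x : R3, f (t, x) := by
  rw [volume_restrict_slab] at hf ⊢
  exact lintegral_prod _ hf

lemma locIntegrable_of_memLp {F : Type} [NormedAddCommGroup F] {f : ST → F} {q : ℝ≥0∞} (hq : 1 ≤ q)
    (hf : ∀ S : ℝ, 0 < S → MemLp f q (volume.restrict (slab S))) : LocIntegrable f := by
  intro R
  rcases le_or_gt R 0 with hR | hR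
  · simp [Metric.ball_eq_empty.2 hR]
  have : IsFiniteMeasure (volume.restrict (future ∩ Metric.ball (0 : ST) R)) :=
    ⟨by rw [Measure.restrict_apply_univ]
        exact (measure_mono inter_subset_right).trans_lt measure_ball_lt_top⟩
  exact ((hf R hR).mono_measure
    (Measure.restrict_mono (future_inter_ball_subset R) le_rfl)).integrable hq

lemma LocLinftyL2.memLp {u : ST → R3} (h : LocLinftyL2 u) (S : ℝ) :
    MemLp u 2 (volume.restrict (slab S)) := by
  rcases le_or_gt S 0 with hS | hS
  · simp [slab, Ioo_eq_empty (not_lt.2 hS)]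
  have hm : AEStronglyMeasurable u (volume.restrict (slab S)) :=
    h.1.mono_measure (Measure.restrict_mono (slab_subset_future S) le_rfl)
  refine ⟨hm, ?_⟩
  rw [eLpNorm_lt_top_iff_lintegral_rpow_enorm_lt_top (by norm_num) (by norm_num)]
  simp only [ENNReal.toReal_ofNat, ENNReal.rpow_ofNat]
  rw [lintegral_slab S (hm.enorm.pow_const 2)]
  obtain ⟨C, hC⟩ := h.2 S hS
  calc ∫⁻ t in Ioo 0 S, ∫⁻ x : R3, ‖u (t, x)‖ₑ ^ 2 ≤ ∫⁻ _ in Ioo 0 S, (C : ℝ≥0∞) :=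
        lintegral_mono_ae hC
    _ < ⊤ := by
        rw [setLIntegral_const, Real.volume_Ioo]
        exact ENNReal.mul_lt_top ENNReal.coe_lt_top ENNReal.ofReal_lt_top

lemma LocLinftyL2.locIntegrable {u : ST → R3} (h : LocLinftyL2 u) : LocIntegrable u :=
  locIntegrable_of_memLp one_le_two fun S _ => h.memLp S

/-! ### Test functions on the half space -/

/-- Continuous functions on the open half space, bounded and of bounded support. -/
structure IsHalfCont {F : Type} [NormedAddCommGroup F] (Φ : ST → F) : Prop where
  cont : ContinuousOn Φ future
  bounded : ∃ C : ℝ, ∀ p ∈ future, ‖Φ p‖ ≤ C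
  support : ∃ R : ℝ, ∀ p ∈ future, R ≤ ‖p‖ → Φ p = 0

/-- Smooth functions on the open half space, bounded together with their first derivatives, and of
bounded support. They generalize test functions in that they need not be smooth up to `t = 0`. -/
structure IsHalfTest (Ψ : ST → F) : Prop where
  smooth : ContDiffOn ℝ ∞ Ψ future
  bounded : ∃ C : ℝ, ∀ p ∈ future, ‖Ψ p‖ ≤ C ∧ ‖fderiv ℝ Ψ p‖ ≤ C
  support : ∃ R : ℝ, ∀ p ∈ future, R ≤ ‖p‖ → Ψ p = 0

lemma IsHalfCont.clm {Φ : ST → F} (h : IsHalfCont Φ) (L : F →L[ℝ] F') :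
    IsHalfCont (fun p => L (Φ p)) := by
  obtain ⟨C, hC⟩ := h.bounded
  obtain ⟨R, hR⟩ := h.support
  refine ⟨L.continuous.comp_continuousOn h.cont, ⟨‖L‖ * C, fun p hp => ?_⟩, R, fun p hp hn => ?_⟩
  · exact (L.le_opNorm _).trans (by gcongr; exact hC p hp)
  · simp [hR p hp hn]

lemma IsHalfTest.halfCont {Ψ : ST → F} (h : IsHalfTest Ψ) : IsHalfCont Ψ := by
  obtain ⟨C, hC⟩ := h.bounded
  exact ⟨h.smooth.continuousOn, ⟨C, fun p hp => (hC p hp).1⟩, h.support⟩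

lemma IsHalfTest.halfCont_fderiv {Ψ : ST → F} (h : IsHalfTest Ψ) : IsHalfCont (fderiv ℝ Ψ) := by
  obtain ⟨C, hC⟩ := h.bounded
  obtain ⟨R, hR⟩ := h.support
  refine ⟨(h.smooth.fderiv_of_isOpen isOpen_future (m := 0) (by simp)).continuousOn,
    ⟨C, fun p hp => (hC p hp).2⟩, R + 1, fun p hp hn => ?_⟩
  have : Ψ =ᶠ[𝓝 p] fun _ => 0 := by
    filter_upwards [isOpen_future.mem_nhds hp,
      (isOpen_lt continuous_const continuous_norm).mem_nhds (show R < ‖p‖ by linarith)] with q h1 h2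
    exact hR q h1 (le_of_lt h2)
  rw [this.fderiv_eq]; simp

lemma IsHalfTest.halfCont_dt {Ψ : ST → F} (h : IsHalfTest Ψ) : IsHalfCont (dt Ψ) :=
  h.halfCont_fderiv.clm (ContinuousLinearMap.apply ℝ F ((1, 0) : ST))

lemma IsHalfTest.halfCont_dx {Ψ : ST → F} (h : IsHalfTest Ψ) (i : Fin 3) :
    IsHalfCont (dx i Ψ) :=
  h.halfCont_fderiv.clm (ContinuousLinearMap.apply ℝ F ((0, e i) : ST))

/-- The curl as a linear function of the derivative. -/
def curlL : (ST →L[ℝ] R3) →L[ℝ] R3 :=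
  LinearMap.toContinuousLinearMap
    { toFun := fun D => !₂[D (0, e 1) 2 - D (0, e 2) 1, D (0, e 2) 0 - D (0, e 0) 2,
        D (0, e 0) 1 - D (0, e 1) 0]
      map_add' := fun A B => by apply ext_coords <;> simp <;> ring
      map_smul' := fun c A => by apply ext_coords <;> simp <;> ring }

lemma curl_eq_curlL (u : ST → R3) (p : ST) : curl u p = curlL (fderiv ℝ u p) := rfl

lemma IsHalfTest.halfCont_curl {Ψ : ST → R3} (h : IsHalfTest Ψ) : IsHalfCont (curl Ψ) :=
  h.halfCont_fderiv.clm curlL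

lemma IsTest.halfTest {Ψ : ST → F} (h : IsTest Ψ) : IsHalfTest Ψ := by
  obtain ⟨C, hC⟩ := h.2.exists_bound_of_continuous h.1.continuous
  obtain ⟨D, hD⟩ := (h.2.fderiv ℝ).exists_bound_of_continuous (h.1.continuous_fderiv (by simp))
  obtain ⟨R, hR⟩ := h.2.isCompact.isBounded.subset_ball (0 : ST)
  refine ⟨h.1.contDiffOn, ⟨max C D, fun p _ =>
    ⟨(hC p).trans (le_max_left _ _), (hD p).trans (le_max_right _ _)⟩⟩, R, fun p _ hn => ?_⟩
  by_contra h0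
  have := hR (subset_tsupport _ h0)
  rw [mem_ball_zero_iff] at this
  linarith

protected lemma IsTest.dt {Ψ : ST → F} (h : IsTest Ψ) : IsTest (dt Ψ) :=
  ⟨(h.1.fderiv_right (m := ∞) (by simp)).clm_apply contDiff_const,
    (h.2.fderiv ℝ).comp_left (g := fun L : ST →L[ℝ] F => L (1, 0)) (by simp)⟩

protected lemma IsTest.dx {Ψ : ST → F} (h : IsTest Ψ) (i : Fin 3) : IsTest (dx i Ψ) :=
  ⟨(h.1.fderiv_right (m := ∞) (by simp)).clm_apply contDiff_const,
    (h.2.fderiv ℝ).comp_left (g := fun L : ST →L[ℝ] F => L (0, e i)) (by simp)⟩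

lemma setIntegral_future_eq_ball {φ : ST → F} {R : ℝ}
    (h : ∀ p ∈ future, R ≤ ‖p‖ → φ p = 0) :
    ∫ p in future, φ p = ∫ p in future ∩ Metric.ball 0 R, φ p :=
  setIntegral_eq_of_subset_of_forall_sdiff_eq_zero measurableSet_future inter_subset_left
    fun p hp => h p hp.1 (not_lt.1 fun hlt => hp.2 ⟨hp.1, mem_ball_zero_iff.2 hlt⟩)

lemma IsHalfCont.integrable_inner {Φ : ST → V} (h : IsHalfCont Φ) {f : ST → V}
    (hf : LocIntegrable f) : IntegrableOn (fun p => inner ℝ (f p) (Φ p)) future := by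
  obtain ⟨C, hC⟩ := h.bounded
  obtain ⟨R, hR⟩ := h.support
  have integrable_ball :
      IntegrableOn (fun p => inner ℝ (f p) (Φ p)) (future ∩ Metric.ball 0 R) := by
    refine ((hf R).norm.mul_const C).mono' ((hf R).aestronglyMeasurable.inner
      ((h.cont.mono inter_subset_left).aestronglyMeasurable
        (measurableSet_future_inter_ball R))) ?_
    filter_upwards [ae_restrict_mem (measurableSet_future_inter_ball R)] with p hp
    exact (norm_inner_le_norm _ _).trans (by gcongr; exact hC _ hp.1)
  refine integrable_ball.of_forall_sdiff_eq_zero measurableSet_future fun p hp => ?_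
  rw [hR p hp.1 (not_lt.1 fun hlt => hp.2 ⟨hp.1, mem_ball_zero_iff.2 hlt⟩), inner_zero_right]

lemma add_time_mem_future {ε : ℝ} (hε : 0 < ε) {p : ST} (hp : p ∈ future) :
    p + (ε, 0) ∈ future :=
  mem_future.2 (by simpa using add_pos (mem_future.1 hp) hε)

lemma norm_le_norm_add_time {ε : ℝ} (hε : 0 < ε) {p : ST} (hp : 0 ≤ p.1) :
    ‖p‖ ≤ ‖p + (ε, 0)‖ := by
  simp only [Prod.norm_def, Prod.fst_add, Prod.snd_add, add_zero, Real.norm_eq_abs]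
  gcongr
  linarith

lemma tendsto_add_time (p : ST) :
    Tendsto (fun ε : ℝ => p + (ε, (0 : R3))) (𝓝[>] 0) (𝓝 p) := by
  have at_zero : Tendsto (fun ε : ℝ => p + (ε, (0 : R3))) (𝓝 0) (𝓝 (p + (0, 0))) :=
    ContinuousAt.tendsto (by fun_prop)
  rw [Prod.mk_zero_zero, add_zero] at at_zero
  exact at_zero.mono_left nhdsWithin_le_nhds

lemma IsHalfCont.tendsto_integral_inner_of_shift {Φ : ST → V} (h : IsHalfCont Φ) {f : ST → V}
    (hf : LocIntegrable f) {Ψ : ℝ → ST → V}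
    (hΨ : ∀ ε > 0, ∀ p ∈ future, Ψ ε p = Φ (p + (ε, 0))) :
    Tendsto (fun ε => ∫ p in future, inner ℝ (f p) (Ψ ε p)) (𝓝[>] 0)
      (𝓝 (∫ p in future, inner ℝ (f p) (Φ p))) := by
  obtain ⟨C, hC⟩ := h.bounded
  obtain ⟨R, hR⟩ := h.support
  have hs := measurableSet_future_inter_ball R
  have on_ball : ∀ ε > 0, ∫ p in future, inner ℝ (f p) (Ψ ε p)
      = ∫ p in future ∩ Metric.ball 0 R, inner ℝ (f p) (Φ (p + (ε, 0))) := by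
    intro ε hε
    rw [setIntegral_future_eq_ball fun p hp hn => ?_]
    · exact setIntegral_congr_fun hs fun p hp => by simp only [hΨ ε hε p hp.1]
    · rw [hΨ ε hε p hp, hR _ (add_time_mem_future hε hp)
        (hn.trans (norm_le_norm_add_time hε (mem_future.1 hp).le)), inner_zero_right]
  rw [setIntegral_future_eq_ball fun p hp hn => by rw [hR p hp hn, inner_zero_right]]
  refine Tendsto.congr' (eventually_mem_nhdsWithin.mono fun ε hε => (on_ball ε hε).symm) ?_
  refine tendsto_integral_filter_of_dominated_convergence (fun p => ‖f p‖ * C) ?_ ?_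
    ((hf R).norm.mul_const C) ?_
  · filter_upwards [self_mem_nhdsWithin] with ε hε
    refine (hf R).aestronglyMeasurable.inner (ContinuousOn.aestronglyMeasurable ?_ hs)
    exact h.cont.comp (by fun_prop) fun p hp => add_time_mem_future hε hp.1
  · filter_upwards [self_mem_nhdsWithin] with ε hε
    filter_upwards [ae_restrict_mem hs] with p hp
    exact (norm_inner_le_norm _ _).trans (by gcongr; exact hC _ (add_time_mem_future hε hp.1))
  · filter_upwards [ae_restrict_mem hs] with p hp
    exact tendsto_const_nhds.inner
      ((h.cont.continuousAt (isOpen_future.mem_nhds hp.1)).tendsto.comp (tendsto_add_time p))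

lemma IsHalfCont.tendsto_integral_initial {Φ : ST → V} (h : IsHalfCont Φ) {f Φ₀ : R3 → V}
    (hf : Continuous f) (h0 : ∀ x, Tendsto (fun t : ℝ => Φ (t, x)) (𝓝[>] 0) (𝓝 (Φ₀ x))) :
    Tendsto (fun t : ℝ => ∫ x, inner ℝ (f x) (Φ (t, x))) (𝓝[>] 0)
      (𝓝 (∫ x, inner ℝ (f x) (Φ₀ x))) := by
  obtain ⟨C, hC⟩ := h.bounded
  obtain ⟨R, hR⟩ := h.support
  have hi : Integrable ((Metric.ball (0 : R3) R).indicator fun x => ‖f x‖ * C) := by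
    rw [integrable_indicator_iff measurableSet_ball]
    exact ((hf.norm.mul continuous_const).continuousOn.integrableOn_compact
      (isCompact_closedBall (0 : R3) R)).mono_set Metric.ball_subset_closedBall
  refine tendsto_integral_filter_of_dominated_convergence _ ?_ ?_ hi ?_
  · filter_upwards [self_mem_nhdsWithin] with t (ht : 0 < t)
    refine (hf.inner (h.cont.comp_continuous ?_ fun x => mem_future.2 ht)).aestronglyMeasurable
    fun_prop
  · filter_upwards [self_mem_nhdsWithin] with t (ht : 0 < t)
    refine ae_of_all _ fun x => ?_
    by_cases hx : x ∈ Metric.ball (0 : R3) R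
    · rw [indicator_of_mem hx]
      exact (norm_inner_le_norm _ _).trans (by gcongr; exact hC _ (mem_future.2 ht))
    · rw [indicator_of_notMem hx, hR _ (mem_future.2 ht), inner_zero_right, norm_zero]
      exact (not_lt.1 (by simpa using hx)).trans (norm_snd_le ((t, x) : ST))
  · exact ae_of_all _ fun x => tendsto_const_nhds.inner (h0 x)

/-! ### Translating half tests into test functions -/

/-- Translation in time by `ε`, with a cutoff in `t < 0`. -/
def shift (ε : ℝ) (Ψ : ST → F) (p : ST) : F :=
  Real.smoothTransition (4 / ε * p.1 + 2) • Ψ (p + (ε, 0))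

lemma shift_eq {ε : ℝ} (hε : 0 < ε) (Ψ : ST → F) {p : ST} (hp : 0 ≤ p.1) :
    shift ε Ψ p = Ψ (p + (ε, 0)) := by
  rw [shift, Real.smoothTransition.one_of_one_le, one_smul]
  have : 0 ≤ 4 / ε * p.1 := by positivity
  linarith

lemma shift_eq_zero {ε : ℝ} (hε : 0 < ε) (Ψ : ST → F) {p : ST} (hp : p.1 ≤ -ε / 2) :
    shift ε Ψ p = 0 := by
  rw [shift, Real.smoothTransition.zero_of_nonpos, zero_smul]
  calc 4 / ε * p.1 + 2 ≤ 4 / ε * (-ε / 2) + 2 := by gcongr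
    _ = 0 := by field_simp; norm_num

lemma fderiv_shift {ε : ℝ} (hε : 0 < ε) (Ψ : ST → F) {p : ST} (hp : p ∈ future) :
    fderiv ℝ (shift ε Ψ) p = fderiv ℝ Ψ (p + (ε, 0)) := by
  have : shift ε Ψ =ᶠ[𝓝 p] fun q => Ψ (q + (ε, 0)) := by
    filter_upwards [isOpen_future.mem_nhds hp] with q hq
    exact shift_eq hε Ψ (mem_future.1 hq).le
  rw [this.fderiv_eq, fderiv_comp_add_right]

lemma IsHalfTest.contDiff_shift {ε : ℝ} (hε : 0 < ε) {Ψ : ST → F} (h : IsHalfTest Ψ) :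
    ContDiff ℝ ∞ (shift ε Ψ) := by
  rw [contDiff_iff_contDiffAt]
  intro p
  by_cases hp : -ε < p.1
  · have hp' : p + (ε, 0) ∈ future := mem_future.2 (by simp; linarith)
    have cutoff : ContDiff ℝ ∞ fun q : ST => Real.smoothTransition (4 / ε * q.1 + 2) :=
      Real.smoothTransition.contDiff.comp (by fun_prop)
    exact cutoff.contDiffAt.smul
      (((h.smooth _ hp').contDiffAt (isOpen_future.mem_nhds hp')).comp p (by fun_prop))
  · have : shift ε Ψ =ᶠ[𝓝 p] fun _ => 0 := by
      filter_upwards [(isOpen_lt continuous_fst continuous_const).mem_nhds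
        (show p.1 < -ε / 2 by linarith)] with q hq
      exact shift_eq_zero hε Ψ (le_of_lt hq)
    exact contDiffAt_const.congr_of_eventuallyEq this

lemma IsHalfTest.hasCompactSupport_shift {ε : ℝ} (hε : 0 < ε) {Ψ : ST → F} (h : IsHalfTest Ψ) :
    HasCompactSupport (shift ε Ψ) := by
  obtain ⟨R, hR⟩ := h.support
  refine HasCompactSupport.of_support_subset_isCompact
    (isCompact_closedBall (0 : ST) (|R| + ε)) fun p hp => ?_
  rw [mem_closedBall_zero_iff]
  by_contra! hn
  apply hp
  by_cases hp0 : -ε < p.1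
  · have hp' : p + (ε, 0) ∈ future := mem_future.2 (by simp; linarith)
    have h1 : ‖p‖ ≤ ‖p + (ε, 0)‖ + ‖((ε, 0) : ST)‖ := norm_le_add_norm_add _ _
    have h2 : ‖((ε, 0) : ST)‖ = ε := by simp [Prod.norm_def, abs_of_pos hε, hε.le]
    rw [shift, hR _ hp' (by linarith [le_abs_self R]), smul_zero]
  · exact shift_eq_zero hε Ψ (by linarith)

lemma IsHalfTest.isTest_shift {ε : ℝ} (hε : 0 < ε) {Ψ : ST → F} (h : IsHalfTest Ψ) :
    IsTest (shift ε Ψ) :=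
  ⟨h.contDiff_shift hε, h.hasCompactSupport_shift hε⟩

/-! ### Weak balance laws -/

/-- The pairing of fields with the first-order derivatives of a test function. -/
def pairing (a b c : ST → R3) (g : Fin 3 → ST → R3) (Φ : ST → R3) (p : ST) : ℝ :=
  inner ℝ (a p) (dt Φ p) + inner ℝ (b p) (curl Φ p) + inner ℝ (c p) (Φ p)
    + ∑ i, inner ℝ (g i p) (dx i Φ p)

section Pairing

variable {a b c Ψ : ST → R3} {g : Fin 3 → ST → R3} {u₀ : R3 → R3}

lemma IsHalfTest.integrableOn_pairing (h : IsHalfTest Ψ) (ha : LocIntegrable a)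
    (hb : LocIntegrable b) (hc : LocIntegrable c) (hg : ∀ i, LocIntegrable (g i)) :
    IntegrableOn (pairing a b c g Ψ) future :=
  (((h.halfCont_dt.integrable_inner ha).add (h.halfCont_curl.integrable_inner hb)).add
      (h.halfCont.integrable_inner hc)).add
    (integrable_finsetSum _ fun i _ => (h.halfCont_dx i).integrable_inner (hg i))

lemma IsHalfTest.integral_pairing (h : IsHalfTest Ψ) (ha : LocIntegrable a)
    (hb : LocIntegrable b) (hc : LocIntegrable c) (hg : ∀ i, LocIntegrable (g i)) :
    ∫ p in future, pairing a b c g Ψ p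
      = (∫ p in future, inner ℝ (a p) (dt Ψ p)) + (∫ p in future, inner ℝ (b p) (curl Ψ p))
        + (∫ p in future, inner ℝ (c p) (Ψ p))
        + ∑ i, ∫ p in future, inner ℝ (g i p) (dx i Ψ p) := by
  have hia := h.halfCont_dt.integrable_inner ha
  have hib := h.halfCont_curl.integrable_inner hb
  have hic := h.halfCont.integrable_inner hc
  have hig := fun i => (h.halfCont_dx i).integrable_inner (hg i)
  have hab : IntegrableOn (fun p => inner ℝ (a p) (dt Ψ p) + inner ℝ (b p) (curl Ψ p)) future :=
    hia.add hib
  have habc : IntegrableOn (fun p => inner ℝ (a p) (dt Ψ p) + inner ℝ (b p) (curl Ψ p)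
      + inner ℝ (c p) (Ψ p)) future := hab.add hic
  simp only [pairing]
  rw [integral_add habc (integrable_finsetSum _ fun i _ => hig i), integral_add hab hic,
    integral_add hia hib, integral_finsetSum _ fun i _ => hig i]

lemma IsHalfTest.tendsto_integral_pairing_shift (h : IsHalfTest Ψ) (ha : LocIntegrable a)
    (hb : LocIntegrable b) (hc : LocIntegrable c) (hg : ∀ i, LocIntegrable (g i)) :
    Tendsto (fun ε => ∫ p in future, pairing a b c g (shift ε Ψ) p) (𝓝[>] 0)
      (𝓝 (∫ p in future, pairing a b c g Ψ p)) := by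
  have expand : ∀ᶠ ε in 𝓝[>] (0 : ℝ), _ = ∫ p in future, pairing a b c g (shift ε Ψ) p :=
    eventually_mem_nhdsWithin.mono fun ε hε =>
      ((h.isTest_shift hε).halfTest.integral_pairing ha hb hc hg).symm
  rw [h.integral_pairing ha hb hc hg]
  refine Tendsto.congr' expand ?_
  have fderiv_eq : ∀ ε > 0, ∀ p ∈ future, fderiv ℝ (shift ε Ψ) p = fderiv ℝ Ψ (p + (ε, 0)) :=
    fun ε hε p hp => fderiv_shift hε Ψ hp
  refine (((h.halfCont_dt.tendsto_integral_inner_of_shift ha fun ε hε p hp => ?_).add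
    (h.halfCont_curl.tendsto_integral_inner_of_shift hb fun ε hε p hp => ?_)).add
    (h.halfCont.tendsto_integral_inner_of_shift hc fun ε hε p hp => ?_)).add
    (tendsto_finsetSum _ fun i _ =>
      (h.halfCont_dx i).tendsto_integral_inner_of_shift (hg i) fun ε hε p hp => ?_)
  · simp only [dt, fderiv_eq ε hε p hp]
  · simp only [curl_eq_curlL, fderiv_eq ε hε p hp]
  · exact shift_eq hε Ψ (mem_future.1 hp).le
  · simp only [dx, fderiv_eq ε hε p hp]

/-- The weak form of the balance law `-∂ₜ a + curl b + c - ∑ᵢ ∂ᵢ gᵢ = 0` on the half space, with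
initial value `-a(0) = u₀`, for locally integrable fields. -/
structure IsWeakBalance (a b c : ST → R3) (g : Fin 3 → ST → R3) (u₀ : R3 → R3) : Prop where
  locIntegrable_a : LocIntegrable a
  locIntegrable_b : LocIntegrable b
  locIntegrable_c : LocIntegrable c
  locIntegrable_g : ∀ i, LocIntegrable (g i)
  integral_pairing : ∀ Φ : ST → R3, IsTest Φ →
    ∫ p in future, pairing a b c g Φ p = ∫ x, inner ℝ (u₀ x) (Φ (0, x))

lemma IsWeakBalance.of_split (ha : LocIntegrable a) (hb : LocIntegrable b) (hc : LocIntegrable c)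
    (hg : ∀ i, LocIntegrable (g i))
    (H : ∀ Φ : ST → R3, IsTest Φ →
      (∫ p in future, inner ℝ (a p) (dt Φ p)) + (∫ p in future, inner ℝ (b p) (curl Φ p))
        + (∫ p in future, inner ℝ (c p) (Φ p)) + ∑ i, ∫ p in future, inner ℝ (g i p) (dx i Φ p)
        = ∫ x, inner ℝ (u₀ x) (Φ (0, x))) : IsWeakBalance a b c g u₀ :=
  ⟨ha, hb, hc, hg, fun Φ hΦ => (hΦ.halfTest.integral_pairing ha hb hc hg).trans (H Φ hΦ)⟩

lemma IsWeakBalance.integral_pairing_halfTest (H : IsWeakBalance a b c g u₀) (h : IsHalfTest Ψ)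
    {A : ℝ} (h0 : Tendsto (fun t : ℝ => ∫ x, inner ℝ (u₀ x) (Ψ (t, x))) (𝓝[>] 0) (𝓝 A)) :
    ∫ p in future, pairing a b c g Ψ p = A := by
  refine tendsto_nhds_unique (h.tendsto_integral_pairing_shift H.locIntegrable_a
    H.locIntegrable_b H.locIntegrable_c H.locIntegrable_g) (h0.congr' ?_)
  filter_upwards [self_mem_nhdsWithin] with ε (hε : 0 < ε)
  rw [H.integral_pairing _ (h.isTest_shift hε)]
  refine integral_congr_ae (ae_of_all _ fun x => ?_)
  simp [shift_eq hε Ψ (p := (0, x)) le_rfl]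

end Pairing

/-! ### Weights in time and cutoffs in space -/

/-- Decreasing weights in time that vanish after time `S` and decay at rate `lam` at least. -/
structure IsTimeWeight (S lam : ℝ) (ζ : ℝ → ℝ) : Prop where
  smooth : ContDiff ℝ ∞ ζ
  zero : ∀ t, S ≤ t → ζ t = 0
  pos : ∀ t, t < S → 0 < ζ t
  decay : ∀ t, 0 < t → t < S → lam * ζ t ≤ - deriv ζ t

lemma hasDerivAt_expNegInvGlue (x : ℝ) :
    HasDerivAt expNegInvGlue (x⁻¹ ^ 2 * expNegInvGlue x) x := by
  simpa using expNegInvGlue.hasDerivAt_polynomial_eval_inv_mul 1 x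

lemma exists_isTimeWeight {S lam : ℝ} (hS : 0 < S) (hl : 0 < lam) :
    ∃ ζ : ℝ → ℝ, IsTimeWeight S lam ζ := by
  -- `ζ t = exp (-k / (S - t))` before `S`, so that `-ζ' = k ζ / (S - t) ^ 2`
  let k := lam * S ^ 2
  have hk : 0 < k := by positivity
  refine ⟨fun t => expNegInvGlue ((S - t) / k), ?_, fun t ht => ?_, fun t ht => ?_,
    fun t ht0 ht => ?_⟩
  · exact expNegInvGlue.contDiff.comp (by fun_prop)
  · exact expNegInvGlue.zero_of_nonpos (div_nonpos_of_nonpos_of_nonneg (by linarith) hk.le)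
  · exact expNegInvGlue.pos_of_pos (div_pos (by linarith) hk)
  · have hst : 0 < S - t := by linarith
    have inner_deriv : HasDerivAt (fun s : ℝ => (S - s) / k) (-1 / k) t :=
      ((hasDerivAt_id t).const_sub S).div_const k
    have outer_deriv := (hasDerivAt_expNegInvGlue _).comp t inner_deriv
    rw [Function.comp_def] at outer_deriv
    rw [outer_deriv.deriv]
    have rate : lam ≤ k / (S - t) ^ 2 := by
      rw [le_div_iff₀ (by positivity)]
      exact mul_le_mul_of_nonneg_left (by gcongr; linarith) hl.le
    calc lam * expNegInvGlue ((S - t) / k)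
        ≤ k / (S - t) ^ 2 * expNegInvGlue ((S - t) / k) :=
          mul_le_mul_of_nonneg_right rate (expNegInvGlue.nonneg _)
      _ = -(((S - t) / k)⁻¹ ^ 2 * expNegInvGlue ((S - t) / k) * (-1 / k)) := by
          field_simp

namespace IsTimeWeight

variable {S lam : ℝ} {ζ : ℝ → ℝ}

lemma nonneg (h : IsTimeWeight S lam ζ) (t : ℝ) : 0 ≤ ζ t := by
  rcases lt_or_ge t S with ht | ht
  · exact (h.pos t ht).le
  · exact (h.zero t ht).ge

lemma hasDerivAt (h : IsTimeWeight S lam ζ) (t : ℝ) : HasDerivAt ζ (deriv ζ t) t :=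
  (h.smooth.differentiable (by simp) t).hasDerivAt

lemma continuous_deriv (h : IsTimeWeight S lam ζ) : Continuous (deriv ζ) :=
  h.smooth.continuous_deriv (by simp)

lemma neg_deriv_nonneg (h : IsTimeWeight S lam ζ) (hl : 0 ≤ lam) {t : ℝ} (h0 : 0 < t)
    (ht : t < S) : 0 ≤ - deriv ζ t :=
  (mul_nonneg hl (h.nonneg t)).trans (h.decay t h0 ht)

lemma exists_bound (h : IsTimeWeight S lam ζ) :
    ∃ C : ℝ, 0 ≤ C ∧ ∀ t, 0 ≤ t → t ≤ S → |ζ t| ≤ C ∧ |deriv ζ t| ≤ C := by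
  obtain ⟨C, hC⟩ := (isCompact_Icc (a := 0) (b := S)).exists_bound_of_continuousOn
    h.smooth.continuous.continuousOn
  obtain ⟨D, hD⟩ := (isCompact_Icc (a := 0) (b := S)).exists_bound_of_continuousOn
    h.continuous_deriv.continuousOn
  exact ⟨max 0 (max C D), le_max_left _ _, fun t h0 ht =>
    ⟨(hC t ⟨h0, ht⟩).trans (by simp), (hD t ⟨h0, ht⟩).trans (by simp)⟩⟩

lemma integral_neg_deriv (h : IsTimeWeight S lam ζ) (s : ℝ) :
    ∫ t in s..S, - deriv ζ t = ζ s := by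
  rw [intervalIntegral.integral_neg, intervalIntegral.integral_eq_sub_of_hasDerivAt
    (fun t _ => h.hasDerivAt t) (h.continuous_deriv.intervalIntegrable _ _), h.zero S le_rfl]
  ring

end IsTimeWeight

/-- The partial derivative `∂ᵢ θ` of a scalar function on `ℝ³`. -/
def pdScalar (i : Fin 3) (θ : R3 → ℝ) (x : R3) : ℝ := fderiv ℝ θ x (e i)

/-- The gradient of a scalar function on `ℝ³`. -/
def grad (θ : R3 → ℝ) (x : R3) : R3 := !₂[pdScalar 0 θ x, pdScalar 1 θ x, pdScalar 2 θ x]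

/-- The product of a function with a weight in time and a weight in space. -/
def localize (ζ : ℝ → ℝ) (θ : R3 → ℝ) (v : ST → F) (p : ST) : F := (ζ p.1 * θ p.2) • v p

section Localize

variable {S T lam : ℝ} {ζ : ℝ → ℝ} {θ : R3 → ℝ} {v : ST → F} {p : ST}

lemma bddSmooth_weight (hζ : ContDiff ℝ ∞ ζ) (hθ : ContDiff ℝ ∞ θ) (hc : HasCompactSupport θ)
    (T : ℝ) : BddSmooth T (fun p : ST => ζ p.1 * θ p.2) := by
  have hs : ContDiff ℝ ∞ (fun p : ST => ζ p.1 * θ p.2) :=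
    (hζ.comp contDiff_fst).mul (hθ.comp contDiff_snd)
  refine ⟨hs.contDiffOn, fun T' _ n => ?_⟩
  obtain ⟨C, hC⟩ := (isCompact_Icc (a := 0) (b := T')).prod hc.isCompact
    |>.exists_bound_of_continuousOn
      (hs.continuous_iteratedFDeriv (m := n) (by exact_mod_cast le_top)).continuousOn
  refine ⟨max C 0, fun p hp => ?_⟩
  by_cases hx : p.2 ∈ tsupport θ
  · exact (hC p ⟨⟨(mem_slab.1 hp).1.le, (mem_slab.1 hp).2.le⟩, hx⟩).trans (le_max_left _ _)
  · have : (fun q : ST => ζ q.1 * θ q.2) =ᶠ[𝓝 p] fun _ => 0 := by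
      have h1 := notMem_tsupport_iff_eventuallyEq.1 hx
      filter_upwards [continuous_snd.continuousAt.eventually h1] with q hq
      simp [hq]
    rw [this.iteratedFDeriv ℝ n |>.eq_of_nhds]
    rcases n with _ | n <;> simp

lemma BddSmooth.localize (hv : BddSmooth T v) (hζ : ContDiff ℝ ∞ ζ) (hθ : ContDiff ℝ ∞ θ)
    (hc : HasCompactSupport θ) : BddSmooth T (localize ζ θ v) :=
  (bddSmooth_weight hζ hθ hc T).bilin hv (ContinuousLinearMap.lsmul ℝ ℝ)

lemma localize_eq_zero (hζ : IsTimeWeight S lam ζ) (hp : S ≤ p.1) : localize ζ θ v p = 0 := by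
  simp [localize, hζ.zero _ hp]

lemma localize_eventuallyEq_zero (hζ : IsTimeWeight S lam ζ) (hp : S < p.1) :
    localize ζ θ v =ᶠ[𝓝 p] fun _ => 0 := by
  filter_upwards [(isOpen_lt continuous_const continuous_fst).mem_nhds hp] with q hq
  exact localize_eq_zero hζ (le_of_lt hq)

lemma fderiv_localize_eq_zero (hζ : IsTimeWeight S lam ζ) (hp : S < p.1) :
    fderiv ℝ (localize ζ θ v) p = 0 := by
  rw [(localize_eventuallyEq_zero hζ hp).fderiv_eq]; simp

lemma exists_localize_eq_zero_of_norm_ge (hζ : IsTimeWeight S lam ζ) (hc : HasCompactSupport θ) :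
    ∃ R : ℝ, ∀ p ∈ future, R ≤ ‖p‖ → localize ζ θ v p = 0 := by
  obtain ⟨R, hR⟩ := hc.isCompact.isBounded.subset_ball (0 : R3)
  refine ⟨max R S, fun p hp hn => ?_⟩
  rw [Prod.norm_def, Real.norm_eq_abs, abs_of_pos (mem_future.1 hp), max_le_iff, le_max_iff,
    le_max_iff] at hn
  rcases le_or_gt S p.1 with hS | hS
  · exact localize_eq_zero hζ hS
  · have hx : p.2 ∉ tsupport θ := fun h => by
      have := mem_ball_zero_iff.1 (hR h)
      rcases hn with ⟨h1 | h1, h2 | h2⟩ <;> linarith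
    simp [localize, image_eq_zero_of_notMem_tsupport hx]

lemma isHalfTest_localize (hST : S < T) (hv : BddSmooth T v) (hζ : IsTimeWeight S lam ζ)
    (hθ : ContDiff ℝ ∞ θ) (hc : HasCompactSupport θ) : IsHalfTest (localize ζ θ v) := by
  have hb := hv.localize hζ.smooth hθ hc
  obtain ⟨T', hT', hT''⟩ := exists_between hST
  refine ⟨fun p hp => ?_, ?_, exists_localize_eq_zero_of_norm_ge hζ hc⟩
  · rcases lt_or_ge p.1 T with h | h
    · exact (hb.contDiffAt (mem_slab.2 ⟨mem_future.1 hp, h⟩)).contDiffWithinAt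
    · exact (contDiffAt_const.congr_of_eventuallyEq
        (localize_eventuallyEq_zero hζ (hST.trans_le h))).contDiffWithinAt
  · obtain ⟨C, hC0, hC⟩ := hb.exists_bound hT''
    obtain ⟨D, -, hD⟩ := hb.exists_bound_fderiv hT''
    refine ⟨max C D, fun p hp => ?_⟩
    rcases lt_or_ge p.1 T' with h | h
    · have hp' := mem_slab.2 ⟨mem_future.1 hp, h⟩
      exact ⟨(hC p hp').trans (le_max_left _ _), (hD p hp').trans (le_max_right _ _)⟩
    · rw [localize_eq_zero hζ (hT'.le.trans h), fderiv_localize_eq_zero hζ (hT'.trans_le h)]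
      simp [hC0]

lemma hasFDerivAt_weight (hζ : ContDiff ℝ ∞ ζ) (hθ : ContDiff ℝ ∞ θ) (p : ST) :
    HasFDerivAt (fun p : ST => ζ p.1 * θ p.2)
      (ζ p.1 • (fderiv ℝ θ p.2).comp (ContinuousLinearMap.snd ℝ ℝ R3)
        + θ p.2 • (deriv ζ p.1 • ContinuousLinearMap.fst ℝ ℝ R3)) p := by
  have time : HasFDerivAt (fun p : ST => ζ p.1) (deriv ζ p.1 • ContinuousLinearMap.fst ℝ ℝ R3) p :=
    (hζ.differentiable (by simp) p.1).hasDerivAt.comp_hasFDerivAt p hasFDerivAt_fst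
  have space : HasFDerivAt (fun p : ST => θ p.2)
      ((fderiv ℝ θ p.2).comp (ContinuousLinearMap.snd ℝ ℝ R3)) p :=
    (hθ.differentiable (by simp) p.2).hasFDerivAt.comp p hasFDerivAt_snd
  exact time.mul space

lemma dt_localize (hζ : ContDiff ℝ ∞ ζ) (hθ : ContDiff ℝ ∞ θ) (hv : DifferentiableAt ℝ v p) :
    dt (localize ζ θ v) p = (deriv ζ p.1 * θ p.2) • v p + (ζ p.1 * θ p.2) • dt v p := by
  have h := hasFDerivAt_weight hζ hθ p
  refine (dt_bilin (ContinuousLinearMap.lsmul ℝ ℝ) h.differentiableAt hv).trans ?_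
  simp [dt, h.fderiv, mul_comm]

lemma dx_localize (hζ : ContDiff ℝ ∞ ζ) (hθ : ContDiff ℝ ∞ θ) (hv : DifferentiableAt ℝ v p)
    (i : Fin 3) :
    dx i (localize ζ θ v) p = (ζ p.1 * pdScalar i θ p.2) • v p + (ζ p.1 * θ p.2) • dx i v p := by
  have h := hasFDerivAt_weight hζ hθ p
  refine (dx_bilin i (ContinuousLinearMap.lsmul ℝ ℝ) h.differentiableAt hv).trans ?_
  simp [dx, h.fderiv, pdScalar]

lemma curl_localize {v : ST → R3} (hζ : ContDiff ℝ ∞ ζ) (hθ : ContDiff ℝ ∞ θ)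
    (hv : DifferentiableAt ℝ v p) :
    curl (localize ζ θ v) p
      = (ζ p.1 * θ p.2) • curl v p + ζ p.1 • cross (grad θ p.2) (v p) := by
  simp only [curl, dx_localize hζ hθ hv]
  apply ext_coords <;> simp [grad] <;> ring

lemma setIntegral_future_eq_slab {f : ST → F} (hf : ∀ p : ST, S < p.1 → f p = 0) :
    ∫ p in future, f p = ∫ p in slab S, f p := by
  have null_slice : ∀ᵐ p ∂(volume : Measure ST), p.1 ≠ S := by
    rw [ae_iff]
    have : {p : ST | ¬ p.1 ≠ S} = {S} ×ˢ univ := by ext p; simp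
    rw [this, Measure.volume_eq_prod, Measure.prod_prod]; simp
  refine setIntegral_eq_of_subset_of_ae_sdiff_eq_zero
    measurableSet_future.nullMeasurableSet (slab_subset_future S) ?_
  filter_upwards [null_slice] with p hp hm
  refine hf p (lt_of_not_ge fun hle => hm.2 (mem_slab.2 ⟨mem_future.1 hm.1, ?_⟩))
  exact lt_of_le_of_ne hle hp

end Localize

section LocalizedBalance

variable {S T lam : ℝ} {ζ : ℝ → ℝ} {θ : R3 → ℝ} {a b c v : ST → R3} {g : Fin 3 → ST → R3}
  {u₀ v₀ : R3 → R3}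

lemma tendsto_integral_localize_initial (hST : S < T) (hv : BddSmooth T v)
    (hζ : IsTimeWeight S lam ζ) (hθ : ContDiff ℝ ∞ θ) (hcs : HasCompactSupport θ)
    (hu : Continuous u₀) (h0 : ∀ x, Tendsto (fun t : ℝ => v (t, x)) (𝓝[>] 0) (𝓝 (v₀ x))) :
    Tendsto (fun t : ℝ => ∫ x, inner ℝ (u₀ x) (localize ζ θ v (t, x))) (𝓝[>] 0)
      (𝓝 (ζ 0 * ∫ x, θ x * inner ℝ (u₀ x) (v₀ x))) := by
  have slice : ∀ x, Tendsto (fun t : ℝ => localize ζ θ v (t, x)) (𝓝[>] 0)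
      (𝓝 ((ζ 0 * θ x) • v₀ x)) := fun x =>
    (((hζ.smooth.continuous.tendsto 0).mono_left nhdsWithin_le_nhds).mul_const _).smul (h0 x)
  have := (isHalfTest_localize hST hv hζ hθ hcs).halfCont.tendsto_integral_initial hu slice
  simpa only [real_inner_smul_right, mul_assoc, integral_const_mul] using this

lemma IsWeakBalance.integrableOn_pairing_localize (H : IsWeakBalance a b c g u₀) (hST : S < T)
    (hv : BddSmooth T v) (hζ : IsTimeWeight S lam ζ) (hθ : ContDiff ℝ ∞ θ)
    (hcs : HasCompactSupport θ) : IntegrableOn (pairing a b c g (localize ζ θ v)) (slab S) :=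
  ((isHalfTest_localize hST hv hζ hθ hcs).integrableOn_pairing H.locIntegrable_a H.locIntegrable_b
    H.locIntegrable_c H.locIntegrable_g).mono_set (slab_subset_future S)

lemma IsWeakBalance.integral_pairing_localize_of_tendsto (H : IsWeakBalance a b c g u₀)
    (hST : S < T) (hv : BddSmooth T v) (hζ : IsTimeWeight S lam ζ) (hθ : ContDiff ℝ ∞ θ)
    (hcs : HasCompactSupport θ) {A : ℝ}
    (h0 : Tendsto (fun t : ℝ => ∫ x, inner ℝ (u₀ x) (localize ζ θ v (t, x))) (𝓝[>] 0) (𝓝 A)) :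
    ∫ p in slab S, pairing a b c g (localize ζ θ v) p = A := by
  rw [← setIntegral_future_eq_slab fun p hp => ?_]
  · exact H.integral_pairing_halfTest (isHalfTest_localize hST hv hζ hθ hcs) h0
  · simp [pairing, dt, dx, curl_eq_curlL, fderiv_localize_eq_zero (θ := θ) (v := v) hζ hp,
      localize_eq_zero (θ := θ) (v := v) hζ hp.le]

lemma IsWeakBalance.integral_pairing_localize (H : IsWeakBalance a b c g u₀) (hu : Continuous u₀)
    (hST : S < T) (hv : BddSmooth T v) (hζ : IsTimeWeight S lam ζ) (hθ : ContDiff ℝ ∞ θ)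
    (hcs : HasCompactSupport θ)
    (h0 : ∀ x, Tendsto (fun t : ℝ => v (t, x)) (𝓝[>] 0) (𝓝 (v₀ x))) :
    ∫ p in slab S, pairing a b c g (localize ζ θ v) p
      = ζ 0 * ∫ x, θ x * inner ℝ (u₀ x) (v₀ x) :=
  H.integral_pairing_localize_of_tendsto hST hv hζ hθ hcs
    (tendsto_integral_localize_initial hST hv hζ hθ hcs hu h0)

lemma IsWeakBalance.integral_pairing_localize_eq_zero (H : IsWeakBalance a b c g fun _ => 0)
    (hST : S < T) (hv : BddSmooth T v) (hζ : IsTimeWeight S lam ζ) (hθ : ContDiff ℝ ∞ θ)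
    (hcs : HasCompactSupport θ) : ∫ p in slab S, pairing a b c g (localize ζ θ v) p = 0 :=
  H.integral_pairing_localize_of_tendsto hST hv hζ hθ hcs (by simp)

end LocalizedBalance

/-! ### Restriction to lines and to time slices -/

section Slices

variable {u : ST → F} {t : ℝ} {x : R3}

lemma hasDerivAt_time (h : DifferentiableAt ℝ u (t, x)) :
    HasDerivAt (fun s => u (s, x)) (dt u (t, x)) t :=
  h.hasFDerivAt.comp_hasDerivAt t ((hasDerivAt_id t).prodMk (hasDerivAt_const t x))

lemma hasFDerivAt_space (h : DifferentiableAt ℝ u (t, x)) :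
    HasFDerivAt (fun y => u (t, y))
      ((fderiv ℝ u (t, x)).comp (ContinuousLinearMap.inr ℝ ℝ R3)) x :=
  h.hasFDerivAt.comp x (hasFDerivAt_prodMk_right t x)

lemma dx_eq_fderiv_space (h : DifferentiableAt ℝ u (t, x)) (i : Fin 3) :
    dx i u (t, x) = fderiv ℝ (fun y => u (t, y)) x (e i) := by
  simp [dx, (hasFDerivAt_space h).fderiv]

lemma hasDerivAt_line {s : ℝ} {i : Fin 3} (h : DifferentiableAt ℝ u (t, x + s • e i)) :
    HasDerivAt (fun r : ℝ => u (t, x + r • e i)) (dx i u (t, x + s • e i)) s := by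
  have line : HasDerivAt (fun r : ℝ => (t, x + r • e i)) ((0, e i) : ST) s := by
    refine (hasDerivAt_const s t).prodMk ?_
    simpa using ((hasDerivAt_id s).smul_const (e i)).const_add x
  exact h.hasFDerivAt.comp_hasDerivAt s line

lemma hasCompactSupport_slice {F : Type} [Zero F] {Ψ : ST → F} (h : HasCompactSupport Ψ) (t : ℝ) :
    HasCompactSupport fun x : R3 => Ψ (t, x) :=
  HasCompactSupport.of_support_subset_isCompact (h.isCompact.image continuous_snd)
    fun x hx => ⟨(t, x), subset_tsupport _ hx, rfl⟩

lemma continuous_pd {u₀ : R3 → R3} (h : ContDiff ℝ ∞ u₀) (i : Fin 3) : Continuous (pd i u₀) :=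
  (h.continuous_fderiv (by simp)).clm_apply continuous_const

lemma IsTest.integrable_inner_slice {Ψ : ST → V} (h : IsTest Ψ) {f : R3 → V} (hf : Continuous f)
    (t : ℝ) : Integrable fun x => inner ℝ (f x) (Ψ (t, x)) :=
  (hf.inner (h.1.continuous.comp (by fun_prop))).integrable_of_hasCompactSupport
    ((hasCompactSupport_slice h.2 t).mono fun x hx h0 => hx (by simp [h0]))

lemma IsTest.integral_inner_dx_slice {Ψ : ST → R3} (h : IsTest Ψ) {u₀ : R3 → R3}
    (hu : ContDiff ℝ ∞ u₀) (i : Fin 3) (t : ℝ) :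
    ∫ x, inner ℝ (u₀ x) (dx i Ψ (t, x)) = - ∫ x, inner ℝ (pd i u₀ x) (Ψ (t, x)) := by
  have smooth_slice : ContDiff ℝ ∞ fun x : R3 => Ψ (t, x) := h.1.comp (by fun_prop)
  have hdx : ∀ x, fderiv ℝ (fun y : R3 => Ψ (t, y)) x (e i) = dx i Ψ (t, x) := fun x =>
    (dx_eq_fderiv_space (h.1.differentiable (by simp) (t, x)) i).symm
  have := integral_bilinear_fderiv_right_eq_neg_left_of_integrable (μ := volume) (f := u₀)
    (g := fun x : R3 => Ψ (t, x)) (v := e i) (B := innerSL ℝ)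
    (h.integrable_inner_slice (continuous_pd hu i) t)
    (by simp only [hdx]; exact (h.dx i).integrable_inner_slice hu.continuous t)
    (h.integrable_inner_slice hu.continuous t)
    (fun x _ => hu.differentiable (by simp) x) (fun x _ => smooth_slice.differentiable (by simp) x)
  simp only [hdx] at this
  exact this

end Slices

lemma BddSmooth.exists_taylor_bound {T : ℝ} {u : ST → F} (h : BddSmooth T u) {S : ℝ} (hS : S < T)
    (i : Fin 3) :
    ∃ C : ℝ, ∀ t x, 0 < t → t < S → ∀ s : ℝ, 0 ≤ s →
      ‖u (t, x + s • e i) - u (t, x) - s • dx i u (t, x)‖ ≤ C * s * s := by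
  obtain ⟨C, hC0, hC⟩ := ((h.dx i).dx i).exists_bound hS
  refine ⟨C, fun t x h0 ht s hs => ?_⟩
  have mem_T : ∀ y : R3, (t, y) ∈ slab T := fun y => mem_slab.2 ⟨h0, ht.trans hS⟩
  have dx_lipschitz : ∀ r ∈ Icc 0 s, ‖dx i u (t, x + r • e i) - dx i u (t, x)‖ ≤ C * r := by
    intro r hr
    have := norm_image_sub_le_of_norm_deriv_le_segment' (a := 0) (b := s) (C := C)
      (f := fun r : ℝ => dx i u (t, x + r • e i))
      (fun r _ => (hasDerivAt_line ((h.dx i).differentiableAt (mem_T _))).hasDerivWithinAt)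
      (fun r _ => hC _ (mem_slab.2 ⟨h0, ht⟩)) r hr
    simpa using this
  have remainder_deriv : ∀ r, HasDerivAt (fun r : ℝ => u (t, x + r • e i) - r • dx i u (t, x))
      (dx i u (t, x + r • e i) - dx i u (t, x)) r := fun r => by
    simpa using (hasDerivAt_line (x := x) (i := i) (h.differentiableAt (mem_T _))).fun_sub
      ((hasDerivAt_id r).smul_const (dx i u (t, x)))
  have := norm_image_sub_le_of_norm_deriv_le_segment' (a := 0) (b := s) (C := C * s)
    (fun r _ => (remainder_deriv r).hasDerivWithinAt)
    (fun r hr => (dx_lipschitz r ⟨hr.1, hr.2.le⟩).trans (by gcongr; exact hr.2.le)) s ⟨hs, le_rfl⟩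
  simpa [sub_right_comm] using this

lemma BddSmooth.tendstoUniformlyOnFilter_dx {T : ℝ} (hT : 0 < T) {u : ST → F} (h : BddSmooth T u)
    (i : Fin 3) (x : R3) :
    TendstoUniformlyOnFilter (fun s t : ℝ => s⁻¹ • (u (t, x + s • e i) - u (t, x)))
      (fun t => dx i u (t, x)) (𝓝[>] 0) (𝓝[>] 0) := by
  obtain ⟨C, hC⟩ := h.exists_taylor_bound (half_lt_self hT) i
  have error : Tendsto (fun s : ℝ => C * s) (𝓝[>] 0) (𝓝 0) := by
    simpa using (continuous_const_mul C).tendsto 0 |>.mono_left nhdsWithin_le_nhds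
  rw [Metric.tendstoUniformlyOnFilter_iff]
  intro ε hε
  filter_upwards [((error.eventually_lt_const hε).and self_mem_nhdsWithin).prod_mk
    (Ioo_mem_nhdsGT (half_pos hT))] with ⟨s, t⟩ ⟨⟨hsε, (hs : 0 < s)⟩, ht⟩
  rw [dist_comm, dist_eq_norm]
  calc ‖s⁻¹ • (u (t, x + s • e i) - u (t, x)) - dx i u (t, x)‖
      = s⁻¹ * ‖u (t, x + s • e i) - u (t, x) - s • dx i u (t, x)‖ := by
        rw [← norm_smul_of_nonneg (by positivity), smul_sub s⁻¹ (_ - _), smul_smul,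
          inv_mul_cancel₀ hs.ne', one_smul]
    _ ≤ s⁻¹ * (C * s * s) := by gcongr; exact hC t x ht.1 ht.2 s hs.le
    _ = C * s := by field_simp
    _ < ε := hsε

lemma IsSmoothUpTo.tendsto_dx {T : ℝ} {u : ST → R3} {u₀ : R3 → R3} (hT : 0 < T)
    (h : IsSmoothUpTo T u u₀) (hu₀ : ContDiff ℝ ∞ u₀) (i : Fin 3) (x : R3) :
    Tendsto (fun t : ℝ => dx i u (t, x)) (𝓝[>] 0) (𝓝 (pd i u₀ x)) := by
  have quotient₀ : Tendsto (fun s : ℝ => s⁻¹ • (u₀ (x + s • e i) - u₀ x)) (𝓝[>] 0)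
      (𝓝 (pd i u₀ x)) :=
    ((hu₀.differentiable (by simp) x).hasFDerivAt.hasLineDerivAt (e i)).tendsto_slope_zero_right
  refine (h.bddSmooth.tendstoUniformlyOnFilter_dx hT i x).tendsto_of_eventually_tendsto
    (Eventually.of_forall fun s => ?_) quotient₀
  exact ((h.initial _).sub (h.initial _)).const_smul _

/-! ### Weak solutions as weak balance laws -/

lemma locIntegrable_zero : LocIntegrable (fun _ : ST => (0 : R3)) := fun _ => integrableOn_zero

protected lemma LocIntegrable.neg {f : ST → R3} (h : LocIntegrable f) :
    LocIntegrable (fun p => - f p) :=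
  fun R => (h R).neg

lemma LocIntegrable.ite {f : ST → R3} (h : LocIntegrable f) (i j : Fin 3) :
    LocIntegrable (fun p => if j = i then f p else 0) := by
  by_cases hij : j = i
  · simpa [hij] using h
  · simpa [hij] using locIntegrable_zero

lemma memLp_cross {μ : Measure ST} {q r s : ℝ≥0∞} [q.HolderTriple r s] {f g : ST → R3}
    (hf : MemLp f q μ) (hg : MemLp g r μ) : MemLp (fun p => cross (f p) (g p)) s μ :=
  hf.of_bilin cross 1 hg (crossL.aestronglyMeasurable_comp₂ hf.1 hg.1) <|
    ae_of_all _ fun p => by simpa [← NNReal.coe_le_coe] using norm_cross_le (f p) (g p)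

namespace IsWeakSolutionWith

variable {m₀ E₀ H₀ : R3 → R3} {m E H mt : ST → R3} {G : Fin 3 → ST → R3}

lemma norm_m_slab (W : IsWeakSolutionWith m₀ E₀ H₀ m E H mt G) (S : ℝ) :
    ∀ᵐ p ∂(volume.restrict (slab S)), ‖m p‖ = 1 :=
  ae_restrict_of_ae_restrict_of_subset (slab_subset_future S) W.norm_m

lemma meas_m_slab (W : IsWeakSolutionWith m₀ E₀ H₀ m E H mt G) (S : ℝ) :
    AEStronglyMeasurable m (volume.restrict (slab S)) :=
  W.meas_m.mono_measure (Measure.restrict_mono (slab_subset_future S) le_rfl)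

lemma memLp_top_m (W : IsWeakSolutionWith m₀ E₀ H₀ m E H mt G) (S : ℝ) :
    MemLp m ⊤ (volume.restrict (slab S)) :=
  memLp_top_of_bound (W.meas_m_slab S) 1 ((W.norm_m_slab S).mono fun _ hp => hp.le)

lemma memLp_cross (W : IsWeakSolutionWith m₀ E₀ H₀ m E H mt G) {f : ST → R3} {S : ℝ} {q : ℝ≥0∞}
    (hf : MemLp f q (volume.restrict (slab S))) :
    MemLp (fun p => cross (m p) (f p)) q (volume.restrict (slab S)) :=
  MLL.memLp_cross (W.memLp_top_m S) hf

lemma locIntegrable_m (W : IsWeakSolutionWith m₀ E₀ H₀ m E H mt G) : LocIntegrable m :=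
  locIntegrable_of_memLp le_top fun S _ => W.memLp_top_m S

lemma locIntegrable_mt (W : IsWeakSolutionWith m₀ E₀ H₀ m E H mt G) : LocIntegrable mt :=
  locIntegrable_of_memLp one_le_two W.memLp_mt

lemma ampere_balance (W : IsWeakSolutionWith m₀ E₀ H₀ m E H mt G) :
    IsWeakBalance (fun p => - E p) (fun p => - H p) (fun _ => 0) (fun _ _ => 0) E₀ := by
  refine .of_split W.class_E.locIntegrable.neg W.class_H.locIntegrable.neg locIntegrable_zero
    (fun _ => locIntegrable_zero) fun Φ hΦ => ?_
  rw [← W.ampere Φ hΦ]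
  simp [integral_neg, sub_eq_add_neg]

lemma faraday_balance (W : IsWeakSolutionWith m₀ E₀ H₀ m E H mt G) (hm₀ : Continuous m₀)
    (hH₀ : Continuous H₀) : IsWeakBalance (fun p => - H p) E mt (fun _ _ => 0) H₀ := by
  refine .of_split W.class_H.locIntegrable.neg W.class_E.locIntegrable W.locIntegrable_mt
    (fun _ => locIntegrable_zero) fun Φ hΦ => ?_
  have induction_law := W.faraday Φ hΦ
  simp only [inner_add_left] at induction_law
  rw [integral_add (hΦ.halfTest.halfCont_dt.integrable_inner W.class_H.locIntegrable)
      (hΦ.halfTest.halfCont_dt.integrable_inner W.locIntegrable_m),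
    integral_add (hΦ.integrable_inner_slice hH₀ 0) (hΦ.integrable_inner_slice hm₀ 0)]
    at induction_law
  simp only [inner_neg_left, integral_neg, inner_zero_left, integral_zero, Finset.sum_const_zero]
  linarith [W.weak_dt Φ hΦ]

lemma sum_integral_inner_ite (i : Fin 3) (f : ST → R3) (Φ : Fin 3 → ST → R3) :
    ∑ j, ∫ p in future, inner ℝ (if j = i then f p else 0) (Φ j p)
      = ∫ p in future, inner ℝ (f p) (Φ i p) := by
  rw [Finset.sum_eq_single i] <;> simp +contextual

lemma dt_dx_balance (W : IsWeakSolutionWith m₀ E₀ H₀ m E H mt G) (hm₀ : ContDiff ℝ ∞ m₀)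
    (i : Fin 3) : IsWeakBalance (fun p => - G i p) (fun _ => 0) (fun _ => 0)
      (fun j p => if j = i then mt p else 0) (pd i m₀) := by
  refine .of_split (W.grad_m i).locIntegrable.neg locIntegrable_zero locIntegrable_zero
    (fun j => W.locIntegrable_mt.ite i j) fun Φ hΦ => ?_
  have dt_dx : dt (dx i Φ) = dx i (dt Φ) := funext fun p => dt_dx_comm i hΦ.1.contDiffAt
  have trace := W.weak_dt _ (hΦ.dx i)
  rw [dt_dx, W.weak_dx i _ hΦ.dt, hΦ.integral_inner_dx_slice hm₀] at trace
  rw [sum_integral_inner_ite]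
  simp only [inner_neg_left, integral_neg, inner_zero_left, integral_zero]
  linarith

lemma dx_balance (W : IsWeakSolutionWith m₀ E₀ H₀ m E H mt G) (i : Fin 3) :
    IsWeakBalance (fun _ => 0) (fun _ => 0) (G i) (fun j p => if j = i then m p else 0)
      (fun _ => 0) := by
  refine .of_split locIntegrable_zero locIntegrable_zero (W.grad_m i).locIntegrable
    (fun j => W.locIntegrable_m.ite i j) fun Φ hΦ => ?_
  rw [sum_integral_inner_ite, W.weak_dx i Φ hΦ]
  simp

lemma gilbert_balance (W : IsWeakSolutionWith m₀ E₀ H₀ m E H mt G) :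
    IsWeakBalance (fun _ => 0) (fun _ => 0)
      (fun p => mt p + cross (m p) (mt p) - (2 : ℝ) • cross (m p) (H p))
      (fun i p => (2 : ℝ) • cross (m p) (G i p)) (fun _ => 0) := by
  have precession : LocIntegrable (fun p => mt p + cross (m p) (mt p)) :=
    locIntegrable_of_memLp one_le_two fun S hS =>
      (W.memLp_mt S hS).add (W.memLp_cross (W.memLp_mt S hS))
  have torque : LocIntegrable (fun p => cross (m p) (H p)) :=
    locIntegrable_of_memLp one_le_two fun S _ => W.memLp_cross (W.class_H.memLp S)
  have exchange : ∀ i, LocIntegrable (fun p => cross (m p) (G i p)) := fun i =>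
    locIntegrable_of_memLp one_le_two fun S _ => W.memLp_cross ((W.grad_m i).memLp S)
  refine .of_split locIntegrable_zero locIntegrable_zero
    (fun R => (precession R).sub ((torque R).smul (2 : ℝ)))
    (fun j R => (exchange j R).smul (2 : ℝ)) fun Φ hΦ => ?_
  simp only [inner_zero_left, integral_zero, zero_add, inner_sub_left, real_inner_smul_left,
    integral_const_mul]
  rw [integral_sub (hΦ.halfTest.halfCont.integrable_inner precession)
    ((hΦ.halfTest.halfCont.integrable_inner torque).const_mul 2), integral_const_mul,
    ← Finset.mul_sum]
  linarith [W.gilbert Φ hΦ]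

end IsWeakSolutionWith

/-! ### Integration by parts over slabs -/

section SlabIntegrals

variable {S T lam : ℝ} {ζ η : ℝ → ℝ} {χ : R3 → ℝ} {f : ST → ℝ}

lemma integrableOn_slab_mul (hχ : Integrable χ) (hf : ContinuousOn f (slab S))
    {C : ℝ} (hC : ∀ p ∈ slab S, |f p| ≤ C) : IntegrableOn (fun p => χ p.2 * f p) (slab S) := by
  have weight : Integrable (fun p : ST => χ p.2) (volume.restrict (slab S)) := by
    simpa only [one_mul, volume_restrict_slab] using (integrable_const (1 : ℝ)).mul_prod hχ
  refine weight.mul_bdd (c := C) (hf.aestronglyMeasurable (isOpen_slab S).measurableSet) ?_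
  filter_upwards [ae_restrict_mem (isOpen_slab S).measurableSet] with p hp using hC p hp

namespace BddSmooth

lemma integrableOn_slab (hf : BddSmooth T f) (hST : S < T)
    (hχ : Integrable χ) (hη : Continuous η) :
    IntegrableOn (fun p => χ p.2 * (η p.1 * f p)) (slab S) := by
  obtain ⟨C, -, hC⟩ := hf.exists_bound hST
  obtain ⟨D, hD⟩ := (isCompact_Icc (a := 0) (b := S)).exists_bound_of_continuousOn hη.continuousOn
  refine integrableOn_slab_mul hχ ((hη.comp continuous_fst).continuousOn.mul
    (hf.continuousOn.mono (slab_mono hST.le))) (C := D * C) fun p hp => ?_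
  have hDp := hD p.1 ⟨(mem_slab.1 hp).1.le, (mem_slab.1 hp).2.le⟩
  rw [abs_mul]
  exact mul_le_mul hDp (hC p hp) (abs_nonneg _) ((norm_nonneg _).trans hDp)

lemma continuous_slice (hf : BddSmooth T f) {t : ℝ} (ht : t ∈ Ioo 0 T) :
    Continuous fun x : R3 => f (t, x) :=
  hf.continuousOn.comp_continuous (by fun_prop) fun _ => mem_slab.2 ht

lemma integrable_mul_slice (hf : BddSmooth T f) {t : ℝ} (ht : t ∈ Ioo 0 T) (hχ : Integrable χ) :
    Integrable fun x => χ x * f (t, x) := by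
  obtain ⟨S, htS, hST⟩ := exists_between ht.2
  obtain ⟨C, -, hC⟩ := hf.exists_bound hST
  exact hχ.mul_bdd (hf.continuous_slice ht).aestronglyMeasurable
    (ae_of_all _ fun x => hC _ (mem_slab.2 ⟨ht.1, htS⟩))

lemma integral_slice_dx (hf : BddSmooth T f) {t : ℝ} (ht : t ∈ Ioo 0 T) (i : Fin 3)
    (hχ : ContDiff ℝ ∞ χ) (hχi : Integrable χ) (hdχ : Integrable (pdScalar i χ)) :
    ∫ x, χ x * dx i f (t, x) + pdScalar i χ x * f (t, x) = 0 := by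
  have hd : ∀ y : R3, DifferentiableAt ℝ f (t, y) := fun y => hf.differentiableAt (mem_slab.2 ht)
  have by_parts := integral_mul_fderiv_eq_neg_fderiv_mul_of_integrable (μ := volume) (f := χ)
    (g := fun y => f (t, y)) (v := e i) (hf.integrable_mul_slice ht hdχ)
    (by simpa only [dx_eq_fderiv_space (hd _)] using (hf.dx i).integrable_mul_slice ht hχi)
    (hf.integrable_mul_slice ht hχi)
    (fun y _ => hχ.differentiable (by simp) y)
    (fun y _ => (hasFDerivAt_space (hd y)).differentiableAt)
  simp only [← dx_eq_fderiv_space (hd _)] at by_parts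
  rw [integral_add ((hf.dx i).integrable_mul_slice ht hχi) (hf.integrable_mul_slice ht hdχ),
    by_parts]
  simp [pdScalar]

lemma integral_slab_dx (hf : BddSmooth T f) (hST : S < T) (i : Fin 3)
    (hχ : ContDiff ℝ ∞ χ) (hχi : Integrable χ) (hdχ : Integrable (pdScalar i χ))
    (hη : Continuous η) :
    ∫ p in slab S, η p.1 * (χ p.2 * dx i f p + pdScalar i χ p.2 * f p) = 0 := by
  have hI : IntegrableOn (fun p : ST => η p.1 * (χ p.2 * dx i f p + pdScalar i χ p.2 * f p))
      (slab S) := by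
    refine (((hf.dx i).integrableOn_slab hST hχi hη).add
      (hf.integrableOn_slab hST hdχ hη)).congr (ae_of_all _ fun p => ?_)
    simp only [Pi.add_apply]; ring
  rw [IntegrableOn, volume_restrict_slab] at hI
  rw [volume_restrict_slab, integral_prod _ hI]
  refine setIntegral_eq_zero_of_forall_eq_zero fun t ht => ?_
  simp only [integral_const_mul, hf.integral_slice_dx ⟨ht.1, ht.2.trans hST⟩ i hχ hχi hdχ, mul_zero]

lemma intervalIntegrable_mul_time (hf : BddSmooth T f) (hS : 0 < S) (hST : S < T)
    (hη : Continuous η) (x : R3) : IntervalIntegrable (fun t => η t * f (t, x)) volume 0 S := by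
  obtain ⟨C, -, hC⟩ := hf.exists_bound hST
  have cont : ContinuousOn (fun t => f (t, x)) (Ioo 0 S) :=
    hf.continuousOn.comp (by fun_prop) fun t ht => slab_mono hST.le (mem_slab.2 ht)
  have hηi : IntegrableOn η (Ioo 0 S) :=
    hη.continuousOn.integrableOn_Icc.mono_set Ioo_subset_Icc_self
  rw [intervalIntegrable_iff_integrableOn_Ioo_of_le hS.le]
  refine hηi.mul_bdd (c := C) (cont.aestronglyMeasurable measurableSet_Ioo) ?_
  filter_upwards [ae_restrict_mem measurableSet_Ioo] with t ht using hC _ (mem_slab.2 ht)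

lemma tendsto_weight_mul_nhdsLT (hf : BddSmooth T f) (hS : 0 < S) (hST : S < T)
    (hζ : IsTimeWeight S lam ζ) (x : R3) :
    Tendsto (fun s => ζ s * f (s, x)) (𝓝[<] S) (𝓝 0) := by
  obtain ⟨C, -, hC⟩ := hf.exists_bound hST
  have weight : Tendsto ζ (𝓝[<] S) (𝓝 0) :=
    hζ.zero S le_rfl ▸ (hζ.smooth.continuous.tendsto S).mono_left nhdsWithin_le_nhds
  refine weight.zero_mul_isBoundedUnder_le ⟨C, ?_⟩
  rw [eventually_map]
  filter_upwards [Ioo_mem_nhdsLT hS] with s hs using hC (s, x) (mem_slab.2 hs)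

lemma intervalIntegral_dt (hf : BddSmooth T f) (hS : 0 < S) (hST : S < T) {x : R3} {f₀ : ℝ}
    (h0 : Tendsto (fun t : ℝ => f (t, x)) (𝓝[>] 0) (𝓝 f₀)) (hζ : IsTimeWeight S lam ζ) :
    ∫ t in 0..S, (- deriv ζ t * f (t, x) - ζ t * dt f (t, x)) = ζ 0 * f₀ := by
  have hderiv : ∀ t ∈ Ioo 0 S, HasDerivAt (fun s => - (ζ s * f (s, x)))
      (- deriv ζ t * f (t, x) - ζ t * dt f (t, x)) t := fun t ht =>
    ((hζ.hasDerivAt t).fun_mul (hasDerivAt_time (hf.differentiableAt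
      (slab_mono hST.le (mem_slab.2 ht : (t, x) ∈ slab S))))).fun_neg.congr_deriv (by ring)
  have at_zero : Tendsto (fun s => - (ζ s * f (s, x))) (𝓝[>] 0) (𝓝 (-(ζ 0 * f₀))) :=
    (((hζ.smooth.continuous.tendsto 0).mono_left nhdsWithin_le_nhds).mul h0).neg
  rw [intervalIntegral.integral_eq_sub_of_hasDerivAt_of_tendsto hS hderiv
    ((hf.intervalIntegrable_mul_time hS hST hζ.continuous_deriv.neg x).sub
      (hf.dt.intervalIntegrable_mul_time hS hST hζ.smooth.continuous x))
    at_zero (hf.tendsto_weight_mul_nhdsLT hS hST hζ x).neg]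
  ring

lemma integral_slab_dt (hf : BddSmooth T f) (hS : 0 < S) (hST : S < T)
    {f₀ : R3 → ℝ} (h0 : ∀ x, Tendsto (fun t : ℝ => f (t, x)) (𝓝[>] 0) (𝓝 (f₀ x)))
    (hχ : Integrable χ) (hζ : IsTimeWeight S lam ζ) :
    ∫ p in slab S, χ p.2 * (- deriv ζ p.1 * f p - ζ p.1 * dt f p)
      = ζ 0 * ∫ x, χ x * f₀ x := by
  have hI : IntegrableOn (fun p : ST => χ p.2 * (- deriv ζ p.1 * f p - ζ p.1 * dt f p))
      (slab S) := by
    refine ((hf.integrableOn_slab hST hχ hζ.continuous_deriv.neg).sub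
      (hf.dt.integrableOn_slab hST hχ hζ.smooth.continuous)).congr (ae_of_all _ fun p => ?_)
    simp only [Pi.sub_apply, Pi.neg_apply]; ring
  rw [IntegrableOn, volume_restrict_slab] at hI
  rw [volume_restrict_slab, integral_prod_symm _ hI, ← integral_const_mul]
  refine integral_congr_ae (ae_of_all _ fun x => ?_)
  dsimp only
  rw [integral_const_mul, ← integral_Ioc_eq_integral_Ioo, ← intervalIntegral.integral_of_le hS.le,
    hf.intervalIntegral_dt hS hST (h0 x) hζ]
  ring

end BddSmooth

end SlabIntegrals

/-! ### The energy balance of smooth solutions -/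

/-- The Laplacian in the space variables. -/
def lap (u : ST → R3) (p : ST) : R3 := ∑ i, dx i (dx i u) p

/-- The energy density of the initial value. -/
def energy₀ (m₀ E₀ H₀ : R3 → R3) (x : R3) : ℝ :=
  ‖E₀ x‖ ^ 2 + ‖H₀ x‖ ^ 2 + ∑ i, ‖pd i m₀ x‖ ^ 2

/-- The energy density of electric and magnetic fields `E`, `H` and of a field with space
derivatives `g i`. -/
def energyDensity (E H : ST → R3) (g : Fin 3 → ST → R3) (p : ST) : ℝ :=
  ‖E p‖ ^ 2 + ‖H p‖ ^ 2 + ∑ i, ‖g i p‖ ^ 2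

/-- The `i`-th component of the flux of energy, the sum of the Poynting vector and of the exchange
flux; twice its divergence is the rate of change of `energyDensity` up to dissipation. -/
def energyFlux (m E H : ST → R3) (i : Fin 3) (p : ST) : ℝ :=
  cross (H p) (E p) i + inner ℝ (dx i m p) (dt m p)

lemma energyDensity_nonneg (E H : ST → R3) (g : Fin 3 → ST → R3) (p : ST) :
    0 ≤ energyDensity E H g p := by unfold energyDensity; positivity

lemma IsSmoothData.norm_eq_one {m₀ E₀ H₀ : R3 → R3} (h : IsSmoothData m₀ E₀ H₀) (x : R3) :
    ‖m₀ x‖ = 1 :=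
  congrFun (h.smooth_m.continuous.norm.ae_eq_iff_eq (volume : Measure R3) continuous_const
    |>.1 h.norm_m) x

lemma IsSmoothData.integrable_energy₀ {m₀ E₀ H₀ : R3 → R3} (h : IsSmoothData m₀ E₀ H₀) :
    Integrable (energy₀ m₀ E₀ H₀) :=
  (h.memLp_E.norm.integrable_sq.add h.memLp_H.norm.integrable_sq).add
    (integrable_finsetSum _ fun i _ => (h.grad_m i).norm.integrable_sq)

lemma BddSmooth.norm_sq {T : ℝ} {u : ST → V} (hu : BddSmooth T u) :
    BddSmooth T (fun p => ‖u p‖ ^ 2) := by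
  simpa only [real_inner_self_eq_norm_sq] using hu.inner hu

namespace IsSmoothSolution

variable {T : ℝ} {m₀ E₀ H₀ : R3 → R3} {m E H : ST → R3} {p : ST}

lemma bddSmooth_m (h : IsSmoothSolution T m₀ E₀ H₀ m E H) : BddSmooth T m := h.smooth_m.bddSmooth

lemma bddSmooth_E (h : IsSmoothSolution T m₀ E₀ H₀ m E H) : BddSmooth T E := h.smooth_E.bddSmooth

lemma bddSmooth_H (h : IsSmoothSolution T m₀ E₀ H₀ m E H) : BddSmooth T H := h.smooth_H.bddSmooth

lemma gilbert_lap (h : IsSmoothSolution T m₀ E₀ H₀ m E H) (hp : p ∈ slab T) :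
    dt m p + cross (m p) (dt m p) = (2 : ℝ) • cross (m p) (lap m p + H p) := by
  have exchange : ∀ i, dx i (fun q => cross (m q) (dx i m q)) p
      = crossL (m p) (dx i (dx i m) p) := fun i => by
    rw [dx_cross i (h.bddSmooth_m.differentiableAt hp)
      ((h.bddSmooth_m.dx i).differentiableAt hp), cross_self_eq_zero, zero_add]
    rfl
  rw [h.gilbert p hp, ← smul_add, Finset.sum_congr rfl fun i _ => exchange i, ← map_sum,
    cross_add_right]
  rfl

lemma inner_m_dt (h : IsSmoothSolution T m₀ E₀ H₀ m E H) (hp : p ∈ slab T) :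
    inner ℝ (m p) (dt m p) = 0 := by
  have := congrArg (inner ℝ (m p)) (h.gilbert_lap hp)
  rwa [inner_add_right, inner_cross_self, real_inner_smul_right, inner_cross_self, mul_zero,
    add_zero] at this

lemma hasDerivAt_norm_sq_m (h : IsSmoothSolution T m₀ E₀ H₀ m E H) {t : ℝ} (ht : t ∈ Ioo 0 T)
    (x : R3) : HasDerivAt (fun s => ‖m (s, x)‖ ^ 2) 0 t := by
  have hp : (t, x) ∈ slab T := mem_slab.2 ht
  simpa [h.inner_m_dt hp] using (hasDerivAt_time (h.bddSmooth_m.differentiableAt hp)).norm_sq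

lemma norm_m_eq_one (h : IsSmoothSolution T m₀ E₀ H₀ m E H) (hd : IsSmoothData m₀ E₀ H₀)
    (hp : p ∈ slab T) : ‖m p‖ = 1 := by
  obtain ⟨t, x⟩ := p
  have ht : t ∈ Ioo 0 T := mem_slab.1 hp
  have constant : ∀ s ∈ Ioo 0 T, ‖m (t, x)‖ ^ 2 = ‖m (s, x)‖ ^ 2 := fun s hs =>
    isOpen_Ioo.is_const_of_deriv_eq_zero isPreconnected_Ioo
      (fun r hr => (h.hasDerivAt_norm_sq_m hr x).differentiableAt.differentiableWithinAt)
      (fun r hr => (h.hasDerivAt_norm_sq_m hr x).deriv) ht hs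
  have initial : Tendsto (fun s : ℝ => ‖m (s, x)‖ ^ 2) (𝓝[>] 0) (𝓝 1) := by
    simpa [hd.norm_eq_one x] using (h.smooth_m.initial x).norm.pow 2
  have limit : ‖m (t, x)‖ ^ 2 = 1 := by
    refine tendsto_nhds_unique (tendsto_const_nhds.congr' ?_) initial
    filter_upwards [Ioo_mem_nhdsGT (ht.1.trans ht.2)] with s hs using constant s hs
  exact (pow_eq_one_iff_of_nonneg (norm_nonneg _) two_ne_zero).1 limit

lemma bddSmooth_energyFlux (h : IsSmoothSolution T m₀ E₀ H₀ m E H) (i : Fin 3) :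
    BddSmooth T (energyFlux m E H i) :=
  ((h.bddSmooth_H.cross h.bddSmooth_E).clm (EuclideanSpace.proj i : R3 →L[ℝ] ℝ)).add
    ((h.bddSmooth_m.dx i).inner h.bddSmooth_m.dt)

lemma bddSmooth_energyDensity (h : IsSmoothSolution T m₀ E₀ H₀ m E H) :
    BddSmooth T (energyDensity E H (fun i => dx i m)) := by
  have := (h.bddSmooth_E.norm_sq.add h.bddSmooth_H.norm_sq).add
    (((h.bddSmooth_m.dx 0).norm_sq.add (h.bddSmooth_m.dx 1).norm_sq).add
      (h.bddSmooth_m.dx 2).norm_sq)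
  unfold energyDensity
  simpa only [Fin.sum_univ_three] using this

lemma dt_energyDensity (h : IsSmoothSolution T m₀ E₀ H₀ m E H) (hp : p ∈ slab T) :
    dt (energyDensity E H (fun i => dx i m)) p = 2 * inner ℝ (E p) (dt E p)
      + 2 * inner ℝ (H p) (dt H p) + ∑ i, 2 * inner ℝ (dx i m p) (dt (dx i m) p) := by
  have hasDeriv := ((h.bddSmooth_E.differentiableAt hp).hasFDerivAt.norm_sq.fun_add
    (h.bddSmooth_H.differentiableAt hp).hasFDerivAt.norm_sq).fun_add
    (HasFDerivAt.fun_sum (u := Finset.univ) fun i _ =>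
      ((h.bddSmooth_m.dx i).differentiableAt hp).hasFDerivAt.norm_sq)
  unfold energyDensity
  rw [dt, hasDeriv.fderiv]
  simp [dt]

lemma dx_energyFlux (h : IsSmoothSolution T m₀ E₀ H₀ m E H) (hp : p ∈ slab T) (i : Fin 3) :
    dx i (energyFlux m E H i) p = (cross (dx i H p) (E p) + cross (H p) (dx i E p)) i
      + (inner ℝ (dx i (dx i m) p) (dt m p) + inner ℝ (dx i m p) (dt (dx i m) p)) := by
  have poynting : DifferentiableAt ℝ (fun q => cross (H q) (E q)) p :=
    (h.bddSmooth_H.cross h.bddSmooth_E).differentiableAt hp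
  have exchange : DifferentiableAt ℝ (fun q => inner ℝ (dx i m q) (dt m q)) p :=
    ((h.bddSmooth_m.dx i).inner h.bddSmooth_m.dt).differentiableAt hp
  have hasDeriv := ((EuclideanSpace.proj i : R3 →L[ℝ] ℝ).hasFDerivAt.comp p
    poynting.hasFDerivAt).fun_add exchange.hasFDerivAt
  have split : dx i (energyFlux m E H i) p = dx i (fun q => cross (H q) (E q)) p i
      + dx i (fun q => inner ℝ (dx i m q) (dt m q)) p := by
    rw [dx, show energyFlux m E H i = _ from rfl]
    exact congrArg (fun L : ST →L[ℝ] ℝ => L (0, e i)) hasDeriv.fderiv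
  rw [split, dx_cross i (h.bddSmooth_H.differentiableAt hp) (h.bddSmooth_E.differentiableAt hp),
    dx_inner i ((h.bddSmooth_m.dx i).differentiableAt hp) (h.bddSmooth_m.dt.differentiableAt hp),
    dt_dx_comm i (h.bddSmooth_m.contDiffAt hp)]

lemma energy_balance (h : IsSmoothSolution T m₀ E₀ H₀ m E H) (hp : p ∈ slab T) :
    dt (energyDensity E H (fun i => dx i m)) p + ‖dt m p‖ ^ 2
      = 2 * ∑ i, dx i (energyFlux m E H i) p := by
  have hE : dt E p = curl H p := sub_eq_zero.1 (h.ampere p hp)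
  have hH : dt H p = - dt m p - curl E p := eq_sub_of_add_eq (h.faraday p hp)
  rw [h.dt_energyDensity hp, Finset.sum_congr rfl fun i _ => h.dx_energyFlux hp i,
    ← two_mul_inner_of_gilbert (h.gilbert_lap hp), hE, hH]
  simp only [lap, inner_add_right, inner_sum, Finset.sum_add_distrib, ← Finset.mul_sum, mul_add,
    real_inner_comm (dt m p)]
  simp only [Fin.sum_univ_three, inner_eq_coords, curl]
  simp only [Fin.isValue, Matrix.cons_val_zero, Matrix.cons_val_one, Matrix.cons_val,
    PiLp.sub_apply, PiLp.neg_apply, PiLp.add_apply, cross_apply_zero, cross_apply_one,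
    cross_apply_two]
  ring

end IsSmoothSolution

/-! ### The energy inequality of smooth solutions -/

section Fatou

variable {α : Type*} [MeasurableSpace α] {μ : Measure α} {f : α → ℝ} {a : ℝ}

lemma integral_le_of_lintegral_ofReal_le (hf : AEStronglyMeasurable f μ) (hf0 : 0 ≤ᵐ[μ] f)
    (ha : 0 ≤ a) (h : ∫⁻ x, ENNReal.ofReal (f x) ∂μ ≤ ENNReal.ofReal a) :
    Integrable f μ ∧ ∫ x, f x ∂μ ≤ a := by
  have hint : Integrable f μ :=
    ⟨hf, (hasFiniteIntegral_iff_ofReal hf0).2 (h.trans_lt ENNReal.ofReal_lt_top)⟩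
  rw [← ofReal_integral_eq_lintegral_ofReal hint hf0] at h
  exact ⟨hint, (ENNReal.ofReal_le_ofReal_iff ha).1 h⟩

lemma integral_le_of_tendsto {g : ℕ → α → ℝ} {A : ℕ → ℝ} (hg : ∀ n, Integrable (g n) μ)
    (hg0 : ∀ n, 0 ≤ᵐ[μ] g n) (hlim : ∀ᵐ x ∂μ, Tendsto (fun n => g n x) atTop (𝓝 (f x)))
    (hle : ∀ᶠ n in atTop, ∫ x, g n x ∂μ ≤ A n) (hA : Tendsto A atTop (𝓝 a)) :
    Integrable f μ ∧ ∫ x, f x ∂μ ≤ a := by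
  have hf0 : 0 ≤ᵐ[μ] f := by
    filter_upwards [hlim, ae_all_iff.2 hg0] with x hx h0 using ge_of_tendsto' hx h0
  have ha : 0 ≤ a := ge_of_tendsto hA
    (hle.mono fun n hn => (integral_nonneg_of_ae (hg0 n)).trans hn)
  refine integral_le_of_lintegral_ofReal_le
    (aestronglyMeasurable_of_tendsto_ae atTop (fun n => (hg n).1) hlim) hf0 ha ?_
  have ofReal_lim : Tendsto (fun n => ENNReal.ofReal (A n)) atTop (𝓝 (ENNReal.ofReal a)) :=
    ENNReal.tendsto_ofReal hA
  calc ∫⁻ x, ENNReal.ofReal (f x) ∂μ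
      = ∫⁻ x, liminf (fun n => ENNReal.ofReal (g n x)) atTop ∂μ :=
        lintegral_congr_ae (hlim.mono fun x hx => (ENNReal.tendsto_ofReal hx).liminf_eq.symm)
    _ ≤ liminf (fun n => ∫⁻ x, ENNReal.ofReal (g n x) ∂μ) atTop :=
        lintegral_liminf_le' fun n => (hg n).1.aemeasurable.ennreal_ofReal
    _ ≤ liminf (fun n => ENNReal.ofReal (A n)) atTop := by
        refine liminf_le_liminf (hle.mono fun n hn => ?_)
        rw [← ofReal_integral_eq_lintegral_ofReal (hg n) (hg0 n)]
        exact ENNReal.ofReal_le_ofReal hn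
    _ = ENNReal.ofReal a := ofReal_lim.liminf_eq

end Fatou

/-- A smooth integrable weight on `ℝ³` whose gradient is at most `2 κ` times the weight itself, and
which converges to `1` as `κ → 0`. Being positive, it truncates the energy identity with an error
that is absorbed by the energy. -/
def polyWeight (κ : ℝ) (x : R3) : ℝ := ((1 + κ ^ 2 * ‖x‖ ^ 2) ^ 2)⁻¹

namespace polyWeight

variable {κ : ℝ}

lemma base_pos (κ : ℝ) (x : R3) : 0 < 1 + κ ^ 2 * ‖x‖ ^ 2 := by positivity

lemma pos (κ : ℝ) (x : R3) : 0 < polyWeight κ x :=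
  inv_pos.2 (pow_pos (base_pos κ x) 2)

lemma le_one (κ : ℝ) (x : R3) : polyWeight κ x ≤ 1 :=
  inv_le_one_of_one_le₀ (one_le_pow₀ (le_add_of_nonneg_right (by positivity)))

lemma smooth (κ : ℝ) : ContDiff ℝ ∞ (polyWeight κ) :=
  ((contDiff_const.add (contDiff_const.mul (contDiff_norm_sq ℝ))).pow 2).inv fun x =>
    (pow_pos (base_pos κ x) 2).ne'

lemma pdScalar_eq (κ : ℝ) (i : Fin 3) (x : R3) :
    pdScalar i (polyWeight κ) x
      = - (4 * κ ^ 2 * x i) * (1 + κ ^ 2 * ‖x‖ ^ 2)⁻¹ * polyWeight κ x := by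
  have hb := base_pos κ x
  have norm_sq : HasFDerivAt (fun y : R3 => ‖y‖ ^ 2) (2 • innerSL ℝ x) x :=
    (hasStrictFDerivAt_norm_sq x).hasFDerivAt
  have hasDeriv : HasFDerivAt (polyWeight κ) _ x :=
    (hasDerivAt_inv (pow_pos hb 2).ne').comp_hasFDerivAt x
      (((norm_sq.const_mul (κ ^ 2)).const_add 1).pow 2)
  rw [pdScalar, hasDeriv.fderiv]
  have hx : inner ℝ x (e i) = x i := by simp [e, EuclideanSpace.inner_single_right]
  simp only [Nat.add_one_sub_one, pow_one, smul_add, nsmul_eq_mul, Nat.cast_ofNat, mul_one,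
    neg_smul, neg_apply, smul_apply, coe_innerSL_apply, hx, smul_eq_mul, neg_mul, polyWeight,
    neg_inj]
  field_simp
  ring

lemma abs_pdScalar_le (hκ : 0 ≤ κ) (i : Fin 3) (x : R3) :
    |pdScalar i (polyWeight κ) x| ≤ 2 * κ * polyWeight κ x := by
  have hb := base_pos κ x
  have hx : |x i| ≤ ‖x‖ := PiLp.norm_apply_le x i
  have amgm : 4 * κ ^ 2 * |x i| ≤ 2 * κ * (1 + κ ^ 2 * ‖x‖ ^ 2) := by
    nlinarith [mul_nonneg hκ (sq_nonneg (1 - κ * ‖x‖)), mul_le_mul_of_nonneg_left hx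
      (show 0 ≤ 4 * κ ^ 2 by positivity)]
  rw [pdScalar_eq, abs_mul, abs_of_pos (pos κ x), abs_mul, abs_neg, abs_of_pos (inv_pos.2 hb),
    abs_mul, abs_of_nonneg (show 0 ≤ 4 * κ ^ 2 by positivity)]
  exact mul_le_mul_of_nonneg_right ((mul_inv_le_iff₀ hb).2 amgm) (pos κ x).le

lemma integrable (hκ : κ ≠ 0) : Integrable (polyWeight κ) := by
  have japanese : Integrable (fun x : R3 => (1 + ‖x‖ ^ 2) ^ (-(4 : ℝ) / 2)) :=
    integrable_rpow_neg_one_add_norm_sq (by simp; norm_num)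
  refine (japanese.comp_smul hκ).congr (ae_of_all _ fun x => ?_)
  simp only [polyWeight, norm_smul, mul_pow, Real.norm_eq_abs, sq_abs]
  rw [show -(4 : ℝ) / 2 = -2 by norm_num, Real.rpow_neg (base_pos κ x).le]
  norm_num

lemma integrable_pdScalar (hκ : 0 < κ) (i : Fin 3) : Integrable (pdScalar i (polyWeight κ)) :=
  ((integrable hκ.ne').const_mul (2 * κ)).mono'
    (((smooth κ).continuous_fderiv (by simp)).clm_apply continuous_const).aestronglyMeasurable
    (ae_of_all _ fun x => abs_pdScalar_le hκ.le i x)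

lemma tendsto_one (x : R3) : Tendsto (fun k => polyWeight k x) (𝓝 0) (𝓝 1) := by
  have hc : Continuous fun k : ℝ => polyWeight k x :=
    Continuous.inv₀ (by fun_prop) fun k => (pow_pos (base_pos k x) 2).ne'
  simpa [polyWeight] using hc.tendsto 0

end polyWeight

/-- The energy weighted by `-ζ'` plus the dissipation `‖v‖²` weighted by `ζ`: an integration by
parts in time turns the energy inequality into a bound for its integral. -/
def weightedEnergy (ζ : ℝ → ℝ) (E H : ST → R3) (g : Fin 3 → ST → R3) (v : ST → R3) (p : ST) : ℝ :=
  - deriv ζ p.1 * energyDensity E H g p + ζ p.1 * ‖v p‖ ^ 2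

section WeightedEnergy

variable {S lam : ℝ} {ζ : ℝ → ℝ} {E H v : ST → R3} {g : Fin 3 → ST → R3} {p : ST}

lemma weightedEnergy_nonneg (hζ : IsTimeWeight S lam ζ) (hl : 0 ≤ lam) (hp : p ∈ slab S) :
    0 ≤ weightedEnergy ζ E H g v p :=
  add_nonneg (mul_nonneg (hζ.neg_deriv_nonneg hl (mem_slab.1 hp).1 (mem_slab.1 hp).2)
    (energyDensity_nonneg E H g p)) (mul_nonneg (hζ.nonneg p.1) (sq_nonneg _))

lemma mul_energyDensity_add_le_weightedEnergy (hζ : IsTimeWeight S lam ζ) (hl : 1 ≤ lam)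
    (hp : p ∈ slab S) :
    ζ p.1 * (energyDensity E H g p + ‖v p‖ ^ 2) ≤ weightedEnergy ζ E H g v p := by
  have decay : ζ p.1 ≤ - deriv ζ p.1 :=
    (le_mul_of_one_le_left (hζ.nonneg p.1) hl).trans
      (hζ.decay p.1 (mem_slab.1 hp).1 (mem_slab.1 hp).2)
  rw [weightedEnergy, mul_add]
  gcongr
  exact energyDensity_nonneg E H g p

lemma sq_norm_dx_le_energyDensity (i : Fin 3) : ‖g i p‖ ^ 2 ≤ energyDensity E H g p :=
  (Finset.single_le_sum (f := fun j => ‖g j p‖ ^ 2) (fun j _ => by positivity)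
    (Finset.mem_univ i)).trans (le_add_of_nonneg_left (by positivity))

lemma abs_energyFlux_le (m E H : ST → R3) (i : Fin 3) (p : ST) :
    2 * |energyFlux m E H i p| ≤ energyDensity E H (fun i => dx i m) p + ‖dt m p‖ ^ 2 := by
  have poynting : |cross (H p) (E p) i| ≤ ‖H p‖ * ‖E p‖ :=
    (PiLp.norm_apply_le (cross (H p) (E p)) i).trans (norm_cross_le _ _)
  have exchange : |inner ℝ (dx i m p) (dt m p)| ≤ ‖dx i m p‖ * ‖dt m p‖ :=
    abs_real_inner_le_norm _ _
  have single : ‖dx i m p‖ ^ 2 ≤ ∑ j, ‖dx j m p‖ ^ 2 :=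
    Finset.single_le_sum (f := fun j => ‖dx j m p‖ ^ 2) (fun j _ => by positivity)
      (Finset.mem_univ i)
  have triangle := abs_add_le (cross (H p) (E p) i) (inner ℝ (dx i m p) (dt m p))
  unfold energyFlux energyDensity
  nlinarith [sq_nonneg (‖H p‖ - ‖E p‖), sq_nonneg (‖dx i m p‖ - ‖dt m p‖)]

end WeightedEnergy

lemma energy₀_nonneg (m₀ E₀ H₀ : R3 → R3) (x : R3) : 0 ≤ energy₀ m₀ E₀ H₀ x := by
  unfold energy₀; positivity

namespace IsSmoothSolution

variable {T S lam κ : ℝ} {ζ : ℝ → ℝ} {χ : R3 → ℝ} {m₀ E₀ H₀ : R3 → R3} {m E H : ST → R3}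

lemma tendsto_energyDensity (h : IsSmoothSolution T m₀ E₀ H₀ m E H)
    (hd : IsSmoothData m₀ E₀ H₀) (hT : 0 < T) (x : R3) :
    Tendsto (fun t : ℝ => energyDensity E H (fun i => dx i m) (t, x)) (𝓝[>] 0)
      (𝓝 (energy₀ m₀ E₀ H₀ x)) :=
  (((h.smooth_E.initial x).norm.pow 2).add ((h.smooth_H.initial x).norm.pow 2)).add
    (tendsto_finsetSum _ fun i _ => (h.smooth_m.tendsto_dx hT hd.smooth_m i x).norm.pow 2)

lemma integrableOn_mul_weightedEnergy (h : IsSmoothSolution T m₀ E₀ H₀ m E H) (hST : S < T)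
    (hζ : IsTimeWeight S lam ζ) (hχ : Integrable χ) :
    IntegrableOn (fun p => χ p.2 * weightedEnergy ζ E H (fun i => dx i m) (dt m) p) (slab S) := by
  refine ((h.bddSmooth_energyDensity.integrableOn_slab hST hχ hζ.continuous_deriv.neg).add
    (h.bddSmooth_m.dt.norm_sq.integrableOn_slab hST hχ hζ.smooth.continuous)).congr
    (ae_of_all _ fun p => ?_)
  simp only [Pi.add_apply, Pi.neg_apply, weightedEnergy]; ring

lemma integrableOn_mul_energyFlux (h : IsSmoothSolution T m₀ E₀ H₀ m E H) (hST : S < T)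
    (hζ : IsTimeWeight S lam ζ) (hχ : Integrable χ) (i : Fin 3) :
    IntegrableOn (fun p => ζ p.1 * (χ p.2 * energyFlux m E H i p)) (slab S) :=
  ((h.bddSmooth_energyFlux i).integrableOn_slab hST hχ hζ.smooth.continuous).congr
    (ae_of_all _ fun _ => mul_left_comm _ _ _)

lemma weighted_energy_identity (h : IsSmoothSolution T m₀ E₀ H₀ m E H)
    (hd : IsSmoothData m₀ E₀ H₀) (hS : 0 < S) (hST : S < T) (hζ : IsTimeWeight S lam ζ)
    (hχ : ContDiff ℝ ∞ χ) (hχi : Integrable χ) (hdχ : ∀ i, Integrable (pdScalar i χ)) :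
    ∫ p in slab S, (χ p.2 * weightedEnergy ζ E H (fun i => dx i m) (dt m) p
        + 2 * ∑ i, ζ p.1 * (pdScalar i χ p.2 * energyFlux m E H i p))
      = ζ 0 * ∫ x, χ x * energy₀ m₀ E₀ H₀ x := by
  set ed := energyDensity E H (fun i => dx i m)
  have hed : BddSmooth T ed := h.bddSmooth_energyDensity
  have in_time := hed.integral_slab_dt hS hST (h.tendsto_energyDensity hd (hS.trans hST)) hχi hζ
  have in_space := fun i => (h.bddSmooth_energyFlux i).integral_slab_dx hST i hχ hχi (hdχ i)
    hζ.smooth.continuous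
  have time_integrable : IntegrableOn
      (fun p : ST => χ p.2 * (- deriv ζ p.1 * ed p - ζ p.1 * dt ed p)) (slab S) := by
    refine ((hed.integrableOn_slab hST hχi hζ.continuous_deriv.neg).sub
      (hed.dt.integrableOn_slab hST hχi hζ.smooth.continuous)).congr (ae_of_all _ fun p => ?_)
    simp only [Pi.sub_apply, Pi.neg_apply]; ring
  have space_integrable : ∀ i, IntegrableOn (fun p : ST => ζ p.1 *
      (χ p.2 * dx i (energyFlux m E H i) p + pdScalar i χ p.2 * energyFlux m E H i p))
      (slab S) := fun i => by
    refine ((((h.bddSmooth_energyFlux i).dx i).integrableOn_slab hST hχi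
      hζ.smooth.continuous).add (h.integrableOn_mul_energyFlux hST hζ (hdχ i) i)).congr
      (ae_of_all _ fun p => ?_)
    simp only [Pi.add_apply]; ring
  calc _ = ∫ p in slab S, (χ p.2 * (- deriv ζ p.1 * ed p - ζ p.1 * dt ed p) + 2 * ∑ i, ζ p.1 *
          (χ p.2 * dx i (energyFlux m E H i) p + pdScalar i χ p.2 * energyFlux m E H i p)) := by
        refine setIntegral_congr_fun (isOpen_slab S).measurableSet fun p hp => ?_
        have balance := h.energy_balance (slab_mono hST.le hp)
        simp only [Fin.sum_univ_three, weightedEnergy] at balance ⊢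
        linear_combination χ p.2 * ζ p.1 * balance
    _ = _ := by
        rw [integral_add time_integrable
          ((integrable_finsetSum _ fun i _ => space_integrable i).const_mul 2),
          integral_const_mul, integral_finsetSum _ fun i _ => space_integrable i, in_time,
          Finset.sum_eq_zero fun i _ => in_space i, mul_zero, add_zero]

lemma flux_error_le (hζ : IsTimeWeight S lam ζ) (hl : 1 ≤ lam) (hκ : 0 ≤ κ) {p : ST}
    (hp : p ∈ slab S) :
    (1 - 6 * κ) * (polyWeight κ p.2 * weightedEnergy ζ E H (fun i => dx i m) (dt m) p)
      ≤ polyWeight κ p.2 * weightedEnergy ζ E H (fun i => dx i m) (dt m) p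
        + 2 * ∑ i, ζ p.1 * (pdScalar i (polyWeight κ) p.2 * energyFlux m E H i p) := by
  set χ := polyWeight κ
  set W := weightedEnergy ζ E H (fun i => dx i m) (dt m) p
  have hχp : 0 ≤ χ p.2 := (polyWeight.pos κ p.2).le
  have hζp := hζ.nonneg p.1
  have component : ∀ i, - (2 * κ * (χ p.2 * W))
      ≤ 2 * (ζ p.1 * (pdScalar i χ p.2 * energyFlux m E H i p)) := fun i => by
    refine neg_le_of_abs_le ?_
    calc |2 * (ζ p.1 * (pdScalar i χ p.2 * energyFlux m E H i p))|
        = |pdScalar i χ p.2| * (ζ p.1 * (2 * |energyFlux m E H i p|)) := by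
          rw [abs_mul, abs_mul, abs_mul, abs_of_nonneg hζp, abs_two]; ring
      _ ≤ (2 * κ * χ p.2)
          * (ζ p.1 * (energyDensity E H (fun i => dx i m) p + ‖dt m p‖ ^ 2)) := by
          gcongr
          · exact polyWeight.abs_pdScalar_le hκ i p.2
          · exact abs_energyFlux_le m E H i p
      _ ≤ (2 * κ * χ p.2) * W := by
          gcongr
          exact mul_energyDensity_add_le_weightedEnergy hζ hl hp
      _ = 2 * κ * (χ p.2 * W) := by ring
  rw [Fin.sum_univ_three]
  linarith [component 0, component 1, component 2]

lemma polyWeight_energy_le (h : IsSmoothSolution T m₀ E₀ H₀ m E H) (hd : IsSmoothData m₀ E₀ H₀)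
    (hS : 0 < S) (hST : S < T) (hζ : IsTimeWeight S lam ζ) (hl : 1 ≤ lam) (hκ : 0 < κ) :
    (1 - 6 * κ) * (∫ p in slab S, polyWeight κ p.2
        * weightedEnergy ζ E H (fun i => dx i m) (dt m) p)
      ≤ ζ 0 * ∫ x, energy₀ m₀ E₀ H₀ x := by
  have hχ := polyWeight.integrable hκ.ne'
  have hdχ := polyWeight.integrable_pdScalar hκ
  have hint := h.integrableOn_mul_weightedEnergy hST hζ hχ
  rw [← integral_const_mul]
  calc _ ≤ ∫ p in slab S, (polyWeight κ p.2 * weightedEnergy ζ E H (fun i => dx i m) (dt m) p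
          + 2 * ∑ i, ζ p.1 * (pdScalar i (polyWeight κ) p.2 * energyFlux m E H i p)) :=
        setIntegral_mono_on (hint.const_mul _) (hint.add ((integrable_finsetSum _ fun i _ =>
          h.integrableOn_mul_energyFlux hST hζ (hdχ i) i).const_mul 2))
          (isOpen_slab S).measurableSet fun p hp => flux_error_le hζ hl hκ.le hp
    _ = ζ 0 * ∫ x, polyWeight κ x * energy₀ m₀ E₀ H₀ x :=
        h.weighted_energy_identity hd hS hST hζ (polyWeight.smooth κ) hχ hdχ
    _ ≤ _ := by
        refine mul_le_mul_of_nonneg_left (integral_mono_of_nonneg ?_ hd.integrable_energy₀ ?_)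
          (hζ.nonneg 0) <;> refine ae_of_all _ fun x => ?_
        · exact mul_nonneg (polyWeight.pos κ x).le (energy₀_nonneg m₀ E₀ H₀ x)
        · exact mul_le_of_le_one_left (energy₀_nonneg m₀ E₀ H₀ x) (polyWeight.le_one κ x)

theorem energy_le (h : IsSmoothSolution T m₀ E₀ H₀ m E H) (hd : IsSmoothData m₀ E₀ H₀)
    (hS : 0 < S) (hST : S < T) (hζ : IsTimeWeight S lam ζ) (hl : 1 ≤ lam) :
    IntegrableOn (weightedEnergy ζ E H (fun i => dx i m) (dt m)) (slab S) ∧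
    ∫ p in slab S, weightedEnergy ζ E H (fun i => dx i m) (dt m) p
      ≤ ζ 0 * ∫ x, energy₀ m₀ E₀ H₀ x := by
  set A := ζ 0 * ∫ x, energy₀ m₀ E₀ H₀ x
  let κ : ℕ → ℝ := fun n => 1 / ((n : ℝ) + 1)
  have hκ : ∀ n, 0 < κ n := fun n => by positivity
  have hκ0 : Tendsto κ atTop (𝓝 0) := tendsto_one_div_add_atTop_nhds_zero_nat
  have bound_tendsto : Tendsto (fun n => A / (1 - 6 * κ n)) atTop (𝓝 A) := by
    have := (tendsto_const_nhds (x := A)).div ((hκ0.const_mul 6).const_sub 1) (by norm_num)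
    simpa [Pi.div_def] using this
  refine integral_le_of_tendsto
    (fun n => h.integrableOn_mul_weightedEnergy hST hζ (polyWeight.integrable (hκ n).ne'))
    (fun n => ?_) (ae_of_all _ fun p => ?_) ?_ bound_tendsto
  · filter_upwards [ae_restrict_mem (isOpen_slab S).measurableSet] with p hp using
      mul_nonneg (polyWeight.pos _ _).le (weightedEnergy_nonneg hζ (by linarith) hp)
  · simpa using ((polyWeight.tendsto_one p.2).comp hκ0).mul_const
      (weightedEnergy ζ E H (fun i => dx i m) (dt m) p)
  · filter_upwards [hκ0.eventually_lt_const (show (0 : ℝ) < 1 / 6 by norm_num)] with n hn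
    rw [le_div_iff₀ (by linarith), mul_comm]
    exact h.polyWeight_energy_le hd hS hST hζ hl (hκ n)

lemma integrableOn_energyDensity (h : IsSmoothSolution T m₀ E₀ H₀ m E H)
    (hd : IsSmoothData m₀ E₀ H₀) (hS : 0 < S) (hST : S < T) :
    IntegrableOn (fun p => energyDensity E H (fun i => dx i m) p + ‖dt m p‖ ^ 2) (slab S) := by
  obtain ⟨S', hSS', hST'⟩ := exists_between hST
  obtain ⟨ζ, hζ⟩ := exists_isTimeWeight (hS.trans hSS') one_pos
  obtain ⟨t₀, ht₀, hmin⟩ := (isCompact_Icc (a := 0) (b := S)).exists_isMinOn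
    ⟨0, left_mem_Icc.2 hS.le⟩ hζ.smooth.continuous.continuousOn
  have hc : 0 < ζ t₀ := hζ.pos t₀ (ht₀.2.trans_lt hSS')
  have hW := (h.energy_le hd (hS.trans hSS') hST' hζ le_rfl).1.mono_set (slab_mono hSS'.le)
  have hmeas := (isOpen_slab S).measurableSet
  refine (hW.const_mul (ζ t₀)⁻¹).mono'
    ((h.bddSmooth_energyDensity.add h.bddSmooth_m.dt.norm_sq).aestronglyMeasurable hST.le) ?_
  filter_upwards [ae_restrict_mem hmeas] with p hp
  have hnonneg := add_nonneg (energyDensity_nonneg E H (fun i => dx i m) p) (sq_nonneg ‖dt m p‖)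
  rw [Real.norm_of_nonneg hnonneg, inv_mul_eq_div, le_div_iff₀' hc]
  calc _ ≤ ζ p.1 * (energyDensity E H (fun i => dx i m) p + ‖dt m p‖ ^ 2) :=
        mul_le_mul_of_nonneg_right (hmin ⟨(mem_slab.1 hp).1.le, (mem_slab.1 hp).2.le⟩) hnonneg
    _ ≤ _ := mul_energyDensity_add_le_weightedEnergy hζ le_rfl (slab_mono hSS'.le hp)

lemma memLp_of_sq_norm_le (h : IsSmoothSolution T m₀ E₀ H₀ m E H) (hd : IsSmoothData m₀ E₀ H₀)
    (hS : 0 < S) (hST : S < T) {u : ST → R3} (hu : BddSmooth T u)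
    (hle : ∀ p, ‖u p‖ ^ 2 ≤ energyDensity E H (fun i => dx i m) p + ‖dt m p‖ ^ 2) :
    MemLp u 2 (volume.restrict (slab S)) := by
  have hum := hu.aestronglyMeasurable hST.le
  refine (memLp_two_iff_integrable_sq_norm hum).2
    ((h.integrableOn_energyDensity hd hS hST).mono' (hum.norm.pow 2) (ae_of_all _ fun p => ?_))
  rw [Real.norm_of_nonneg (by positivity)]
  exact hle p

lemma memLp_E (h : IsSmoothSolution T m₀ E₀ H₀ m E H) (hd : IsSmoothData m₀ E₀ H₀)
    (hS : 0 < S) (hST : S < T) : MemLp E 2 (volume.restrict (slab S)) :=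
  h.memLp_of_sq_norm_le hd hS hST h.bddSmooth_E fun p => by
    unfold energyDensity; rw [add_assoc, add_assoc]; exact le_add_of_nonneg_right (by positivity)

lemma memLp_H (h : IsSmoothSolution T m₀ E₀ H₀ m E H) (hd : IsSmoothData m₀ E₀ H₀)
    (hS : 0 < S) (hST : S < T) : MemLp H 2 (volume.restrict (slab S)) :=
  h.memLp_of_sq_norm_le hd hS hST h.bddSmooth_H fun p => by
    unfold energyDensity
    rw [add_comm (‖E p‖ ^ 2), add_assoc, add_assoc]
    exact le_add_of_nonneg_right (by positivity)

lemma memLp_dx (h : IsSmoothSolution T m₀ E₀ H₀ m E H) (hd : IsSmoothData m₀ E₀ H₀)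
    (hS : 0 < S) (hST : S < T) (i : Fin 3) : MemLp (dx i m) 2 (volume.restrict (slab S)) :=
  h.memLp_of_sq_norm_le hd hS hST (h.bddSmooth_m.dx i) fun _ =>
    (sq_norm_dx_le_energyDensity (g := fun j => dx j m) i).trans
      (le_add_of_nonneg_right (sq_nonneg _))

lemma memLp_dt (h : IsSmoothSolution T m₀ E₀ H₀ m E H) (hd : IsSmoothData m₀ E₀ H₀)
    (hS : 0 < S) (hST : S < T) : MemLp (dt m) 2 (volume.restrict (slab S)) :=
  h.memLp_of_sq_norm_le hd hS hST h.bddSmooth_m.dt fun _ =>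
    le_add_of_nonneg_left (energyDensity_nonneg _ _ _ _)

end IsSmoothSolution

/-! ### The energy inequality of weak solutions -/

namespace IsTimeWeight

variable {S lam : ℝ} {ζ : ℝ → ℝ}

lemma measurable_ofReal_neg_deriv (hζ : IsTimeWeight S lam ζ) :
    Measurable fun t => ENNReal.ofReal (- deriv ζ t) :=
  hζ.continuous_deriv.neg.measurable.ennreal_ofReal

lemma lintegral_neg_deriv (hζ : IsTimeWeight S lam ζ) (hl : 0 ≤ lam) {s : ℝ} (hs : 0 ≤ s)
    (hsS : s ≤ S) : ∫⁻ t in Ioo s S, ENNReal.ofReal (- deriv ζ t) = ENNReal.ofReal (ζ s) := by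
  have hint : IntegrableOn (fun t => - deriv ζ t) (Ioo s S) :=
    (hζ.continuous_deriv.neg.continuousOn.integrableOn_compact (isCompact_Icc (a := s)
      (b := S))).mono_set Ioo_subset_Icc_self
  rw [← ofReal_integral_eq_lintegral_ofReal hint, ← integral_Ioc_eq_integral_Ioo,
    ← intervalIntegral.integral_of_le hsS, hζ.integral_neg_deriv]
  filter_upwards [ae_restrict_mem measurableSet_Ioo] with t ht
  exact hζ.neg_deriv_nonneg hl (hs.trans_lt ht.1) ht.2

end IsTimeWeight

lemma lintegral_Ioo_mul_lintegral_Ioo {S : ℝ} {f g : ℝ → ℝ≥0∞} (hf : Measurable f)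
    (hg : AEMeasurable g (volume.restrict (Ioo 0 S))) :
    ∫⁻ t in Ioo 0 S, f t * ∫⁻ s in Ioo 0 t, g s
      = ∫⁻ s in Ioo 0 S, (∫⁻ t in Ioo s S, f t) * g s := by
  have inner_integral : ∀ t ∈ Ioo 0 S, f t * ∫⁻ s in Ioo 0 t, g s
      = ∫⁻ s in Ioo 0 S, {q : ℝ × ℝ | q.2 < q.1}.indicator (fun q => f q.1 * g q.2) (t, s) := by
    intro t ht
    have earlier : Ioo 0 t = Iio t ∩ Ioo 0 S := by rw [Iio_inter_Ioo, min_eq_left ht.2.le]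
    rw [← lintegral_const_mul'' _ (hg.mono_set (Ioo_subset_Ioo_right ht.2.le)), earlier,
      ← Measure.restrict_restrict measurableSet_Iio, ← lintegral_indicator measurableSet_Iio]
    rfl
  have outer_integral : ∀ s ∈ Ioo 0 S, (∫⁻ t in Ioo s S, f t) * g s
      = ∫⁻ t in Ioo 0 S, {q : ℝ × ℝ | q.2 < q.1}.indicator (fun q => f q.1 * g q.2) (t, s) := by
    intro s hs
    have later : Ioo s S = Ioi s ∩ Ioo 0 S := by
      ext t
      exact ⟨fun h => ⟨h.1, hs.1.trans h.1, h.2⟩, fun h => ⟨h.1, h.2.2⟩⟩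
    rw [← lintegral_mul_const _ hf, later, ← Measure.restrict_restrict measurableSet_Ioi,
      ← lintegral_indicator measurableSet_Ioi]
    rfl
  rw [setLIntegral_congr_fun measurableSet_Ioo inner_integral,
    setLIntegral_congr_fun measurableSet_Ioo outer_integral]
  refine lintegral_lintegral_swap (AEMeasurable.indicator ?_
    (measurableSet_lt measurable_snd measurable_fst))
  exact (hf.comp measurable_fst).aemeasurable.mul hg.comp_snd

lemma IsTimeWeight.lintegral_neg_deriv_mul_lintegral {S lam : ℝ} {ζ : ℝ → ℝ}
    (hζ : IsTimeWeight S lam ζ) (hl : 0 ≤ lam) {g : ℝ → ℝ≥0∞}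
    (hg : AEMeasurable g (volume.restrict (Ioo 0 S))) :
    ∫⁻ t in Ioo 0 S, ENNReal.ofReal (- deriv ζ t) * ∫⁻ s in Ioo 0 t, g s
      = ∫⁻ s in Ioo 0 S, ENNReal.ofReal (ζ s) * g s := by
  rw [lintegral_Ioo_mul_lintegral_Ioo hζ.measurable_ofReal_neg_deriv hg]
  refine setLIntegral_congr_fun measurableSet_Ioo fun s hs => ?_
  simp only [hζ.lintegral_neg_deriv hl hs.1.le hs.2.le]

lemma ofReal_norm_sq {F : Type} [NormedAddCommGroup F] (a : F) :
    ENNReal.ofReal (‖a‖ ^ 2) = ‖a‖ₑ ^ 2 := by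
  rw [ENNReal.ofReal_pow (norm_nonneg _), ofReal_norm]

lemma ofReal_sum_norm_sq (a b : R3) (c : Fin 3 → R3) :
    ENNReal.ofReal (‖a‖ ^ 2 + ‖b‖ ^ 2 + ∑ i, ‖c i‖ ^ 2)
      = ‖a‖ₑ ^ 2 + ‖b‖ₑ ^ 2 + ∑ i, ‖c i‖ₑ ^ 2 := by
  rw [ENNReal.ofReal_add (by positivity) (Finset.sum_nonneg fun i _ => by positivity),
    ENNReal.ofReal_add (by positivity) (by positivity),
    ENNReal.ofReal_sum_of_nonneg fun i _ => by positivity]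
  simp only [ofReal_norm_sq]

section WeightedEnergy

variable {S lam : ℝ} {ζ : ℝ → ℝ} {E H v : ST → R3} {g : Fin 3 → ST → R3} {μ : Measure ST}

lemma aestronglyMeasurable_energyDensity (hE : AEStronglyMeasurable E μ)
    (hH : AEStronglyMeasurable H μ) (hg : ∀ i, AEStronglyMeasurable (g i) μ) :
    AEStronglyMeasurable (energyDensity E H g) μ :=
  ((hE.norm.pow 2).add (hH.norm.pow 2)).add
    (Finset.aestronglyMeasurable_fun_sum _ fun i _ => (hg i).norm.pow 2)

lemma aestronglyMeasurable_weightedEnergy (hζ : IsTimeWeight S lam ζ)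
    (hD : AEStronglyMeasurable (energyDensity E H g) μ) (hv : AEStronglyMeasurable v μ) :
    AEStronglyMeasurable (weightedEnergy ζ E H g v) μ :=
  ((hζ.continuous_deriv.neg.comp continuous_fst).aestronglyMeasurable.mul hD).add
    ((hζ.smooth.continuous.comp continuous_fst).aestronglyMeasurable.mul (hv.norm.pow 2))

lemma ofReal_weightedEnergy (hζ : IsTimeWeight S lam ζ) (hl : 0 ≤ lam) {p : ST}
    (hp : p ∈ slab S) :
    ENNReal.ofReal (weightedEnergy ζ E H g v p)
      = ENNReal.ofReal (- deriv ζ p.1) * ENNReal.ofReal (energyDensity E H g p)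
        + ENNReal.ofReal (ζ p.1) * ‖v p‖ₑ ^ 2 := by
  have hn := hζ.neg_deriv_nonneg hl (mem_slab.1 hp).1 (mem_slab.1 hp).2
  have hz := hζ.nonneg p.1
  rw [weightedEnergy, ENNReal.ofReal_add (mul_nonneg hn (energyDensity_nonneg E H g p))
    (mul_nonneg hz (sq_nonneg _)), ENNReal.ofReal_mul hn, ENNReal.ofReal_mul hz, ofReal_norm_sq]

lemma lintegral_ofReal_weightedEnergy (hζ : IsTimeWeight S lam ζ) (hl : 0 ≤ lam)
    (hD : AEStronglyMeasurable (energyDensity E H g) (volume.restrict (slab S)))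
    (hv : AEStronglyMeasurable v (volume.restrict (slab S))) :
    ∫⁻ p in slab S, ENNReal.ofReal (weightedEnergy ζ E H g v p)
      = ∫⁻ t in Ioo 0 S, ENNReal.ofReal (- deriv ζ t)
        * ((∫⁻ x : R3, ENNReal.ofReal (energyDensity E H g (t, x)))
          + ∫⁻ s in Ioo 0 t, ∫⁻ x : R3, ‖v (s, x)‖ₑ ^ 2) := by
  have hζ' := hζ.measurable_ofReal_neg_deriv
  have measD : AEMeasurable (fun p => ENNReal.ofReal (energyDensity E H g p))
      (volume.restrict (slab S)) := hD.aemeasurable.ennreal_ofReal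
  have measv : AEMeasurable (fun p => ‖v p‖ₑ ^ 2) (volume.restrict (slab S)) :=
    hv.enorm.pow_const 2
  have measD' := (hζ'.comp measurable_fst).aemeasurable.mul measD
  have measv' := (hζ.smooth.continuous.measurable.ennreal_ofReal.comp
    measurable_fst).aemeasurable.mul measv
  have sliceD := volume_restrict_slab S ▸ measD
  have slicev := volume_restrict_slab S ▸ measv
  have layer : ∫⁻ t in Ioo 0 S, ENNReal.ofReal (ζ t) * ∫⁻ x : R3, ‖v (t, x)‖ₑ ^ 2
      = ∫⁻ t in Ioo 0 S, ENNReal.ofReal (- deriv ζ t)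
        * ∫⁻ s in Ioo 0 t, ∫⁻ x : R3, ‖v (s, x)‖ₑ ^ 2 := by
    rw [hζ.lintegral_neg_deriv_mul_lintegral hl slicev.lintegral_prod_right']
  rw [setLIntegral_congr_fun (isOpen_slab S).measurableSet
    fun p hp => ofReal_weightedEnergy hζ hl hp]
  calc _ = (∫⁻ t in Ioo 0 S, ∫⁻ x : R3, ENNReal.ofReal (- deriv ζ t)
          * ENNReal.ofReal (energyDensity E H g (t, x)))
        + ∫⁻ t in Ioo 0 S, ∫⁻ x : R3, ENNReal.ofReal (ζ t) * ‖v (t, x)‖ₑ ^ 2 := by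
        refine (lintegral_add_left' measD' _).trans ?_
        exact congr_arg₂ _ (lintegral_slab S measD') (lintegral_slab S measv')
    _ = _ := by
        simp only [lintegral_const_mul' _ _ ENNReal.ofReal_ne_top, mul_add]
        rw [layer]
        exact (lintegral_add_left' (hζ'.aemeasurable.mul sliceD.lintegral_prod_right') _).symm

end WeightedEnergy

namespace IsWeakSolutionWith

variable {S lam : ℝ} {ζ : ℝ → ℝ} {m₀ E₀ H₀ : R3 → R3} {m E H mt : ST → R3}
  {G : Fin 3 → ST → R3}

lemma aestronglyMeasurable_energyDensity (W : IsWeakSolutionWith m₀ E₀ H₀ m E H mt G) (S : ℝ) :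
    AEStronglyMeasurable (energyDensity E H G) (volume.restrict (slab S)) :=
  MLL.aestronglyMeasurable_energyDensity (W.class_E.memLp S).1 (W.class_H.memLp S).1
    fun i => ((W.grad_m i).memLp S).1

lemma ae_energyDensity_add_le (W : IsWeakSolutionWith m₀ E₀ H₀ m E H mt G)
    (hd : IsSmoothData m₀ E₀ H₀) :
    ∀ᵐ t ∂(volume.restrict (Ioo 0 S)), (∫⁻ x : R3, ENNReal.ofReal (energyDensity E H G (t, x)))
        + ∫⁻ s in Ioo 0 t, ∫⁻ x : R3, ‖mt (s, x)‖ₑ ^ 2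
      ≤ ENNReal.ofReal (∫ x, energy₀ m₀ E₀ H₀ x) := by
  filter_upwards [ae_restrict_of_ae_restrict_of_subset
    (Ioo_subset_Ioi_self : Ioo 0 S ⊆ Ioi 0) W.energy] with t ht
  rw [ofReal_integral_eq_lintegral_ofReal hd.integrable_energy₀
    (ae_of_all _ fun x => energy₀_nonneg m₀ E₀ H₀ x)]
  simpa only [energyDensity, energy₀, ofReal_sum_norm_sq] using ht

lemma energy_le (W : IsWeakSolutionWith m₀ E₀ H₀ m E H mt G) (hd : IsSmoothData m₀ E₀ H₀)
    (hS : 0 < S) (hζ : IsTimeWeight S lam ζ) (hl : 0 ≤ lam) :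
    IntegrableOn (weightedEnergy ζ E H G mt) (slab S) ∧
    ∫ p in slab S, weightedEnergy ζ E H G mt p ≤ ζ 0 * ∫ x, energy₀ m₀ E₀ H₀ x := by
  have hD := W.aestronglyMeasurable_energyDensity S
  have hv := (W.memLp_mt S hS).1
  refine integral_le_of_lintegral_ofReal_le (aestronglyMeasurable_weightedEnergy hζ hD hv) ?_
    (mul_nonneg (hζ.nonneg 0) (integral_nonneg (energy₀_nonneg m₀ E₀ H₀))) ?_
  · filter_upwards [ae_restrict_mem (isOpen_slab S).measurableSet] with p hp
    exact weightedEnergy_nonneg hζ hl hp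
  calc ∫⁻ p in slab S, ENNReal.ofReal (weightedEnergy ζ E H G mt p)
      ≤ ∫⁻ t in Ioo 0 S, ENNReal.ofReal (- deriv ζ t)
          * ENNReal.ofReal (∫ x, energy₀ m₀ E₀ H₀ x) := by
        rw [lintegral_ofReal_weightedEnergy hζ hl hD hv]
        refine lintegral_mono_ae ?_
        filter_upwards [W.ae_energyDensity_add_le hd] with t ht
        gcongr
    _ = ENNReal.ofReal (ζ 0 * ∫ x, energy₀ m₀ E₀ H₀ x) := by
        rw [lintegral_mul_const _ hζ.measurable_ofReal_neg_deriv,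
          hζ.lintegral_neg_deriv hl le_rfl hS.le, ENNReal.ofReal_mul (hζ.nonneg 0)]

end IsWeakSolutionWith

/-! ### Weak time derivatives and primitives in time -/

section Fubini

variable {S : ℝ}

lemma lintegral_slab_symm (S : ℝ) {f : ST → ℝ≥0∞}
    (hf : AEMeasurable f (volume.restrict (slab S))) :
    ∫⁻ p in slab S, f p = ∫⁻ x : R3, ∫⁻ t in Ioo 0 S, f (t, x) := by
  rw [volume_restrict_slab] at hf ⊢
  exact lintegral_prod_symm _ hf

lemma integral_slab_symm {f : ST → F} (hf : IntegrableOn f (slab S)) :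
    ∫ p in slab S, f p = ∫ x : R3, ∫ t in Ioo 0 S, f (t, x) := by
  rw [IntegrableOn, volume_restrict_slab] at hf
  rw [volume_restrict_slab]
  exact integral_prod_symm _ hf

lemma ae_ae_of_ae_slab {P : ST → Prop} (h : ∀ᵐ p ∂(volume.restrict (slab S)), P p) :
    ∀ᵐ x : R3, ∀ᵐ t ∂(volume.restrict (Ioo 0 S)), P (t, x) := by
  rw [volume_restrict_slab] at h
  exact Measure.ae_ae_of_ae_prod (Measure.measurePreserving_swap.quasiMeasurePreserving.ae h)

lemma ae_slab_of_ae {P : R3 → Prop} (h : ∀ᵐ x, P x) :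
    ∀ᵐ p ∂(volume.restrict (slab S)), P p.2 := by
  rw [volume_restrict_slab]
  exact Measure.quasiMeasurePreserving_snd.ae h

lemma ae_slab_eq_zero {f : ST → ℝ} (hf : AEStronglyMeasurable f (volume.restrict (slab S)))
    (h : ∀ᵐ x : R3, ∀ᵐ t ∂(volume.restrict (Ioo 0 S)), f (t, x) = 0) :
    f =ᵐ[volume.restrict (slab S)] 0 := by
  have integral_zero : ∫⁻ p in slab S, ‖f p‖ₑ = 0 := by
    rw [lintegral_slab_symm S hf.enorm, lintegral_eq_zero_of_ae_eq_zero]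
    filter_upwards [h] with x hx
    refine lintegral_eq_zero_of_ae_eq_zero ?_
    filter_upwards [hx] with t ht
    rw [ht, enorm_zero, Pi.zero_apply]
  filter_upwards [(lintegral_eq_zero_iff' hf.enorm).1 integral_zero] with p hp
  exact enorm_eq_zero.1 hp

end Fubini

/-- The part of the slab above a ball. Unlike the balls of space-time it is a product, so that
Fubini's theorem applies to locally integrable functions restricted to it. -/
def cyl (S R : ℝ) : Set ST := Ioo 0 S ×ˢ Metric.ball (0 : R3) R

section Cylinder

variable {S R : ℝ}

lemma isOpen_cyl (S R : ℝ) : IsOpen (cyl S R) := isOpen_Ioo.prod Metric.isOpen_ball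

lemma cyl_subset_slab (S R : ℝ) : cyl S R ⊆ slab S := prod_mono_right (subset_univ _)

lemma volume_restrict_cyl (S R : ℝ) : (volume : Measure ST).restrict (cyl S R)
    = ((volume : Measure ℝ).restrict (Ioo 0 S)).prod
      ((volume : Measure R3).restrict (Metric.ball 0 R)) := by
  rw [cyl, Measure.volume_eq_prod, ← Measure.prod_restrict]

lemma cyl_subset_future_inter_ball (S R : ℝ) :
    cyl S R ⊆ future ∩ Metric.ball 0 (max S R) := by
  refine fun p hp => ⟨mem_future.2 hp.1.1, ?_⟩
  have hx : ‖p.2‖ < R := by simpa using hp.2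
  rw [mem_ball_zero_iff, Prod.norm_def, Real.norm_of_nonneg hp.1.1.le]
  exact max_lt_max hp.1.2 hx

lemma LocIntegrable.integrableOn_cyl {F : Type} [NormedAddCommGroup F] {f : ST → F}
    (hf : LocIntegrable f) (S R : ℝ) : IntegrableOn f (cyl S R) :=
  (hf _).mono_set (cyl_subset_future_inter_ball S R)

lemma integrableOn_cyl_comp_snd {F : Type} [NormedAddCommGroup F] {u₀ : R3 → F}
    (h : Continuous u₀) (S R : ℝ) : IntegrableOn (fun p : ST => u₀ p.2) (cyl S R) :=
  ((h.comp continuous_snd).continuousOn.integrableOn_compact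
    (isCompact_Icc.prod (isCompact_closedBall (0 : R3) R))).mono_set
    (prod_mono Ioo_subset_Icc_self Metric.ball_subset_closedBall)

lemma ae_integrableOn_time {F : Type} [NormedAddCommGroup F] {a : ST → F}
    (ha : ∀ R, IntegrableOn a (cyl S R)) :
    ∀ᵐ x : R3, IntegrableOn (fun t => a (t, x)) (Ioo 0 S) := by
  have above_ball : ∀ n : ℕ, ∀ᵐ x : R3, x ∈ Metric.ball (0 : R3) n →
      IntegrableOn (fun t => a (t, x)) (Ioo 0 S) := by
    intro n
    have h := ha n
    rw [IntegrableOn, volume_restrict_cyl] at h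
    exact (ae_restrict_iff' measurableSet_ball).1 h.prod_left_ae
  filter_upwards [ae_all_iff.2 above_ball] with x hx
  obtain ⟨n, hn⟩ := exists_nat_gt ‖x‖
  exact hx n (by simpa using hn)

lemma integrableOn_smul_of_spatial_support {b : ST → ℝ} {f : ST → F} (hb : Continuous b)
    (hR : ∀ p : ST, R ≤ ‖p.2‖ → b p = 0) (hf : IntegrableOn f (cyl S R)) :
    IntegrableOn (fun p => b p • f p) (slab S) := by
  obtain ⟨C, hC⟩ := ((isCompact_Icc (a := 0) (b := S)).prod
    (isCompact_closedBall (0 : R3) R)).exists_bound_of_continuousOn hb.continuousOn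
  have integrable_cyl : IntegrableOn (fun p => b p • f p) (cyl S R) := by
    refine hf.bdd_smul C hb.aestronglyMeasurable ?_
    filter_upwards [ae_restrict_mem (isOpen_cyl S R).measurableSet] with p hp
    exact hC p ⟨Ioo_subset_Icc_self hp.1, Metric.ball_subset_closedBall hp.2⟩
  refine integrable_cyl.of_forall_sdiff_eq_zero (isOpen_slab S).measurableSet fun p hp => ?_
  rw [hR p, zero_smul]
  by_contra! hlt
  exact hp.2 ⟨hp.1.1, by simpa using hlt⟩

end Cylinder

/-- The primitive in time `∫₀ᵗ a(s, x) ds`. -/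
def primitive (a : ST → F) (p : ST) : F := ∫ s in Ioo 0 p.1, a (s, p.2)

section Primitive

variable {S : ℝ} {a : ST → F}

lemma stronglyMeasurable_primitive (ha : StronglyMeasurable a) :
    StronglyMeasurable (primitive a) := by
  have as_indicator : primitive a = fun p : ST => ∫ s,
      {q : ST × ℝ | 0 < q.2 ∧ q.2 < q.1.1}.indicator (fun q => a (q.2, q.1.2)) (p, s) := by
    ext p
    rw [primitive, ← integral_indicator measurableSet_Ioo]
    rfl
  rw [as_indicator]
  refine StronglyMeasurable.integral_prod_right' ?_
  refine StronglyMeasurable.indicator (ha.comp_measurable (by fun_prop)) ?_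
  exact (measurableSet_lt measurable_const measurable_snd).inter
    (measurableSet_lt measurable_snd (measurable_fst.comp measurable_fst))

lemma aestronglyMeasurable_primitive (ha : AEStronglyMeasurable a (volume.restrict (slab S))) :
    AEStronglyMeasurable (primitive a) (volume.restrict (slab S)) := by
  obtain ⟨b, hb, hab⟩ := ha
  refine ⟨primitive b, stronglyMeasurable_primitive hb, ?_⟩
  filter_upwards [ae_slab_of_ae (ae_ae_of_ae_slab hab),
    ae_restrict_mem (isOpen_slab S).measurableSet] with p hp hpS
  exact integral_congr_ae (ae_restrict_of_ae_restrict_of_subset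
    (Ioo_subset_Ioo_right (mem_slab.1 hpS).2.le) hp)

lemma norm_primitive_le {p : ST} (hp : p.1 ≤ S)
    (ha : IntegrableOn (fun t => a (t, p.2)) (Ioo 0 S)) :
    ‖primitive a p‖ ≤ ∫ s in Ioo 0 S, ‖a (s, p.2)‖ :=
  (norm_integral_le_integral_norm _).trans
    (setIntegral_mono_set ha.norm (ae_of_all _ fun _ => norm_nonneg _)
      (Ioo_subset_Ioo_right hp).eventuallyLE)

lemma integrableOn_primitive (ham : AEStronglyMeasurable a (volume.restrict (slab S)))
    (ha : ∀ R, IntegrableOn a (cyl S R)) (R : ℝ) : IntegrableOn (primitive a) (cyl S R) := by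
  have integrable_bound :
      IntegrableOn (fun p : ST => ∫ s in Ioo 0 S, ‖a (s, p.2)‖) (cyl S R) := by
    have h := ha R
    rw [IntegrableOn, volume_restrict_cyl] at h ⊢
    exact h.integral_norm_prod_right.comp_snd _
  refine integrable_bound.mono'
    ((aestronglyMeasurable_primitive ham).mono_set (cyl_subset_slab S R)) ?_
  filter_upwards [ae_restrict_of_ae_restrict_of_subset (cyl_subset_slab S R)
    (ae_slab_of_ae (ae_integrableOn_time ha)),
    ae_restrict_mem (isOpen_cyl S R).measurableSet] with p hp hpS
  exact norm_primitive_le hpS.1.2.le hp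

end Primitive

lemma integral_tail_smul [CompleteSpace F] {S : ℝ} {g : ℝ → ℝ} {f : ℝ → F}
    (hf : IntegrableOn f (Ioo 0 S))
    (hg : Continuous g) (hgS : ∀ s, S ≤ s → g s = 0) :
    ∫ t in Ioo 0 S, (∫ s in Ioi t, g s) • f t = ∫ s in Ioo 0 S, g s • ∫ t in Ioo 0 s, f t := by
  have hgi : IntegrableOn g (Ioo 0 S) :=
    (hg.continuousOn.integrableOn_compact isCompact_Icc).mono_set Ioo_subset_Icc_self
  have integrable_above_diagonal :
      Integrable ({q : ℝ × ℝ | q.1 < q.2}.indicator fun q => g q.2 • f q.1)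
        ((volume.restrict (Ioo 0 S)).prod (volume.restrict (Ioo 0 S))) :=
    (Integrable.smul_prod hgi hf).swap.indicator (measurableSet_lt measurable_fst measurable_snd)
  have inner_integral : ∀ t ∈ Ioo 0 S, (∫ s in Ioi t, g s) • f t
      = ∫ s in Ioo 0 S, {q : ℝ × ℝ | q.1 < q.2}.indicator (fun q => g q.2 • f q.1) (t, s) := by
    intro t ht
    have later : ∫ s in Ioi t, g s = ∫ s in Ioo 0 S ∩ Ioi t, g s := by
      refine setIntegral_eq_of_subset_of_forall_sdiff_eq_zero measurableSet_Ioi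
        inter_subset_right fun s hs => hgS s ?_
      by_contra! hlt
      exact hs.2 ⟨⟨ht.1.trans hs.1, hlt⟩, hs.1⟩
    rw [later, ← integral_smul_const, ← setIntegral_indicator measurableSet_Ioi]
    rfl
  have outer_integral : ∀ s ∈ Ioo 0 S, g s • ∫ t in Ioo 0 s, f t
      = ∫ t in Ioo 0 S, {q : ℝ × ℝ | q.1 < q.2}.indicator (fun q => g q.2 • f q.1) (t, s) := by
    intro s hs
    have earlier : Ioo 0 s = Ioo 0 S ∩ Iio s := by rw [Ioo_inter_Iio, min_eq_right hs.2.le]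
    rw [← integral_smul, earlier, ← setIntegral_indicator measurableSet_Iio]
    rfl
  rw [setIntegral_congr_fun measurableSet_Ioo inner_integral,
    setIntegral_congr_fun measurableSet_Ioo outer_integral]
  exact integral_integral_swap integrable_above_diagonal

/-- The integral over later times. -/
def tail (g : ST → ℝ) (p : ST) : ℝ := ∫ s in Ioi p.1, g (s, p.2)

section Tail

variable {g : ST → ℝ}

lemma hasCompactSupport_time_slice (hc : HasCompactSupport g) (x : R3) :
    HasCompactSupport fun t : ℝ => g (t, x) :=
  HasCompactSupport.of_support_subset_isCompact (hc.isCompact.image continuous_fst)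
    fun t ht => ⟨(t, x), subset_tsupport _ ht, rfl⟩

lemma exists_spatial_support (hc : HasCompactSupport g) :
    ∃ R : ℝ, ∀ p : ST, R ≤ ‖p.2‖ → g p = 0 := by
  obtain ⟨R, hR⟩ := hc.isCompact.isBounded.subset_ball (0 : ST)
  refine ⟨R, fun p hp => image_eq_zero_of_notMem_tsupport fun hmem => ?_⟩
  have hlt := mem_ball_zero_iff.1 (hR hmem)
  exact absurd (hp.trans (norm_snd_le p)) hlt.not_ge

lemma tail_eq_zero_of_spatial {x : R3} (h : ∀ s, g (s, x) = 0) (t : ℝ) : tail g (t, x) = 0 :=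
  setIntegral_eq_zero_of_forall_eq_zero fun s _ => h s

/-- Smoothness comes from writing the tail as a convolution in time with the indicator function of
`(-∞, 0]`. -/
lemma IsTest.contDiff_tail (hg : IsTest g) : ContDiff ℝ ∞ (tail g) := by
  have h_loc : LocallyIntegrable ((Iic (0 : ℝ)).indicator fun _ => (1 : ℝ)) volume :=
    (locallyIntegrable_const (1 : ℝ)).indicator measurableSet_Iic
  have h_conv := contDiffOn_convolution_right_with_param (μ := volume) (n := ⊤)
    (ContinuousLinearMap.lsmul ℝ ℝ) (g := fun (x : R3) (t : ℝ) => g (t, x)) (s := univ)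
    (k := Prod.fst '' tsupport g) isOpen_univ (hg.2.isCompact.image continuous_fst)
    (fun x t _ ht => image_eq_zero_of_notMem_tsupport fun h => ht ⟨(t, x), h, rfl⟩) h_loc
    ((hg.1.comp (contDiff_snd.prodMk contDiff_fst)).contDiffOn)
  rw [univ_prod_univ, contDiffOn_univ] at h_conv
  have tail_eq_conv : tail g = fun p : ST => (fun q : R3 × ℝ => (convolution
      ((Iic (0 : ℝ)).indicator fun _ => (1 : ℝ)) (fun t : ℝ => g (t, q.1))
      (ContinuousLinearMap.lsmul ℝ ℝ) volume) q.2) (p.2, p.1) := by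
    ext ⟨t, x⟩
    simp only [tail, convolution_eq_swap]
    rw [← integral_Ici_eq_integral_Ioi, ← integral_indicator measurableSet_Ici]
    congr 1
    ext s
    by_cases hs : t ≤ s <;> simp [hs]
  rw [tail_eq_conv]
  exact h_conv.comp (contDiff_snd.prodMk contDiff_fst)

lemma IsTest.hasDerivAt_tail (hg : IsTest g) (t : ℝ) (x : R3) :
    HasDerivAt (fun s => tail g (s, x)) (- g (t, x)) t := by
  have hcont : Continuous fun s : ℝ => g (s, x) := hg.1.continuous.comp (by fun_prop)
  have hi : Integrable fun s : ℝ => g (s, x) :=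
    hcont.integrable_of_hasCompactSupport (hasCompactSupport_time_slice hg.2 x)
  have split_at_zero :
      (fun s => tail g (s, x)) = fun s => (∫ r in s..0, g (r, x)) + tail g (0, x) :=
    funext fun s =>
      (intervalIntegral.integral_interval_add_Ioi hi.integrableOn hi.integrableOn).symm
  rw [split_at_zero]
  exact (intervalIntegral.integral_hasDerivAt_left (hcont.intervalIntegrable _ _)
    (hcont.stronglyMeasurableAtFilter _ _) hcont.continuousAt).add_const _

lemma IsTest.dt_tail (hg : IsTest g) (p : ST) : dt (tail g) p = - g p :=
  (hasDerivAt_time (hg.contDiff_tail.differentiable (by simp) p)).unique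
    (hg.hasDerivAt_tail p.1 p.2)

variable {S : ℝ}

lemma eq_zero_of_tsupport_subset_slab (hs : tsupport g ⊆ slab S) {p : ST} (hp : p ∉ slab S) :
    g p = 0 :=
  image_eq_zero_of_notMem_tsupport fun h => hp (hs h)

lemma eq_zero_of_tsupport_subset_slab_of_le (hs : tsupport g ⊆ slab S) {p : ST} (hp : S ≤ p.1) :
    g p = 0 :=
  eq_zero_of_tsupport_subset_slab hs fun h => (mem_slab.1 h).2.not_ge hp

lemma tail_eq_zero (hs : tsupport g ⊆ slab S) {p : ST} (hp : S ≤ p.1) : tail g p = 0 :=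
  setIntegral_eq_zero_of_forall_eq_zero fun _ hlt =>
    eq_zero_of_tsupport_subset_slab_of_le hs (hp.trans (le_of_lt hlt))

/-- A test function whose time derivative is `-g` in the future; the smooth transition makes its
support compact. -/
def tailTest (g : ST → ℝ) (c : F) (p : ST) : F := (Real.smoothTransition (p.1 + 2) * tail g p) • c

lemma tailTest_eq (g : ST → ℝ) (c : F) {p : ST} (hp : -1 ≤ p.1) :
    tailTest g c p = tail g p • c := by
  rw [tailTest, Real.smoothTransition.one_of_one_le (by linarith), one_mul]

lemma IsTest.tailTest (hg : IsTest g) (hs : tsupport g ⊆ slab S) (c : F) :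
    IsTest (tailTest g c) := by
  refine ⟨((Real.smoothTransition.contDiff.comp (by fun_prop : ContDiff ℝ ∞
    fun p : ST => p.1 + 2)).mul hg.contDiff_tail).smul contDiff_const, ?_⟩
  refine HasCompactSupport.of_support_subset_isCompact ((isCompact_Icc (a := -2) (b := S)).prod
    (hg.2.isCompact.image continuous_snd)) fun p hp => ?_
  have transition_ne : Real.smoothTransition (p.1 + 2) ≠ 0 := fun h =>
    hp (by simp [MLL.tailTest, h])
  have tail_ne : tail g p ≠ 0 := fun h => hp (by simp [MLL.tailTest, h])
  refine ⟨⟨?_, ?_⟩, ?_⟩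
  · by_contra! hlt
    exact transition_ne (Real.smoothTransition.zero_of_nonpos (by linarith))
  · by_contra! hlt
    exact tail_ne (tail_eq_zero hs hlt.le)
  · by_contra hx
    refine tail_ne (tail_eq_zero_of_spatial (fun s => ?_) p.1)
    exact image_eq_zero_of_notMem_tsupport fun h => hx ⟨(s, p.2), h, rfl⟩

lemma IsTest.dt_tailTest (hg : IsTest g) (c : F) {p : ST} (hp : p ∈ future) :
    dt (MLL.tailTest g c) p = -(g p • c) := by
  have near : MLL.tailTest g c =ᶠ[𝓝 p] fun q => tail g q • c := by
    filter_upwards [isOpen_future.mem_nhds hp] with q hq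
    exact tailTest_eq g c (by linarith [mem_future.1 hq])
  have hasDeriv : HasFDerivAt (fun q => tail g q • c) ((fderiv ℝ (tail g) p).smulRight c) p :=
    (hg.contDiff_tail.differentiable (by simp) p).hasFDerivAt.smul_const c
  have time := hg.dt_tail p
  rw [dt] at time
  rw [dt, near.fderiv_eq, hasDeriv.fderiv, ContinuousLinearMap.smulRight_apply, time, neg_smul]

lemma integral_smul_initial [CompleteSpace F] {u₀ : R3 → F} (hs : tsupport g ⊆ slab S)
    (hi : IntegrableOn (fun p => g p • u₀ p.2) (slab S)) :
    ∫ p in slab S, g p • u₀ p.2 = ∫ x, tail g (0, x) • u₀ x := by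
  rw [integral_slab_symm hi]
  congr with x
  have tail_zero : tail g (0, x) = ∫ s in Ioo 0 S, g (s, x) :=
    setIntegral_eq_of_subset_of_forall_sdiff_eq_zero measurableSet_Ioi (fun s hs => hs.1)
      fun s hs' => eq_zero_of_tsupport_subset_slab hs fun h => hs'.2 (mem_slab.1 h)
  rw [tail_zero]
  exact integral_smul_const (fun t => g (t, x)) (u₀ x)

lemma integral_smul_primitive [CompleteSpace F] {a : ST → F} (hg : Continuous g)
    (hs : tsupport g ⊆ slab S)
    (ha : ∀ R, IntegrableOn a (cyl S R))
    (hga : IntegrableOn (fun p => g p • primitive a p) (slab S))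
    (hta : IntegrableOn (fun p => tail g p • a p) (slab S)) :
    ∫ p in slab S, g p • primitive a p = ∫ p in slab S, tail g p • a p := by
  rw [integral_slab_symm hga, integral_slab_symm hta]
  refine integral_congr_ae ?_
  filter_upwards [ae_integrableOn_time ha] with x hx
  exact (integral_tail_smul hx (g := fun s => g (s, x)) (hg.comp (by fun_prop))
    fun s hS => eq_zero_of_tsupport_subset_slab_of_le hs hS).symm

lemma ae_eq_add_primitive [CompleteSpace F] {u a : ST → F} {u₀ : R3 → F}
    (hu : ∀ R, IntegrableOn u (cyl S R)) (ham : AEStronglyMeasurable a (volume.restrict (slab S)))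
    (ha : ∀ R, IntegrableOn a (cyl S R)) (hu₀ : Continuous u₀)
    (tested : ∀ g : ST → ℝ, IsTest g → tsupport g ⊆ slab S →
      ∫ p in slab S, g p • u p
        = (∫ x, tail g (0, x) • u₀ x) + ∫ p in slab S, tail g p • a p) :
    ∀ᵐ p ∂(volume.restrict (slab S)), u p = u₀ p.2 + primitive a p := by
  have hint : ∀ R, IntegrableOn (fun p => u p - u₀ p.2 - primitive a p) (cyl S R) := fun R =>
    ((hu R).sub (integrableOn_cyl_comp_snd hu₀ S R)).sub (integrableOn_primitive ham ha R)
  have hloc : LocallyIntegrableOn (fun p => u p - u₀ p.2 - primitive a p) (slab S) := fun p hp =>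
    ⟨cyl S (‖p.2‖ + 1), mem_nhdsWithin_of_mem_nhds
      ((isOpen_cyl _ _).mem_nhds ⟨hp.1, by simp⟩), hint _⟩
  have orthogonal : ∀ g : ST → ℝ, ContDiff ℝ ∞ g → HasCompactSupport g → tsupport g ⊆ slab S →
      ∫ p, g p • (u p - u₀ p.2 - primitive a p) = 0 := by
    intro g hg hc hs
    obtain ⟨R, hR⟩ := exists_spatial_support hc
    have hRt : ∀ p : ST, R ≤ ‖p.2‖ → tail g p = 0 := fun p hp =>
      tail_eq_zero_of_spatial (fun s => hR (s, p.2) hp) p.1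
    have int_u := integrableOn_smul_of_spatial_support hg.continuous hR (hu R)
    have int_u₀ := integrableOn_smul_of_spatial_support hg.continuous hR
      (integrableOn_cyl_comp_snd hu₀ S R)
    have int_prim := integrableOn_smul_of_spatial_support hg.continuous hR
      (integrableOn_primitive ham ha R)
    have int_tail := integrableOn_smul_of_spatial_support
      (IsTest.contDiff_tail ⟨hg, hc⟩).continuous hRt (ha R)
    have int_sub : IntegrableOn (fun p => g p • u p - g p • u₀ p.2) (slab S) := int_u.sub int_u₀
    rw [← setIntegral_eq_integral_of_forall_compl_eq_zero (s := slab S) fun p hp => by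
      rw [eq_zero_of_tsupport_subset_slab hs hp, zero_smul]]
    simp only [smul_sub]
    rw [integral_sub int_sub int_prim, integral_sub int_u int_u₀,
      integral_smul_initial hs int_u₀,
      integral_smul_primitive hg.continuous hs ha int_prim int_tail, tested g ⟨hg, hc⟩ hs]
    abel
  rw [ae_restrict_iff' (isOpen_slab S).measurableSet]
  filter_upwards [(isOpen_slab S).ae_eq_zero_of_integral_contDiff_smul_eq_zero hloc orthogonal]
    with p hp hpS
  rw [← sub_eq_zero, ← hp hpS]
  abel

end Tail

/-- On almost every line `x = const`, the function `u` is on `(0, S)` the primitive of `a` with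
initial value `u₀`. -/
def IsTimePrimitive (S : ℝ) (u₀ : R3 → F) (u a : ST → F) : Prop :=
  ∀ᵐ x : R3, IntegrableOn (fun t => a (t, x)) (Ioo 0 S) ∧
    ∀ᵐ t ∂(volume.restrict (Ioo 0 S)), u (t, x) = u₀ x + primitive a (t, x)

section WeakDt

variable {S : ℝ} {u v : ST → R3} {u₀ : R3 → R3}

lemma IsWeakDtWithTrace.integral_smul (h : IsWeakDtWithTrace u v u₀)
    (hu : ∀ R, IntegrableOn u (cyl S R)) (hv : ∀ R, IntegrableOn v (cyl S R)) (hu₀ : Continuous u₀)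
    {g : ST → ℝ} (hg : IsTest g) (hs : tsupport g ⊆ slab S) :
    ∫ p in slab S, g p • u p
      = (∫ x, tail g (0, x) • u₀ x) + ∫ p in slab S, tail g p • v p := by
  obtain ⟨R, hR⟩ := exists_spatial_support hg.2
  have hRt : ∀ p : ST, R ≤ ‖p.2‖ → tail g p = 0 := fun p hp =>
    tail_eq_zero_of_spatial (fun s => hR (s, p.2) hp) p.1
  have int_u := integrableOn_smul_of_spatial_support hg.1.continuous hR (hu R)
  have int_v := integrableOn_smul_of_spatial_support hg.contDiff_tail.continuous hRt (hv R)
  have int_u₀ : Integrable fun x => tail g (0, x) • u₀ x := by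
    refine ((hg.contDiff_tail.continuous.comp (by fun_prop)).smul
      hu₀).integrable_of_hasCompactSupport (HasCompactSupport.of_support_subset_isCompact
        (isCompact_closedBall 0 R) fun x hx => ?_)
    by_contra hlt
    have hx' : R ≤ ‖x‖ := by simpa using (not_le.1 fun h => hlt (mem_closedBall_zero_iff.2 h)).le
    exact hx (by simp [hRt (0, x) hx'])
  refine ext_inner_left ℝ fun c => ?_
  have tested := h _ (hg.tailTest hs c)
  rw [setIntegral_congr_fun isOpen_future.measurableSet (g := fun p => -inner ℝ c (g p • u p))
      fun p hp => by
        simp only [hg.dt_tailTest c hp, inner_neg_right, inner_smul_right, real_inner_comm c],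
    setIntegral_congr_fun isOpen_future.measurableSet (g := fun p => inner ℝ c (tail g p • v p))
      (f := fun p => inner ℝ (v p) (tailTest g c p)) fun p hp => by
        simp only [tailTest_eq g c (by linarith [mem_future.1 hp] : -1 ≤ p.1), inner_smul_right,
          real_inner_comm c],
    integral_neg,
    setIntegral_future_eq_slab (S := S) fun p hp => by
      rw [eq_zero_of_tsupport_subset_slab_of_le hs hp.le, zero_smul, inner_zero_right],
    setIntegral_future_eq_slab (S := S) fun p hp => by
      rw [tail_eq_zero hs hp.le, zero_smul, inner_zero_right]] at tested
  have initial : ∀ x, inner ℝ (u₀ x) (tailTest g c (0, x)) = inner ℝ c (tail g (0, x) • u₀ x) := by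
    intro x
    rw [tailTest_eq g c (by norm_num : (-1 : ℝ) ≤ ((0, x) : ST).1), inner_smul_right,
      inner_smul_right, real_inner_comm c]
  simp only [initial] at tested
  rw [inner_add_right, ← integral_inner int_u, ← integral_inner int_v, ← integral_inner int_u₀]
  linarith

lemma IsWeakDtWithTrace.isTimePrimitive (h : IsWeakDtWithTrace u v u₀) (hu : LocIntegrable u)
    (hv : LocIntegrable v) (hu₀ : Continuous u₀)
    (hvm : AEStronglyMeasurable v (volume.restrict (slab S))) : IsTimePrimitive S u₀ u v := by
  have hu' := hu.integrableOn_cyl S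
  have hv' := hv.integrableOn_cyl S
  have ae_slab := ae_eq_add_primitive hu' hvm hv' hu₀ fun _ hg hs =>
    h.integral_smul hu' hv' hu₀ hg hs
  filter_upwards [ae_integrableOn_time hv', ae_ae_of_ae_slab ae_slab] with x hx hxu
  exact ⟨hx, hxu⟩

lemma IsTimePrimitive.sub {u v a b : ST → F} {u₀ v₀ : R3 → F} (hu : IsTimePrimitive S u₀ u a)
    (hv : IsTimePrimitive S v₀ v b) :
    IsTimePrimitive S (fun x => u₀ x - v₀ x) (fun p => u p - v p) (fun p => a p - b p) := by
  filter_upwards [hu, hv] with x ⟨ha, hua⟩ ⟨hb, hvb⟩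
  refine ⟨ha.sub hb, ?_⟩
  filter_upwards [hua, hvb, ae_restrict_mem measurableSet_Ioo] with t hut hvt ht
  have earlier : Ioo 0 t ⊆ Ioo 0 S := Ioo_subset_Ioo_right ht.2.le
  have primitive_sub : primitive (fun p => a p - b p) (t, x)
      = primitive a (t, x) - primitive b (t, x) :=
    integral_sub (ha.mono_set earlier) (hb.mono_set earlier)
  rw [hut, hvt, primitive_sub]
  abel

lemma ae_inner_eq_zero_of_ae_norm_eq [CompleteSpace V] (hS : 0 ≤ S) {r : ℝ} {c : V}
    {φ f : ℝ → V} (hf : IntegrableOn f (Ioo 0 S))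
    (hφ : ∀ᵐ t ∂(volume.restrict (Ioo 0 S)), φ t = c + ∫ s in Ioo 0 t, f s)
    (hr : ∀ᵐ t ∂(volume.restrict (Ioo 0 S)), ‖φ t‖ = r) :
    ∀ᵐ t ∂(volume.restrict (Ioo 0 S)), inner ℝ (φ t) (f t) = 0 := by
  have hfi : IntervalIntegrable f volume 0 S := by
    rwa [intervalIntegrable_iff_integrableOn_Ioo_of_le hS]
  set ψ : ℝ → V := fun t => c + ∫ s in (0 : ℝ)..t, f s
  have φ_eq_ψ : ∀ᵐ t ∂(volume.restrict (Ioo 0 S)), φ t = ψ t := by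
    filter_upwards [hφ, ae_restrict_mem measurableSet_Ioo] with t hφt ht
    rw [hφt, ← integral_Ioc_eq_integral_Ioo, ← intervalIntegral.integral_of_le ht.1.le]
  have ψ_continuousOn : ContinuousOn ψ (Ioo 0 S) := by
    have h := intervalIntegral.continuousOn_primitive_interval' hfi left_mem_uIcc
    rw [uIcc_of_le hS] at h
    exact (continuousOn_const.add h).mono Ioo_subset_Icc_self
  have sq_norm_ψ : EqOn (fun t => ‖ψ t‖ ^ 2) (fun _ => r ^ 2) (Ioo 0 S) := by
    refine Measure.eqOn_open_of_ae_eq (μ := volume) ?_ isOpen_Ioo (ψ_continuousOn.norm.pow 2)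
      continuousOn_const
    filter_upwards [φ_eq_ψ, hr] with t ht hrt
    rw [← ht, hrt]
  filter_upwards [φ_eq_ψ, ae_restrict_of_ae hfi.ae_hasDerivAt_integral,
    ae_restrict_mem measurableSet_Ioo] with t hψt hderiv ht
  have ψ_deriv : HasDerivAt ψ (f t) t :=
    (hderiv (by rw [uIcc_of_le hS]; exact Ioo_subset_Icc_self ht) 0 left_mem_uIcc).const_add _
  have sq_norm_deriv : HasDerivAt (fun t => ‖ψ t‖ ^ 2) 0 t :=
    (hasDerivAt_const t (r ^ 2)).congr_of_eventuallyEq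
      (sq_norm_ψ.eventuallyEq_of_mem (isOpen_Ioo.mem_nhds ht))
  rw [hψt]
  linarith [ψ_deriv.norm_sq.unique sq_norm_deriv]

lemma IsTimePrimitive.inner_eq_zero {r : ℝ} (h : IsTimePrimitive S u₀ u v) (hS : 0 ≤ S)
    (hu : AEStronglyMeasurable u (volume.restrict (slab S)))
    (hv : AEStronglyMeasurable v (volume.restrict (slab S)))
    (hr : ∀ᵐ p ∂(volume.restrict (slab S)), ‖u p‖ = r) :
    ∀ᵐ p ∂(volume.restrict (slab S)), inner ℝ (u p) (v p) = 0 := by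
  refine ae_slab_eq_zero (hu.inner hv) ?_
  filter_upwards [h, ae_ae_of_ae_slab hr] with x ⟨hvx, hux⟩ hrx
  exact ae_inner_eq_zero_of_ae_norm_eq hS hvx hux hrx

end WeakDt

section TimePrimitiveEstimates

variable {S lam : ℝ} {ζ : ℝ → ℝ}

lemma sq_lintegral_le {t : ℝ} {f : ℝ → ℝ≥0∞} (hf : AEMeasurable f (volume.restrict (Ioo 0 t))) :
    (∫⁻ s in Ioo 0 t, f s) ^ 2 ≤ ENNReal.ofReal t * ∫⁻ s in Ioo 0 t, f s ^ 2 := by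
  have cauchy_schwarz := ENNReal.lintegral_mul_le_Lp_mul_Lq (volume.restrict (Ioo 0 t))
    Real.HolderConjugate.two_two hf (aemeasurable_const (b := (1 : ℝ≥0∞)))
  simp only [Pi.mul_apply, mul_one, ENNReal.rpow_ofNat, one_pow, lintegral_const,
    Measure.restrict_apply_univ, Real.volume_Ioo, sub_zero, one_mul] at cauchy_schwarz
  have sqrt_sq : ∀ y : ℝ≥0∞, (y ^ (1 / 2 : ℝ)) ^ 2 = y := fun y => by
    rw [← ENNReal.rpow_natCast, ← ENNReal.rpow_mul]
    norm_num
  calc _ ≤ _ := pow_le_pow_left' cauchy_schwarz 2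
    _ = _ := by rw [mul_pow, sqrt_sq, sqrt_sq, mul_comm]

lemma IsTimePrimitive.ae_enorm_sq_le {u a : ST → F} (h : IsTimePrimitive S (fun _ => 0) u a) :
    ∀ᵐ x : R3, ∀ᵐ t ∂(volume.restrict (Ioo 0 S)),
      ‖u (t, x)‖ₑ ^ 2 ≤ ENNReal.ofReal S * ∫⁻ s in Ioo 0 t, ‖a (s, x)‖ₑ ^ 2 := by
  filter_upwards [h] with x ⟨ha, hua⟩
  filter_upwards [hua, ae_restrict_mem measurableSet_Ioo] with t hut ht
  rw [hut, zero_add, primitive]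
  calc _ ≤ (∫⁻ s in Ioo 0 t, ‖a (s, x)‖ₑ) ^ 2 := by
        gcongr
        exact enorm_integral_le_lintegral_enorm _
    _ ≤ _ := sq_lintegral_le
        (ha.mono_set (Ioo_subset_Ioo_right ht.2.le)).aestronglyMeasurable.enorm
    _ ≤ _ := by gcongr; exact ht.2.le

lemma lintegral_sq_enorm_lt_top {F : Type} [NormedAddCommGroup F] {f : ST → F} {μ : Measure ST}
    (hf : MemLp f 2 μ) : ∫⁻ p, ‖f p‖ₑ ^ 2 ∂μ < ⊤ := by
  simpa using lintegral_rpow_enorm_lt_top_of_eLpNorm_lt_top two_ne_zero ENNReal.ofNat_ne_top hf.2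

lemma IsTimePrimitive.memLp {u a : ST → F} (h : IsTimePrimitive S (fun _ => 0) u a)
    (hu : AEStronglyMeasurable u (volume.restrict (slab S)))
    (ha : MemLp a 2 (volume.restrict (slab S))) : MemLp u 2 (volume.restrict (slab S)) := by
  refine ⟨hu, ?_⟩
  rw [eLpNorm_lt_top_iff_lintegral_rpow_enorm_lt_top (by norm_num) (by norm_num)]
  simp only [ENNReal.toReal_ofNat, ENNReal.rpow_ofNat]
  rw [lintegral_slab_symm S (hu.enorm.pow_const 2)]
  calc ∫⁻ x : R3, ∫⁻ t in Ioo 0 S, ‖u (t, x)‖ₑ ^ 2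
      ≤ ∫⁻ x : R3, ∫⁻ _ in Ioo 0 S, ENNReal.ofReal S * ∫⁻ s in Ioo 0 S, ‖a (s, x)‖ₑ ^ 2 := by
        refine lintegral_mono_ae ?_
        filter_upwards [h.ae_enorm_sq_le] with x hx
        refine lintegral_mono_ae ?_
        filter_upwards [hx, ae_restrict_mem measurableSet_Ioo] with t hxt ht
        refine hxt.trans ?_
        gcongr
        exact ht.2.le
    _ = ENNReal.ofReal S * ENNReal.ofReal S * ∫⁻ p in slab S, ‖a p‖ₑ ^ 2 := by
        simp only [lintegral_const, Measure.restrict_apply_univ, Real.volume_Ioo, sub_zero]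
        rw [lintegral_mul_const' _ _ ENNReal.ofReal_ne_top,
          lintegral_const_mul' _ _ ENNReal.ofReal_ne_top,
          lintegral_slab_symm S (ha.1.enorm.pow_const 2)]
        ring
    _ < ⊤ := ENNReal.mul_lt_top (by finiteness) (lintegral_sq_enorm_lt_top ha)

lemma IsTimeWeight.aemeasurable_mul_sq_enorm {F : Type} [NormedAddCommGroup F] {f : ST → F}
    (hζ : IsTimeWeight S lam ζ) (hf : AEStronglyMeasurable f (volume.restrict (slab S))) :
    AEMeasurable (fun p : ST => ENNReal.ofReal (ζ p.1) * ‖f p‖ₑ ^ 2) (volume.restrict (slab S)) :=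
  (hζ.smooth.continuous.measurable.ennreal_ofReal.comp measurable_fst).aemeasurable.mul
    (hf.enorm.pow_const 2)

lemma IsTimePrimitive.lintegral_weight_le {u a : ST → F} (h : IsTimePrimitive S (fun _ => 0) u a)
    (hζ : IsTimeWeight S lam ζ) (hl : 0 < lam)
    (hu : AEStronglyMeasurable u (volume.restrict (slab S)))
    (ha : AEStronglyMeasurable a (volume.restrict (slab S))) :
    ∫⁻ p in slab S, ENNReal.ofReal (ζ p.1) * ‖u p‖ₑ ^ 2
      ≤ ENNReal.ofReal (S / lam) * ∫⁻ p in slab S, ENNReal.ofReal (ζ p.1) * ‖a p‖ₑ ^ 2 := by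
  rw [lintegral_slab_symm S (hζ.aemeasurable_mul_sq_enorm hu),
    lintegral_slab_symm S (hζ.aemeasurable_mul_sq_enorm ha),
    ← lintegral_const_mul' _ _ ENNReal.ofReal_ne_top]
  refine lintegral_mono_ae ?_
  filter_upwards [h, h.ae_enorm_sq_le] with x ⟨hax, _⟩ hx
  rw [← hζ.lintegral_neg_deriv_mul_lintegral hl.le (hax.aestronglyMeasurable.enorm.pow_const 2),
    ← lintegral_const_mul' _ _ ENNReal.ofReal_ne_top]
  refine lintegral_mono_ae ?_
  filter_upwards [hx, ae_restrict_mem measurableSet_Ioo] with t hxt ht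
  have hS : 0 < S := ht.1.trans ht.2
  have decay : S * ζ t ≤ S / lam * -deriv ζ t := by
    rw [div_mul_eq_mul_div, le_div_iff₀ hl]
    nlinarith [hζ.decay t ht.1 ht.2]
  calc ENNReal.ofReal (ζ t) * ‖u (t, x)‖ₑ ^ 2
      ≤ ENNReal.ofReal (ζ t) * (ENNReal.ofReal S * ∫⁻ s in Ioo 0 t, ‖a (s, x)‖ₑ ^ 2) := by gcongr
    _ = ENNReal.ofReal (S * ζ t) * ∫⁻ s in Ioo 0 t, ‖a (s, x)‖ₑ ^ 2 := by
        rw [ENNReal.ofReal_mul hS.le]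
        ring
    _ ≤ ENNReal.ofReal (S / lam * -deriv ζ t) * ∫⁻ s in Ioo 0 t, ‖a (s, x)‖ₑ ^ 2 := by gcongr
    _ = _ := by rw [ENNReal.ofReal_mul (by positivity), mul_assoc]

lemma IsTimeWeight.integrableOn_mul {f : ST → ℝ} (hζ : IsTimeWeight S lam ζ)
    (hf : IntegrableOn f (slab S)) : IntegrableOn (fun p => ζ p.1 * f p) (slab S) := by
  obtain ⟨B, _, hB⟩ := hζ.exists_bound
  refine hf.bdd_mul (c := B) (hζ.smooth.continuous.comp continuous_fst).aestronglyMeasurable ?_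
  filter_upwards [ae_restrict_mem (isOpen_slab S).measurableSet] with p hp
  exact (hB p.1 (mem_slab.1 hp).1.le (mem_slab.1 hp).2.le).1

lemma IsTimeWeight.integrableOn_neg_deriv_mul {f : ST → ℝ} (hζ : IsTimeWeight S lam ζ)
    (hf : IntegrableOn f (slab S)) : IntegrableOn (fun p => - deriv ζ p.1 * f p) (slab S) := by
  obtain ⟨B, _, hB⟩ := hζ.exists_bound
  refine hf.bdd_mul (c := B) (hζ.continuous_deriv.neg.comp continuous_fst).aestronglyMeasurable ?_
  filter_upwards [ae_restrict_mem (isOpen_slab S).measurableSet] with p hp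
  rw [norm_neg]
  exact (hB p.1 (mem_slab.1 hp).1.le (mem_slab.1 hp).2.le).2

lemma IsTimeWeight.integrableOn_mul_sq_norm {F : Type} [NormedAddCommGroup F] {f : ST → F}
    (hζ : IsTimeWeight S lam ζ) (hf : MemLp f 2 (volume.restrict (slab S))) :
    IntegrableOn (fun p => ζ p.1 * ‖f p‖ ^ 2) (slab S) :=
  hζ.integrableOn_mul ((memLp_two_iff_integrable_sq_norm hf.1).1 hf)

lemma IsTimeWeight.lintegral_mul_sq_enorm {F : Type} [NormedAddCommGroup F] {f : ST → F}
    (hζ : IsTimeWeight S lam ζ) (hf : MemLp f 2 (volume.restrict (slab S))) :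
    ∫⁻ p in slab S, ENNReal.ofReal (ζ p.1) * ‖f p‖ₑ ^ 2
      = ENNReal.ofReal (∫ p in slab S, ζ p.1 * ‖f p‖ ^ 2) := by
  rw [ofReal_integral_eq_lintegral_ofReal (hζ.integrableOn_mul_sq_norm hf)
    (ae_of_all _ fun p => mul_nonneg (hζ.nonneg _) (by positivity))]
  refine lintegral_congr fun p => ?_
  rw [ENNReal.ofReal_mul (hζ.nonneg _), ofReal_norm_sq]

lemma IsTimePrimitive.integral_weight_le {u a : ST → F} (h : IsTimePrimitive S (fun _ => 0) u a)
    (hζ : IsTimeWeight S lam ζ) (hS : 0 ≤ S) (hl : 0 < lam)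
    (hu : AEStronglyMeasurable u (volume.restrict (slab S)))
    (ha : MemLp a 2 (volume.restrict (slab S))) :
    ∫ p in slab S, ζ p.1 * ‖u p‖ ^ 2 ≤ S / lam * ∫ p in slab S, ζ p.1 * ‖a p‖ ^ 2 := by
  have key := h.lintegral_weight_le hζ hl hu ha.1
  have integral_nonneg : 0 ≤ ∫ p in slab S, ζ p.1 * ‖a p‖ ^ 2 :=
    integral_nonneg fun p => mul_nonneg (hζ.nonneg _) (by positivity)
  rw [hζ.lintegral_mul_sq_enorm (h.memLp hu ha), hζ.lintegral_mul_sq_enorm ha,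
    ← ENNReal.ofReal_mul (by positivity)] at key
  exact (ENNReal.ofReal_le_ofReal_iff (by positivity)).1 key

end TimePrimitiveEstimates

section Magnetization

variable {S T : ℝ} {m₀ E₀ H₀ : R3 → R3} {m E H mt : ST → R3} {G : Fin 3 → ST → R3}

lemma BddSmooth.integrableOn_time {f : ST → F} (hf : BddSmooth T f) (hST : S < T) (x : R3) :
    IntegrableOn (fun t => f (t, x)) (Ioo 0 S) := by
  obtain ⟨C, _, hC⟩ := hf.exists_bound hST
  refine Integrable.of_bound (ContinuousOn.aestronglyMeasurable (fun s hs => ?_)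
    measurableSet_Ioo) C ?_
  · exact (hasDerivAt_time (hf.differentiableAt (slab_mono hST.le
      (mem_slab.2 hs : (s, x) ∈ slab S)))).continuousAt.continuousWithinAt
  · filter_upwards [ae_restrict_mem measurableSet_Ioo] with s hs
    exact hC _ (mem_slab.2 hs)

lemma IsSmoothSolution.isTimePrimitive_m (h : IsSmoothSolution T m₀ E₀ H₀ m E H) (hST : S < T) :
    IsTimePrimitive S m₀ m (dt m) := by
  refine ae_of_all _ fun x => ⟨h.bddSmooth_m.dt.integrableOn_time hST x, ?_⟩
  filter_upwards [ae_restrict_mem measurableSet_Ioo] with t ht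
  have htT : t < T := ht.2.trans hST
  have hderiv : ∀ s ∈ Ioc 0 t, HasDerivAt (fun s => m (s, x)) (dt m (s, x)) s := fun s hs =>
    hasDerivAt_time (h.bddSmooth_m.differentiableAt (mem_slab.2 ⟨hs.1, hs.2.trans_lt htT⟩))
  have hint : IntervalIntegrable (fun s => dt m (s, x)) volume 0 t := by
    rw [intervalIntegrable_iff_integrableOn_Ioo_of_le ht.1.le]
    exact h.bddSmooth_m.dt.integrableOn_time htT x
  rw [primitive, ← integral_Ioc_eq_integral_Ioo, ← intervalIntegral.integral_of_le ht.1.le,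
    intervalIntegral.integral_eq_sub_of_hasDerivAt_of_tendsto ht.1
      (fun s hs => hderiv s (Ioo_subset_Ioc_self hs)) hint (h.smooth_m.initial x)
      ((hderiv t ⟨ht.1, le_rfl⟩).continuousAt.tendsto.mono_left nhdsWithin_le_nhds)]
  abel

lemma IsWeakSolutionWith.isTimePrimitive_m (W : IsWeakSolutionWith m₀ E₀ H₀ m E H mt G)
    (hm₀ : Continuous m₀) (hS : 0 < S) : IsTimePrimitive S m₀ m mt :=
  W.weak_dt.isTimePrimitive W.locIntegrable_m W.locIntegrable_mt hm₀ (W.memLp_mt S hS).1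

lemma IsWeakSolutionWith.inner_m_mt (W : IsWeakSolutionWith m₀ E₀ H₀ m E H mt G)
    (hm₀ : Continuous m₀) (hS : 0 < S) :
    ∀ᵐ p ∂(volume.restrict (slab S)), inner ℝ (m p) (mt p) = 0 :=
  (W.isTimePrimitive_m hm₀ hS).inner_eq_zero hS.le (W.meas_m_slab S) (W.memLp_mt S hS).1
    (W.norm_m_slab S)

end Magnetization

/-! ### Balance laws localized in space -/

/-- The balance law `∂ₜ(…) = div J - ρ` on `(0, S) × ℝ³`, already integrated in time: tested against
functions `θ` of `x` alone, it equates `∫ (θ ρ + ∇θ · J)` with the contribution `∫ θ r` of time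
zero. Nothing is assumed about `ρ` and `J` at spatial infinity. -/
structure IsSpatialBalance (S : ℝ) (ρ : ST → ℝ) (J : Fin 3 → ST → ℝ) (r : R3 → ℝ) : Prop where
  continuous_initial : Continuous r
  integrableOn : ∀ θ : R3 → ℝ, ContDiff ℝ ∞ θ → HasCompactSupport θ →
    IntegrableOn (fun p => θ p.2 * ρ p + ∑ i, pdScalar i θ p.2 * J i p) (slab S)
  integral_eq : ∀ θ : R3 → ℝ, ContDiff ℝ ∞ θ → HasCompactSupport θ →
    ∫ p in slab S, (θ p.2 * ρ p + ∑ i, pdScalar i θ p.2 * J i p) = ∫ x, θ x * r x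

namespace IsSpatialBalance

variable {S : ℝ} {ρ ρ' : ST → ℝ} {J J' : Fin 3 → ST → ℝ} {r r' : R3 → ℝ}

lemma add (h : IsSpatialBalance S ρ J r) (h' : IsSpatialBalance S ρ' J' r') :
    IsSpatialBalance S (fun p => ρ p + ρ' p) (fun i p => J i p + J' i p) (fun x => r x + r' x) := by
  have split : ∀ (θ : R3 → ℝ) (p : ST),
      θ p.2 * (ρ p + ρ' p) + ∑ i, pdScalar i θ p.2 * (J i p + J' i p)
        = (θ p.2 * ρ p + ∑ i, pdScalar i θ p.2 * J i p)
          + (θ p.2 * ρ' p + ∑ i, pdScalar i θ p.2 * J' i p) := fun θ p => by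
    simp only [mul_add, Finset.sum_add_distrib]; ring
  refine ⟨h.continuous_initial.add h'.continuous_initial, fun θ hθ hcs => ?_, fun θ hθ hcs => ?_⟩
  · simp only [split]
    exact (h.integrableOn θ hθ hcs).add (h'.integrableOn θ hθ hcs)
  · have initial_integrable : ∀ {s : R3 → ℝ}, Continuous s → Integrable fun x => θ x * s x :=
      fun hs => (hθ.continuous.mul hs).integrable_of_hasCompactSupport hcs.mul_right
    simp only [split, mul_add (θ _) (r _)]
    rw [integral_add (h.integrableOn θ hθ hcs) (h'.integrableOn θ hθ hcs),
      integral_add (initial_integrable h.continuous_initial)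
        (initial_integrable h'.continuous_initial), h.integral_eq θ hθ hcs, h'.integral_eq θ hθ hcs]

lemma const_mul (h : IsSpatialBalance S ρ J r) (k : ℝ) :
    IsSpatialBalance S (fun p => k * ρ p) (fun i p => k * J i p) (fun x => k * r x) := by
  have factor : ∀ (θ : R3 → ℝ) (p : ST),
      θ p.2 * (k * ρ p) + ∑ i, pdScalar i θ p.2 * (k * J i p)
        = k * (θ p.2 * ρ p + ∑ i, pdScalar i θ p.2 * J i p) := fun θ p => by
    simp only [mul_add, Finset.mul_sum, mul_left_comm k]
  refine ⟨continuous_const.mul h.continuous_initial, fun θ hθ hcs => ?_, fun θ hθ hcs => ?_⟩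
  · simp only [factor]
    exact (h.integrableOn θ hθ hcs).const_mul k
  · simp only [factor, mul_left_comm (θ _) k (r _)]
    rw [integral_const_mul, integral_const_mul, h.integral_eq θ hθ hcs]

lemma sum {ρ : Fin 3 → ST → ℝ} {J : Fin 3 → Fin 3 → ST → ℝ} {r : Fin 3 → R3 → ℝ}
    (h : ∀ k, IsSpatialBalance S (ρ k) (J k) (r k)) :
    IsSpatialBalance S (fun p => ∑ k, ρ k p) (fun i p => ∑ k, J k i p) (fun x => ∑ k, r k x) := by
  simpa only [Fin.sum_univ_three] using ((h 0).add (h 1)).add (h 2)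

lemma congr (h : IsSpatialBalance S ρ J r) (hρ : ρ =ᵐ[volume.restrict (slab S)] ρ')
    (hJ : ∀ i p, J i p = J' i p) (hr : ∀ x, r x = r' x) : IsSpatialBalance S ρ' J' r' := by
  obtain rfl : J = J' := funext₂ hJ
  obtain rfl : r = r' := funext hr
  have same : ∀ θ : R3 → ℝ, (fun p : ST => θ p.2 * ρ p + ∑ i, pdScalar i θ p.2 * J i p)
      =ᵐ[volume.restrict (slab S)] fun p => θ p.2 * ρ' p + ∑ i, pdScalar i θ p.2 * J i p :=
    fun θ => by filter_upwards [hρ] with p hp using by rw [hp]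
  exact ⟨h.continuous_initial, fun θ hθ hcs => (h.integrableOn θ hθ hcs).congr (same θ),
    fun θ hθ hcs => (integral_congr_ae (same θ)).symm.trans (h.integral_eq θ hθ hcs)⟩

end IsSpatialBalance

section WeakToSpatial

variable {S T lam : ℝ} {ζ : ℝ → ℝ} {θ : R3 → ℝ} {a b c v : ST → R3} {g : Fin 3 → ST → R3}
  {u₀ v₀ : R3 → R3}

lemma inner_cross_grad (a b : R3) (θ : R3 → ℝ) (x : R3) :
    inner ℝ a (cross (grad θ x) b) = ∑ i, pdScalar i θ x * inner ℝ a (cross (e i) b) := by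
  simp [inner_eq_coords, Fin.sum_univ_three, grad, e]
  ring

lemma pairing_localize (hζ : ContDiff ℝ ∞ ζ) (hθ : ContDiff ℝ ∞ θ) {p : ST}
    (hv : DifferentiableAt ℝ v p) :
    pairing a b c g (localize ζ θ v) p
      = θ p.2 * (deriv ζ p.1 * inner ℝ (a p) (v p) + ζ p.1 * pairing a b c g v p)
        + ∑ i, pdScalar i θ p.2
          * (ζ p.1 * (inner ℝ (b p) (cross (e i) (v p)) + inner ℝ (g i p) (v p))) := by
  simp only [pairing, dt_localize hζ hθ hv, dx_localize hζ hθ hv, curl_localize hζ hθ hv,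
    inner_add_right, real_inner_smul_right, inner_cross_grad, Fin.sum_univ_three]
  simp only [localize, real_inner_smul_right]
  ring

lemma IsWeakBalance.isSpatialBalance_of_integral_eq (H : IsWeakBalance a b c g u₀) (hST : S < T)
    (hv : BddSmooth T v) (hζ : IsTimeWeight S lam ζ) {r : R3 → ℝ} (hr : Continuous r)
    (hint : ∀ θ : R3 → ℝ, ContDiff ℝ ∞ θ → HasCompactSupport θ →
      ∫ p in slab S, pairing a b c g (localize ζ θ v) p = ∫ x, θ x * r x) :
    IsSpatialBalance S (fun p => deriv ζ p.1 * inner ℝ (a p) (v p) + ζ p.1 * pairing a b c g v p)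
      (fun i p => ζ p.1 * (inner ℝ (b p) (cross (e i) (v p)) + inner ℝ (g i p) (v p))) r := by
  have expand : ∀ θ : R3 → ℝ, ContDiff ℝ ∞ θ → EqOn (pairing a b c g (localize ζ θ v)) _ (slab S) :=
    fun θ hθ p hp => pairing_localize hζ.smooth hθ (hv.differentiableAt (slab_mono hST.le hp))
  have meas := (isOpen_slab S).measurableSet
  exact ⟨hr, fun θ hθ hcs =>
      (H.integrableOn_pairing_localize hST hv hζ hθ hcs).congr_fun (expand θ hθ) meas,
    fun θ hθ hcs => (setIntegral_congr_fun meas (expand θ hθ)).symm.trans (hint θ hθ hcs)⟩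

lemma IsWeakBalance.isSpatialBalance (H : IsWeakBalance a b c g u₀) (hu : Continuous u₀)
    (hST : S < T) (hv : BddSmooth T v) (hζ : IsTimeWeight S lam ζ) (hv₀ : Continuous v₀)
    (h0 : ∀ x, Tendsto (fun t : ℝ => v (t, x)) (𝓝[>] 0) (𝓝 (v₀ x))) :
    IsSpatialBalance S (fun p => deriv ζ p.1 * inner ℝ (a p) (v p) + ζ p.1 * pairing a b c g v p)
      (fun i p => ζ p.1 * (inner ℝ (b p) (cross (e i) (v p)) + inner ℝ (g i p) (v p)))
      (fun x => ζ 0 * inner ℝ (u₀ x) (v₀ x)) :=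
  H.isSpatialBalance_of_integral_eq hST hv hζ (continuous_const.mul (hu.inner hv₀))
    fun θ hθ hcs => by
      simp only [mul_left_comm _ (ζ 0), integral_const_mul]
      exact H.integral_pairing_localize hu hST hv hζ hθ hcs h0

lemma IsWeakBalance.isSpatialBalance_zero (H : IsWeakBalance a b c g fun _ => 0) (hST : S < T)
    (hv : BddSmooth T v) (hζ : IsTimeWeight S lam ζ) :
    IsSpatialBalance S (fun p => deriv ζ p.1 * inner ℝ (a p) (v p) + ζ p.1 * pairing a b c g v p)
      (fun i p => ζ p.1 * (inner ℝ (b p) (cross (e i) (v p)) + inner ℝ (g i p) (v p)))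
      (fun _ => 0) :=
  H.isSpatialBalance_of_integral_eq hST hv hζ continuous_const fun θ hθ hcs => by
    simpa using H.integral_pairing_localize_eq_zero hST hv hζ hθ hcs

lemma BddSmooth.isSpatialBalance_dx {f : ST → ℝ} (hf : BddSmooth T f) (hST : S < T)
    (hζ : IsTimeWeight S lam ζ) (i : Fin 3) :
    IsSpatialBalance S (fun p => ζ p.1 * dx i f p)
      (fun j p => if j = i then ζ p.1 * f p else 0) (fun _ => 0) := by
  have collect : ∀ (θ : R3 → ℝ) (p : ST), θ p.2 * (ζ p.1 * dx i f p)
      + ∑ j, pdScalar j θ p.2 * (if j = i then ζ p.1 * f p else 0)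
        = ζ p.1 * (θ p.2 * dx i f p + pdScalar i θ p.2 * f p) := fun θ p => by
    simp only [mul_ite, mul_zero, Finset.sum_ite_eq', Finset.mem_univ, if_true]; ring
  have integrable : ∀ θ : R3 → ℝ, ContDiff ℝ ∞ θ → HasCompactSupport θ →
      Integrable θ ∧ Integrable (pdScalar i θ) := fun θ hθ hcs =>
    ⟨hθ.continuous.integrable_of_hasCompactSupport hcs,
      ((hθ.continuous_fderiv (by simp)).clm_apply
        continuous_const).integrable_of_hasCompactSupport (hcs.fderiv_apply ℝ (e i))⟩
  refine ⟨continuous_const, fun θ hθ hcs => ?_, fun θ hθ hcs => ?_⟩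
  · obtain ⟨hθi, hdθ⟩ := integrable θ hθ hcs
    refine (((hf.dx i).integrableOn_slab hST hθi hζ.smooth.continuous).add
      (hf.integrableOn_slab hST hdθ hζ.smooth.continuous)).congr
      (ae_of_all _ fun p => Eq.trans ?_ (collect θ p).symm)
    rw [Pi.add_apply]; ring
  · obtain ⟨hθi, hdθ⟩ := integrable θ hθ hcs
    simpa only [collect, mul_zero, integral_zero] using
      hf.integral_slab_dx hST i hθ hθi hdθ hζ.smooth.continuous

end WeakToSpatial

/-- Smooth cutoff functions which exhaust `ℝ³`: one bump function, dilated by the factor `n + 1`. -/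
def cutoff (n : ℕ) (x : R3) : ℝ :=
  (⟨1, 2, one_pos, one_lt_two⟩ : ContDiffBump (0 : R3)) ((1 / ((n : ℝ) + 1)) • x)

namespace cutoff

lemma contDiff (n : ℕ) : ContDiff ℝ ∞ (cutoff n) :=
  (ContDiffBump.contDiff _).comp (contDiff_const_smul _)

lemma hasCompactSupport (n : ℕ) : HasCompactSupport (cutoff n) :=
  (ContDiffBump.hasCompactSupport _).comp_homeomorph
    (Homeomorph.smulOfNeZero (1 / ((n : ℝ) + 1)) (by positivity))

lemma abs_le_one (n : ℕ) (x : R3) : |cutoff n x| ≤ 1 :=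
  (abs_of_nonneg (ContDiffBump.nonneg _)).trans_le (ContDiffBump.le_one _)

lemma tendsto_one (x : R3) : Tendsto (fun n => cutoff n x) atTop (𝓝 1) := by
  let f : ContDiffBump (0 : R3) := ⟨1, 2, one_pos, one_lt_two⟩
  have rescaled : Tendsto (fun n : ℕ => (1 / ((n : ℝ) + 1)) • x) atTop (𝓝 ((0 : ℝ) • x)) :=
    tendsto_one_div_add_atTop_nhds_zero_nat.smul_const x
  have limit := (f.continuous.tendsto _).comp rescaled
  rwa [zero_smul, f.one_of_mem_closedBall (by simp [f.rIn_pos.le])] at limit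

lemma exists_abs_pdScalar_le :
    ∃ C, 0 ≤ C ∧ ∀ n i x, |pdScalar i (cutoff n) x| ≤ 1 / ((n : ℝ) + 1) * C := by
  let f : ContDiffBump (0 : R3) := ⟨1, 2, one_pos, one_lt_two⟩
  have hf : ContDiff ℝ ∞ f := f.contDiff
  obtain ⟨C, hC⟩ := (hf.continuous_fderiv (by simp)).bounded_above_of_compact_support
    (f.hasCompactSupport.fderiv ℝ)
  refine ⟨C, (norm_nonneg _).trans (hC 0), fun n i x => ?_⟩
  have dilated : pdScalar i (cutoff n) x
      = 1 / ((n : ℝ) + 1) * fderiv ℝ f ((1 / ((n : ℝ) + 1)) • x) (e i) :=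
    congrArg (fun L : R3 →L[ℝ] ℝ => L (e i)) (fderiv_comp_smul (f := f) (1 / ((n : ℝ) + 1)))
  rw [dilated, abs_mul, abs_of_nonneg (by positivity)]
  gcongr
  exact ((fderiv ℝ f _).le_of_opNorm_le (hC _) (e i)).trans_eq (by rw [norm_e, mul_one])

lemma tendsto_integral_mul {b : R3 → ℝ} (hb : Integrable b) :
    Tendsto (fun n => ∫ x, cutoff n x * b x) atTop (𝓝 (∫ x, b x)) := by
  refine tendsto_integral_of_dominated_convergence (fun x => |b x|)
    (fun n => (contDiff n).continuous.aestronglyMeasurable.mul hb.1) hb.abs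
    (fun n => ae_of_all _ fun x => ?_) (ae_of_all _ fun x => ?_)
  · rw [Real.norm_eq_abs, abs_mul]
    exact mul_le_of_le_one_left (abs_nonneg _) (abs_le_one n x)
  · simpa using (tendsto_one x).mul_const (b x)

lemma tendsto_integral_flux {S : ℝ} {ρ : ST → ℝ} {J : Fin 3 → ST → ℝ}
    (hρ : IntegrableOn ρ (slab S)) (hJ : ∀ i, IntegrableOn (J i) (slab S)) :
    Tendsto (fun n => ∫ p in slab S, (cutoff n p.2 * ρ p + ∑ i, pdScalar i (cutoff n) p.2 * J i p))
      atTop (𝓝 (∫ p in slab S, ρ p)) := by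
  obtain ⟨C, hC0, hC⟩ := exists_abs_pdScalar_le
  have grad_le : ∀ n i x, |pdScalar i (cutoff n) x| ≤ C := fun n i x =>
    (hC n i x).trans (mul_le_of_le_one_left hC0
      (div_le_one_of_le₀ (by linarith [n.cast_nonneg (α := ℝ)]) (by positivity)))
  have grad_tendsto : ∀ i x, Tendsto (fun n => pdScalar i (cutoff n) x) atTop (𝓝 0) :=
    fun i x => squeeze_zero_norm (fun n => hC n i x)
      (by simpa using tendsto_one_div_add_atTop_nhds_zero_nat.mul_const C)
  have grad_continuous : ∀ n i, Continuous (pdScalar i (cutoff n)) := fun n i =>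
    ((contDiff n).continuous_fderiv (by simp)).clm_apply continuous_const
  refine tendsto_integral_of_dominated_convergence (fun p => |ρ p| + ∑ i, C * |J i p|)
    (fun n => ?_) ?_ (fun n => ae_of_all _ fun p => ?_) (ae_of_all _ fun p => ?_)
  · exact (((contDiff n).continuous.comp continuous_snd).aestronglyMeasurable.mul hρ.1).add
      (Finset.aestronglyMeasurable_fun_sum _ fun i _ =>
        ((grad_continuous n i).comp continuous_snd).aestronglyMeasurable.mul (hJ i).1)
  · exact hρ.abs.add (integrable_finsetSum _ fun i _ => (hJ i).abs.const_mul C)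
  · refine (norm_add_le _ _).trans (add_le_add ?_ ((norm_sum_le _ _).trans
      (Finset.sum_le_sum fun i _ => ?_)))
    · rw [norm_mul]
      exact mul_le_of_le_one_left (norm_nonneg _) (abs_le_one n p.2)
    · rw [norm_mul]
      exact mul_le_mul_of_nonneg_right (grad_le n i p.2) (norm_nonneg _)
  · simpa using ((tendsto_one p.2).mul_const (ρ p)).add
      (tendsto_finsetSum Finset.univ fun i _ => (grad_tendsto i p.2).mul_const (J i p))

end cutoff

lemma IsSpatialBalance.integral_eq_of_integrable {S : ℝ} {ρ : ST → ℝ} {J : Fin 3 → ST → ℝ}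
    {r : R3 → ℝ} (h : IsSpatialBalance S ρ J r) (hρ : IntegrableOn ρ (slab S))
    (hJ : ∀ i, IntegrableOn (J i) (slab S)) (hr : Integrable r) :
    ∫ p in slab S, ρ p = ∫ x, r x :=
  tendsto_nhds_unique (cutoff.tendsto_integral_flux hρ hJ)
    ((cutoff.tendsto_integral_mul hr).congr fun n =>
      (h.integral_eq _ (cutoff.contDiff n) (cutoff.hasCompactSupport n)).symm)

/-! ### The cross identity -/

/-- The vector field `w = -m ∧ ∂ₜm`, for which `∂ₜm = m ∧ w` when `|m| = 1`. -/
def spin (m : ST → R3) (p : ST) : R3 := - cross (m p) (dt m p)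

/-- The component along the magnetization `m` of the effective field `Δm + H`. -/
def longitudinal (m H : ST → R3) (p : ST) : ℝ := inner ℝ (m p) (lap m p + H p)

/-- The cross energy density of a smooth solution, with space derivatives `g i`, and a weak one,
with space derivatives `G i`: the bilinear form polarizing `energyDensity`. -/
def crossEnergy (E₁ H₁ : ST → R3) (g : Fin 3 → ST → R3) (E₂ H₂ : ST → R3) (G : Fin 3 → ST → R3)
    (p : ST) : ℝ :=
  inner ℝ (E₁ p) (E₂ p) + inner ℝ (H₁ p) (H₂ p) + ∑ i, inner ℝ (g i p) (G i p)

/-- What is left in the cross identity besides energy and dissipation. It is quadratic in the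
differences of the two solutions, with coefficients which depend on the smooth one only. -/
def remainder (m₁ H₁ m₂ H₂ mt : ST → R3) (G : Fin 3 → ST → R3) (p : ST) : ℝ :=
  (1 / 2) * inner ℝ (mt p - dt m₁ p) (cross (m₁ p - m₂ p) (spin m₁ p))
    + longitudinal m₁ H₁ p * inner ℝ (m₁ p - m₂ p) (dt m₁ p - mt p)
    - inner ℝ (H₂ p - H₁ p) (cross (m₁ p - m₂ p) (spin m₁ p))
    + ∑ i, inner ℝ (G i p - dx i m₁ p) (cross (m₁ p - m₂ p) (dx i (spin m₁) p))

/-- The `i`-th component of the flux of cross energy. -/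
def crossFlux (m₁ E₁ H₁ m₂ E₂ H₂ mt : ST → R3) (G : Fin 3 → ST → R3) (i : Fin 3) (p : ST) : ℝ :=
  inner ℝ (E₂ p) (cross (e i) (H₁ p)) - inner ℝ (H₂ p) (cross (e i) (E₁ p))
    + inner ℝ (mt p) (dx i m₁ p) - inner ℝ (cross (m₂ p) (G i p)) (spin m₁ p)
    + inner ℝ (m₂ p) (cross (dx i m₁ p) (spin m₁ p))
    - inner ℝ (m₁ p) (cross (dx i m₁ p) (spin m₁ p))

/-- The density of the cross identity, the bilinear counterpart of `weightedEnergy`. -/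
def crossDensity (ζ : ℝ → ℝ) (m₁ E₁ H₁ m₂ E₂ H₂ mt : ST → R3) (G : Fin 3 → ST → R3) (p : ST) : ℝ :=
  - deriv ζ p.1 * crossEnergy E₁ H₁ (fun i => dx i m₁) E₂ H₂ G p
    + ζ p.1 * (inner ℝ (dt m₁ p) (mt p) - remainder m₁ H₁ m₂ H₂ mt G p)

namespace IsSmoothSolution

variable {S T lam : ℝ} {ζ : ℝ → ℝ} {m₀ E₀ H₀ : R3 → R3} {m E H : ST → R3} {p : ST}

lemma bddSmooth_spin (h : IsSmoothSolution T m₀ E₀ H₀ m E H) : BddSmooth T (spin m) :=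
  (h.bddSmooth_m.cross h.bddSmooth_m.dt).neg

lemma bddSmooth_longitudinal (h : IsSmoothSolution T m₀ E₀ H₀ m E H) :
    BddSmooth T (longitudinal m H) := by
  have hm := h.bddSmooth_m
  have lap_smooth : BddSmooth T (lap m) := by
    unfold lap
    simpa only [Fin.sum_univ_three] using
      (((hm.dx 0).dx 0).add ((hm.dx 1).dx 1)).add ((hm.dx 2).dx 2)
  exact hm.inner (lap_smooth.add h.bddSmooth_H)

lemma dt_eq_cross_spin (h : IsSmoothSolution T m₀ E₀ H₀ m E H) (hd : IsSmoothData m₀ E₀ H₀)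
    (hp : p ∈ slab T) : dt m p = cross (m p) (spin m p) := by
  rw [spin, cross_neg_right, cross_cross_of_unit (h.norm_m_eq_one hd hp) (h.inner_m_dt hp), neg_neg]

lemma dt_dx_eq (h : IsSmoothSolution T m₀ E₀ H₀ m E H) (hd : IsSmoothData m₀ E₀ H₀)
    (hp : p ∈ slab T) (i : Fin 3) :
    dt (dx i m) p = cross (dx i m p) (spin m p) + cross (m p) (dx i (spin m) p) := by
  rw [dt_dx_comm i (h.bddSmooth_m.contDiffAt hp), ← dx_cross i (h.bddSmooth_m.differentiableAt hp)
    (h.bddSmooth_spin.differentiableAt hp)]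
  have near : dt m =ᶠ[𝓝 p] fun q => cross (m q) (spin m q) := by
    filter_upwards [(isOpen_slab T).mem_nhds hp] with q hq using h.dt_eq_cross_spin hd hq
  simp only [dx, near.fderiv_eq]

lemma field_eq (h : IsSmoothSolution T m₀ E₀ H₀ m E H) (hd : IsSmoothData m₀ E₀ H₀)
    (hp : p ∈ slab T) :
    lap m p + H p = (1 / 2 : ℝ) • (dt m p + spin m p) + longitudinal m H p • m p := by
  have decomposition :=
    field_eq_of_gilbert (h.norm_m_eq_one hd hp) (h.inner_m_dt hp) (h.gilbert_lap hp)
  rwa [sub_eq_add_neg] at decomposition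

variable {m₁ E₁ H₁ m₂ E₂ H₂ mt : ST → R3} {G : Fin 3 → ST → R3}

lemma bddSmooth_cross_dx_spin (h : IsSmoothSolution T m₀ E₀ H₀ m₁ E₁ H₁) (i : Fin 3) :
    BddSmooth T fun q => cross (dx i m₁ q) (spin m₁ q) :=
  (h.bddSmooth_m.dx i).cross h.bddSmooth_spin

lemma cross_terms (h : IsSmoothSolution T m₀ E₀ H₀ m₁ E₁ H₁) (hd : IsSmoothData m₀ E₀ H₀)
    (hp : p ∈ slab T) (hv : inner ℝ (m₂ p) (mt p) = 0) :
    inner ℝ (H₂ p) (dt m₁ p) + inner ℝ (H₁ p) (mt p)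
      - (1 / 2) * inner ℝ (mt p + cross (m₂ p) (mt p)) (spin m₁ p)
      + inner ℝ (cross (m₂ p) (H₂ p)) (spin m₁ p)
      + ∑ i, (inner ℝ (mt p) (dx i (dx i m₁) p) - inner ℝ (G i p) (dt (dx i m₁) p)
        - inner ℝ (cross (m₂ p) (G i p)) (dx i (spin m₁) p)
        + inner ℝ (m₂ p) (dx i (fun q => cross (dx i m₁ q) (spin m₁ q)) p)
        + inner ℝ (G i p) (cross (dx i m₁ p) (spin m₁ p))
        - dx i (fun q => inner ℝ (m₁ q) (cross (dx i m₁ q) (spin m₁ q))) p)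
      = inner ℝ (dt m₁ p) (mt p) - remainder m₁ H₁ m₂ H₂ mt G p := by
  have dx_torque : ∀ i, dx i (fun q => cross (dx i m₁ q) (spin m₁ q)) p
      = cross (dx i (dx i m₁) p) (spin m₁ p) + cross (dx i m₁ p) (dx i (spin m₁) p) := fun i =>
    dx_cross i ((h.bddSmooth_m.dx i).differentiableAt hp) (h.bddSmooth_spin.differentiableAt hp)
  have dx_inner_torque : ∀ i, dx i (fun q => inner ℝ (m₁ q) (cross (dx i m₁ q) (spin m₁ q))) p
      = inner ℝ (m₁ p) (cross (dx i (dx i m₁) p) (spin m₁ p)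
        + cross (dx i m₁ p) (dx i (spin m₁) p)) := fun i => by
    rw [dx_inner i (h.bddSmooth_m.differentiableAt hp)
      ((h.bddSmooth_cross_dx_spin i).differentiableAt hp), inner_cross_self, zero_add, dx_torque]
  have exchange := fun i => exchange_terms_gradient (m₁ p) (m₂ p) (dx i m₁ p) (G i p)
    (dx i (dx i m₁) p) (spin m₁ p) (dx i (spin m₁) p)
  have field := exchange_terms_field (H₂ := H₂ p) (h.dt_eq_cross_spin hd hp) (h.field_eq hd hp) hv
  have lap_cross : inner ℝ (m₁ p - m₂ p) (cross (lap m₁ p) (spin m₁ p))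
      = ∑ i, inner ℝ (m₁ p - m₂ p) (cross (dx i (dx i m₁) p) (spin m₁ p)) := by
    rw [← inner_sum]
    exact congrArg (inner ℝ _) (map_sum (crossL.flip (spin m₁ p)) _ _)
  have lap_inner : inner ℝ (mt p) (lap m₁ p) = ∑ i, inner ℝ (mt p) (dx i (dx i m₁) p) := by
    simp only [lap, inner_sum]
  rw [lap_cross, lap_inner] at field
  simp only [dx_torque, dx_inner_torque, h.dt_dx_eq hd hp, remainder]
  simp only [Fin.sum_univ_three] at field ⊢
  linear_combination field + exchange 0 + exchange 1 + exchange 2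

/-- The weak equations of the second solution are tested with fields of the first one: Ampère with
`E₁`, Faraday with `H₁`, `∂ₜ∂ᵢm₂` with `∂ᵢm₁`, Gilbert with `w = spin m₁`, and `∂ᵢm₂` with
`∂ᵢm₁ ∧ w`; the divergence of `⟪m₁, ∂ᵢm₁ ∧ w⟫` makes the terms in `∂ᵢ∂ᵢm₁` quadratic. -/
lemma cross_balance (h : IsSmoothSolution T m₀ E₀ H₀ m₁ E₁ H₁)
    (W : IsWeakSolutionWith m₀ E₀ H₀ m₂ E₂ H₂ mt G) (hd : IsSmoothData m₀ E₀ H₀)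
    (hS : 0 < S) (hST : S < T) (hζ : IsTimeWeight S lam ζ) :
    IsSpatialBalance S (crossDensity ζ m₁ E₁ H₁ m₂ E₂ H₂ mt G)
      (fun i p => ζ p.1 * crossFlux m₁ E₁ H₁ m₂ E₂ H₂ mt G i p)
      (fun x => ζ 0 * energy₀ m₀ E₀ H₀ x) := by
  have hm₀ := hd.smooth_m.continuous
  have hE₀ := hd.smooth_E.continuous
  have hH₀ := hd.smooth_H.continuous
  have ampere := W.ampere_balance.isSpatialBalance hE₀ hST h.bddSmooth_E hζ hE₀ h.smooth_E.initial
  have faraday := (W.faraday_balance hm₀ hH₀).isSpatialBalance hH₀ hST h.bddSmooth_H hζ hH₀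
    h.smooth_H.initial
  have dt_dx := fun i => (W.dt_dx_balance hd.smooth_m i).isSpatialBalance
    (continuous_pd hd.smooth_m i) hST (h.bddSmooth_m.dx i) hζ (continuous_pd hd.smooth_m i)
    (h.smooth_m.tendsto_dx (hS.trans hST) hd.smooth_m i)
  have dx_torque := fun i =>
    (W.dx_balance i).isSpatialBalance_zero hST (h.bddSmooth_cross_dx_spin i) hζ
  have div_torque := fun i =>
    (h.bddSmooth_m.inner (h.bddSmooth_cross_dx_spin i)).isSpatialBalance_dx hST hζ i
  have gilbert := W.gilbert_balance.isSpatialBalance_zero hST h.bddSmooth_spin hζ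
  refine (((ampere.add faraday).add (.sum fun i => ((dt_dx i).add (dx_torque i)).add
    ((div_torque i).const_mul (-1)))).add (gilbert.const_mul (-(1 / 2)))).congr ?_
    (fun i p => ?_) (fun x => ?_)
  · filter_upwards [W.inner_m_mt hm₀ hS, ae_restrict_mem (isOpen_slab S).measurableSet]
      with p hv hpS
    have hp := slab_mono hST.le hpS
    have key := h.cross_terms (m₂ := m₂) (H₂ := H₂) (G := G) hd hp hv
    have hE : curl H₁ p = dt E₁ p := (sub_eq_zero.1 (h.ampere p hp)).symm
    have hH : curl E₁ p = - dt m₁ p - dt H₁ p := eq_sub_of_add_eq' (h.faraday p hp)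
    simp only [pairing, hE, hH, crossDensity, crossEnergy, Fin.sum_univ_three, inner_add_left,
      inner_sub_left, inner_neg_left, inner_sub_right, inner_neg_right, inner_zero_left,
      real_inner_smul_left, real_inner_comm (mt p) (H₁ p), real_inner_comm (E₂ p) (E₁ p),
      real_inner_comm (H₂ p) (H₁ p), real_inner_comm (G _ p) (dx _ m₁ p)] at key ⊢
    simp only [mul_neg, neg_neg, sub_neg_eq_add, add_zero, Fin.isValue, ↓reduceIte, one_ne_zero,
      inner_zero_left, Fin.reduceEq, mul_zero, zero_add, neg_mul, one_mul, zero_ne_one, one_div]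
    linear_combination ζ p.1 * key
  · simp only [crossFlux, Fin.sum_univ_three]
    fin_cases i <;> simp [real_inner_smul_left] <;> ring
  · simp only [energy₀, real_inner_self_eq_norm_sq, Fin.sum_univ_three]
    ring

end IsSmoothSolution

/-! ### Relative energy and uniqueness -/

lemma integrable_inner {μ : Measure ST} {f g : ST → V} (hf : MemLp f 2 μ) (hg : MemLp g 2 μ) :
    Integrable (fun p => inner ℝ (f p) (g p)) μ :=
  (hf.norm.integrable_mul hg.norm).mono' (hf.1.inner hg.1)
    (ae_of_all _ fun _ => norm_inner_le_norm _ _)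

lemma IsTimeWeight.ae_eq_zero_of_integral_nonpos {S lam : ℝ} {ζ : ℝ → ℝ} {f : ST → ℝ}
    (hζ : IsTimeWeight S lam ζ) (hf : IntegrableOn f (slab S)) (hnonneg : ∀ p, 0 ≤ f p)
    (hle : ∫ p in slab S, ζ p.1 * f p ≤ 0) : ∀ᵐ p ∂(volume.restrict (slab S)), f p = 0 := by
  have weighted_nonneg : ∀ p : ST, 0 ≤ ζ p.1 * f p := fun p => mul_nonneg (hζ.nonneg _) (hnonneg p)
  have weighted_eq_zero := (integral_eq_zero_iff_of_nonneg_ae (ae_of_all _ weighted_nonneg)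
    (hζ.integrableOn_mul hf)).1 (hle.antisymm (integral_nonneg weighted_nonneg))
  filter_upwards [weighted_eq_zero, ae_restrict_mem (isOpen_slab S).measurableSet] with p hp hpS
  exact (mul_eq_zero.1 hp).resolve_left (hζ.pos p.1 (mem_slab.1 hpS).2).ne'

section RelativeEnergy

variable {S T lam K : ℝ} {ζ : ℝ → ℝ} {m₀ E₀ H₀ : R3 → R3} {m₁ E₁ H₁ m₂ E₂ H₂ mt : ST → R3}
  {G : Fin 3 → ST → R3} {p : ST}

lemma weightedEnergy_add_sub_crossDensity (ζ : ℝ → ℝ) (m₁ E₁ H₁ m₂ E₂ H₂ mt : ST → R3)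
    (G : Fin 3 → ST → R3) (p : ST) :
    weightedEnergy ζ E₁ H₁ (fun i => dx i m₁) (dt m₁) p + weightedEnergy ζ E₂ H₂ G mt p
      - 2 * crossDensity ζ m₁ E₁ H₁ m₂ E₂ H₂ mt G p
      = - deriv ζ p.1 * (‖E₁ p - E₂ p‖ ^ 2 + ‖H₁ p - H₂ p‖ ^ 2 + ∑ i, ‖dx i m₁ p - G i p‖ ^ 2)
        + ζ p.1 * (‖dt m₁ p - mt p‖ ^ 2 + 2 * remainder m₁ H₁ m₂ H₂ mt G p) := by
  simp only [weightedEnergy, energyDensity, crossDensity, crossEnergy, norm_sub_sq_real,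
    Fin.sum_univ_three]
  ring

lemma neg_remainder_le (hw : ‖spin m₁ p‖ ≤ K) (hc : |longitudinal m₁ H₁ p| ≤ K)
    (hi : ∀ i, ‖dx i (spin m₁) p‖ ≤ K) :
    - (2 * remainder m₁ H₁ m₂ H₂ mt G p) ≤ (1 / 2) * ‖dt m₁ p - mt p‖ ^ 2
      + 9 * K ^ 2 * ‖m₁ p - m₂ p‖ ^ 2
      + (‖H₁ p - H₂ p‖ ^ 2 + ∑ i, ‖dx i m₁ p - G i p‖ ^ 2) := by
  set d := ‖m₁ p - m₂ p‖
  have torque_le : ∀ (a b c : R3), ‖c‖ ≤ K →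
      |inner ℝ (b - a) (cross (m₁ p - m₂ p) c)| ≤ K * (‖a - b‖ * d) := fun a b c hcK => by
    rw [norm_sub_rev a]
    exact (abs_inner_cross_le _ _ _).trans (by gcongr)
  have longitudinal_le : |longitudinal m₁ H₁ p * inner ℝ (m₁ p - m₂ p) (dt m₁ p - mt p)|
      ≤ K * (d * ‖dt m₁ p - mt p‖) := by
    rw [abs_mul]
    exact mul_le_mul hc (abs_real_inner_le_norm _ _) (abs_nonneg _) ((abs_nonneg _).trans hc)
  have young : ∀ x : ℝ, 2 * x * (K * d) ≤ x ^ 2 + (K * d) ^ 2 := fun x => two_mul_le_add_sq _ _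
  have dt_term := neg_le_of_abs_le (torque_le (dt m₁ p) (mt p) _ hw)
  have longitudinal_term := neg_le_of_abs_le longitudinal_le
  have H_term := le_of_abs_le (torque_le (H₁ p) (H₂ p) _ hw)
  have dx_term := fun i => neg_le_of_abs_le (torque_le (dx i m₁ p) (G i p) _ (hi i))
  have young_dt := two_mul_le_add_sq ‖dt m₁ p - mt p‖ (3 * (K * d))
  simp only [remainder, Fin.sum_univ_three]
  linarith [dx_term 0, dx_term 1, dx_term 2, young ‖H₁ p - H₂ p‖, young ‖dx 0 m₁ p - G 0 p‖,
    young ‖dx 1 m₁ p - G 1 p‖, young ‖dx 2 m₁ p - G 2 p‖, sq_nonneg (K * d)]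

lemma le_relative_energy (hζ : IsTimeWeight S lam ζ) (hl : 2 ≤ lam) (hp : p ∈ slab S)
    (hw : ‖spin m₁ p‖ ≤ K) (hc : |longitudinal m₁ H₁ p| ≤ K)
    (hi : ∀ i, ‖dx i (spin m₁) p‖ ≤ K) :
    ζ p.1 * (‖E₁ p - E₂ p‖ ^ 2 + ‖H₁ p - H₂ p‖ ^ 2) + (1 / 2) * (ζ p.1 * ‖dt m₁ p - mt p‖ ^ 2)
        - 9 * K ^ 2 * (ζ p.1 * ‖m₁ p - m₂ p‖ ^ 2)
      ≤ weightedEnergy ζ E₁ H₁ (fun i => dx i m₁) (dt m₁) p + weightedEnergy ζ E₂ H₂ G mt p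
        - 2 * crossDensity ζ m₁ E₁ H₁ m₂ E₂ H₂ mt G p := by
  have hz := hζ.nonneg p.1
  have decay : 2 * ζ p.1 ≤ - deriv ζ p.1 :=
    (mul_le_mul_of_nonneg_right hl hz).trans (hζ.decay p.1 (mem_slab.1 hp).1 (mem_slab.1 hp).2)
  rw [weightedEnergy_add_sub_crossDensity]
  have E_nonneg : 0 ≤ ζ p.1 * ‖E₁ p - E₂ p‖ ^ 2 := mul_nonneg hz (sq_nonneg _)
  have dx_nonneg : 0 ≤ ∑ i, ‖dx i m₁ p - G i p‖ ^ 2 := Finset.sum_nonneg fun _ _ => sq_nonneg _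
  have energy_term := mul_le_mul_of_nonneg_right decay
    (add_nonneg (add_nonneg (sq_nonneg ‖E₁ p - E₂ p‖) (sq_nonneg ‖H₁ p - H₂ p‖)) dx_nonneg)
  have remainder_term := mul_le_mul_of_nonneg_left
    (neg_remainder_le (m₂ := m₂) (H₂ := H₂) (mt := mt) (G := G) hw hc hi) hz
  linarith [mul_nonneg hz dx_nonneg]

namespace IsSmoothSolution

lemma exists_coeff_bound (h : IsSmoothSolution T m₀ E₀ H₀ m₁ E₁ H₁) (hST : S < T) :
    ∃ K, ∀ p ∈ slab S, ‖spin m₁ p‖ ≤ K ∧ |longitudinal m₁ H₁ p| ≤ K ∧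
      ∀ i, ‖dx i (spin m₁) p‖ ≤ K := by
  obtain ⟨A, hA0, hA⟩ := h.bddSmooth_spin.exists_bound hST
  obtain ⟨B, hB0, hB⟩ := h.bddSmooth_longitudinal.exists_bound hST
  choose C hC0 hC using fun i => (h.bddSmooth_spin.dx i).exists_bound hST
  have sum_nonneg : 0 ≤ ∑ i, C i := Finset.sum_nonneg fun i _ => hC0 i
  refine ⟨A + B + ∑ i, C i, fun p hp => ⟨?_, ?_, fun i => ?_⟩⟩
  · linarith [hA p hp]
  · linarith [hB p hp, Real.norm_eq_abs (longitudinal m₁ H₁ p)]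
  · linarith [hC i p hp, Finset.single_le_sum (fun i _ => hC0 i) (Finset.mem_univ i)]

lemma isTimePrimitive_sub (h : IsSmoothSolution T m₀ E₀ H₀ m₁ E₁ H₁)
    (W : IsWeakSolutionWith m₀ E₀ H₀ m₂ E₂ H₂ mt G) (hd : IsSmoothData m₀ E₀ H₀)
    (hS : 0 < S) (hST : S < T) :
    IsTimePrimitive S (fun _ => 0) (fun p => m₁ p - m₂ p) (fun p => dt m₁ p - mt p) := by
  simpa using (h.isTimePrimitive_m hST).sub (W.isTimePrimitive_m hd.smooth_m.continuous hS)

lemma aestronglyMeasurable_sub (h : IsSmoothSolution T m₀ E₀ H₀ m₁ E₁ H₁)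
    (W : IsWeakSolutionWith m₀ E₀ H₀ m₂ E₂ H₂ mt G) (hST : S < T) :
    AEStronglyMeasurable (fun p => m₁ p - m₂ p) (volume.restrict (slab S)) :=
  (h.bddSmooth_m.aestronglyMeasurable hST.le).sub (W.meas_m_slab S)

lemma memLp_dt_sub (h : IsSmoothSolution T m₀ E₀ H₀ m₁ E₁ H₁)
    (W : IsWeakSolutionWith m₀ E₀ H₀ m₂ E₂ H₂ mt G) (hd : IsSmoothData m₀ E₀ H₀)
    (hS : 0 < S) (hST : S < T) :
    MemLp (fun p => dt m₁ p - mt p) 2 (volume.restrict (slab S)) :=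
  (h.memLp_dt hd hS hST).sub (W.memLp_mt S hS)

lemma memLp_sub (h : IsSmoothSolution T m₀ E₀ H₀ m₁ E₁ H₁)
    (W : IsWeakSolutionWith m₀ E₀ H₀ m₂ E₂ H₂ mt G) (hd : IsSmoothData m₀ E₀ H₀)
    (hS : 0 < S) (hST : S < T) : MemLp (fun p => m₁ p - m₂ p) 2 (volume.restrict (slab S)) :=
  (h.isTimePrimitive_sub W hd hS hST).memLp (h.aestronglyMeasurable_sub W hST)
    (h.memLp_dt_sub W hd hS hST)

lemma integrableOn_remainder (h : IsSmoothSolution T m₀ E₀ H₀ m₁ E₁ H₁)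
    (W : IsWeakSolutionWith m₀ E₀ H₀ m₂ E₂ H₂ mt G) (hd : IsSmoothData m₀ E₀ H₀)
    (hS : 0 < S) (hST : S < T) : IntegrableOn (remainder m₁ H₁ m₂ H₂ mt G) (slab S) := by
  have hm := h.memLp_sub W hd hS hST
  have hv := h.memLp_dt_sub W hd hS hST
  have torque : MemLp (fun p => cross (m₁ p - m₂ p) (spin m₁ p)) 2 (volume.restrict (slab S)) :=
    memLp_cross hm (h.bddSmooth_spin.memLp_top hST)
  have torque_dx := fun i => memLp_cross (s := 2) hm ((h.bddSmooth_spin.dx i).memLp_top hST)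
  refine ((((integrable_inner ((W.memLp_mt S hS).sub (h.memLp_dt hd hS hST))
    torque).const_mul (1 / 2)).add ((integrable_inner hm hv).mul_of_top_right
      (h.bddSmooth_longitudinal.memLp_top hST))).sub
    (integrable_inner ((W.class_H.memLp S).sub (h.memLp_H hd hS hST)) torque)).add
    (integrable_finsetSum Finset.univ fun i _ =>
      integrable_inner (((W.grad_m i).memLp S).sub (h.memLp_dx hd hS hST i)) (torque_dx i))

lemma integrableOn_crossFlux (h : IsSmoothSolution T m₀ E₀ H₀ m₁ E₁ H₁)
    (W : IsWeakSolutionWith m₀ E₀ H₀ m₂ E₂ H₂ mt G) (hd : IsSmoothData m₀ E₀ H₀)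
    (hS : 0 < S) (hST : S < T) (i : Fin 3) :
    IntegrableOn (crossFlux m₁ E₁ H₁ m₂ E₂ H₂ mt G i) (slab S) := by
  have hm := h.bddSmooth_m.memLp_top hST
  have hdx := h.memLp_dx hd hS hST i
  have hspin : MemLp (spin m₁) 2 (volume.restrict (slab S)) :=
    (memLp_cross hm (h.memLp_dt hd hS hST)).neg
  have cross_e : ∀ {f : ST → R3}, MemLp f 2 (volume.restrict (slab S)) →
      MemLp (fun p => cross (e i) (f p)) 2 (volume.restrict (slab S)) :=
    memLp_cross (memLp_top_const _)
  unfold crossFlux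
  simp only [inner_cross_rotate (m₁ _), inner_cross_rotate (m₂ _)]
  exact (((((integrable_inner (W.class_E.memLp S) (cross_e (h.memLp_H hd hS hST))).sub
    (integrable_inner (W.class_H.memLp S) (cross_e (h.memLp_E hd hS hST)))).add
    (integrable_inner (W.memLp_mt S hS) hdx)).sub
    (integrable_inner (W.memLp_cross ((W.grad_m i).memLp S)) hspin)).add
    (integrable_inner (W.memLp_cross hdx) hspin)).sub
    (integrable_inner (memLp_cross hm hdx) hspin)

lemma integrableOn_crossDensity (h : IsSmoothSolution T m₀ E₀ H₀ m₁ E₁ H₁)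
    (W : IsWeakSolutionWith m₀ E₀ H₀ m₂ E₂ H₂ mt G) (hd : IsSmoothData m₀ E₀ H₀)
    (hS : 0 < S) (hST : S < T) (hζ : IsTimeWeight S lam ζ) :
    IntegrableOn (crossDensity ζ m₁ E₁ H₁ m₂ E₂ H₂ mt G) (slab S) := by
  refine (hζ.integrableOn_neg_deriv_mul ?_).add (hζ.integrableOn_mul ?_)
  · exact ((integrable_inner (h.memLp_E hd hS hST) (W.class_E.memLp S)).add
      (integrable_inner (h.memLp_H hd hS hST) (W.class_H.memLp S))).add
      (integrable_finsetSum Finset.univ fun i _ =>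
        integrable_inner (h.memLp_dx hd hS hST i) ((W.grad_m i).memLp S))
  · exact (integrable_inner (h.memLp_dt hd hS hST) (W.memLp_mt S hS)).sub
      (h.integrableOn_remainder W hd hS hST)

theorem cross_identity (h : IsSmoothSolution T m₀ E₀ H₀ m₁ E₁ H₁)
    (W : IsWeakSolutionWith m₀ E₀ H₀ m₂ E₂ H₂ mt G) (hd : IsSmoothData m₀ E₀ H₀)
    (hS : 0 < S) (hST : S < T) (hζ : IsTimeWeight S lam ζ) :
    ∫ p in slab S, crossDensity ζ m₁ E₁ H₁ m₂ E₂ H₂ mt G p = ζ 0 * ∫ x, energy₀ m₀ E₀ H₀ x := by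
  rw [← integral_const_mul]
  exact (h.cross_balance W hd hS hST hζ).integral_eq_of_integrable
    (h.integrableOn_crossDensity W hd hS hST hζ)
    (fun i => hζ.integrableOn_mul (h.integrableOn_crossFlux W hd hS hST i))
    (hd.integrable_energy₀.const_mul _)

lemma integral_relative_energy_le (h : IsSmoothSolution T m₀ E₀ H₀ m₁ E₁ H₁)
    (W : IsWeakSolutionWith m₀ E₀ H₀ m₂ E₂ H₂ mt G) (hd : IsSmoothData m₀ E₀ H₀)
    (hS : 0 < S) (hST : S < T) (hζ : IsTimeWeight S lam ζ) (hl : 1 ≤ lam) :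
    IntegrableOn (fun p => weightedEnergy ζ E₁ H₁ (fun i => dx i m₁) (dt m₁) p
      + weightedEnergy ζ E₂ H₂ G mt p - 2 * crossDensity ζ m₁ E₁ H₁ m₂ E₂ H₂ mt G p) (slab S) ∧
    ∫ p in slab S, (weightedEnergy ζ E₁ H₁ (fun i => dx i m₁) (dt m₁) p
      + weightedEnergy ζ E₂ H₂ G mt p - 2 * crossDensity ζ m₁ E₁ H₁ m₂ E₂ H₂ mt G p) ≤ 0 := by
  obtain ⟨int_smooth, smooth_le⟩ := h.energy_le hd hS hST hζ hl
  obtain ⟨int_weak, weak_le⟩ := W.energy_le hd hS hζ (zero_le_one.trans hl)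
  have int_sum : IntegrableOn (fun p => weightedEnergy ζ E₁ H₁ (fun i => dx i m₁) (dt m₁) p
      + weightedEnergy ζ E₂ H₂ G mt p) (slab S) := int_smooth.add int_weak
  have int_cross := (h.integrableOn_crossDensity W hd hS hST hζ).const_mul 2
  refine ⟨int_sum.sub int_cross, ?_⟩
  rw [integral_sub int_sum int_cross, integral_add int_smooth int_weak, integral_const_mul,
    h.cross_identity W hd hS hST hζ]
  linarith

lemma integrableOn_fields_sub (h : IsSmoothSolution T m₀ E₀ H₀ m₁ E₁ H₁)
    (W : IsWeakSolutionWith m₀ E₀ H₀ m₂ E₂ H₂ mt G) (hd : IsSmoothData m₀ E₀ H₀)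
    (hS : 0 < S) (hST : S < T) :
    IntegrableOn (fun p => ‖E₁ p - E₂ p‖ ^ 2 + ‖H₁ p - H₂ p‖ ^ 2) (slab S) := by
  have hE := (h.memLp_E hd hS hST).sub (W.class_E.memLp S)
  have hH := (h.memLp_H hd hS hST).sub (W.class_H.memLp S)
  exact ((memLp_two_iff_integrable_sq_norm hE.1).1 hE).add
    ((memLp_two_iff_integrable_sq_norm hH.1).1 hH)

lemma integral_fields_add_dt_le (h : IsSmoothSolution T m₀ E₀ H₀ m₁ E₁ H₁)
    (W : IsWeakSolutionWith m₀ E₀ H₀ m₂ E₂ H₂ mt G) (hd : IsSmoothData m₀ E₀ H₀)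
    (hS : 0 < S) (hST : S < T) (hζ : IsTimeWeight S lam ζ) (hl : 2 ≤ lam)
    (hK : ∀ p ∈ slab S, ‖spin m₁ p‖ ≤ K ∧ |longitudinal m₁ H₁ p| ≤ K ∧
      ∀ i, ‖dx i (spin m₁) p‖ ≤ K) :
    (∫ p in slab S, ζ p.1 * (‖E₁ p - E₂ p‖ ^ 2 + ‖H₁ p - H₂ p‖ ^ 2))
        + (1 / 2) * (∫ p in slab S, ζ p.1 * ‖dt m₁ p - mt p‖ ^ 2)
      ≤ 9 * K ^ 2 * ∫ p in slab S, ζ p.1 * ‖m₁ p - m₂ p‖ ^ 2 := by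
  obtain ⟨int_rel, rel_le⟩ := h.integral_relative_energy_le W hd hS hST hζ (by linarith)
  have int_fields := hζ.integrableOn_mul (h.integrableOn_fields_sub W hd hS hST)
  have int_dt := (hζ.integrableOn_mul_sq_norm (h.memLp_dt_sub W hd hS hST)).const_mul (1 / 2)
  have int_m := (hζ.integrableOn_mul_sq_norm (h.memLp_sub W hd hS hST)).const_mul (9 * K ^ 2)
  have int_sum : IntegrableOn (fun p => ζ p.1 * (‖E₁ p - E₂ p‖ ^ 2 + ‖H₁ p - H₂ p‖ ^ 2)
      + (1 / 2) * (ζ p.1 * ‖dt m₁ p - mt p‖ ^ 2)) (slab S) := int_fields.add int_dt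
  rw [← sub_nonpos, ← integral_const_mul, ← integral_const_mul, ← integral_add int_fields int_dt,
    ← integral_sub int_sum int_m]
  refine le_trans (setIntegral_mono_on (int_sum.sub int_m) int_rel
    (isOpen_slab S).measurableSet fun p hp => ?_) rel_le
  obtain ⟨hw, hc, hi⟩ := hK p hp
  exact le_relative_energy hζ hl hp hw hc hi

/-- The weight decays at the rate `2 + 36 K² S`, so that Poincaré's inequality in time absorbs
`9 K² ‖m₁ - m₂‖²` into half of the dissipation `½ ‖∂ₜm₁ - ∂ₜm₂‖²`. -/
lemma uniqueness_slab (h : IsSmoothSolution T m₀ E₀ H₀ m₁ E₁ H₁)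
    (W : IsWeakSolutionWith m₀ E₀ H₀ m₂ E₂ H₂ mt G) (hd : IsSmoothData m₀ E₀ H₀)
    (hS : 0 < S) (hST : S < T) :
    ∀ᵐ p ∂(volume.restrict (slab S)), m₂ p = m₁ p ∧ E₂ p = E₁ p ∧ H₂ p = H₁ p := by
  obtain ⟨K, hK⟩ := h.exists_coeff_bound hST
  set lam : ℝ := 2 + 36 * K ^ 2 * S
  have two_le : 2 ≤ lam := le_add_of_nonneg_right (by positivity)
  have lam_pos : 0 < lam := by linarith
  obtain ⟨ζ, hζ⟩ := exists_isTimeWeight hS lam_pos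
  have int_m := (memLp_two_iff_integrable_sq_norm (h.aestronglyMeasurable_sub W hST)).1
    (h.memLp_sub W hd hS hST)
  have energy := h.integral_fields_add_dt_le W hd hS hST hζ two_le hK
  have poincare : ∫ p in slab S, ζ p.1 * ‖m₁ p - m₂ p‖ ^ 2
      ≤ S / lam * ∫ p in slab S, ζ p.1 * ‖dt m₁ p - mt p‖ ^ 2 :=
    (h.isTimePrimitive_sub W hd hS hST).integral_weight_le hζ hS.le lam_pos
      (h.aestronglyMeasurable_sub W hST) (h.memLp_dt_sub W hd hS hST)
  have dt_nonneg : 0 ≤ ∫ p in slab S, ζ p.1 * ‖dt m₁ p - mt p‖ ^ 2 :=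
    integral_nonneg fun p => mul_nonneg (hζ.nonneg _) (sq_nonneg _)
  have fields_nonneg : 0 ≤ ∫ p in slab S, ζ p.1 * (‖E₁ p - E₂ p‖ ^ 2 + ‖H₁ p - H₂ p‖ ^ 2) :=
    integral_nonneg fun p => mul_nonneg (hζ.nonneg _) (by positivity)
  have absorb : 9 * K ^ 2 * (S / lam) ≤ 1 / 4 := by
    rw [← mul_div_assoc, div_le_iff₀ lam_pos]
    linarith
  have m_absorbed := (mul_le_mul_of_nonneg_left poincare (by positivity : 0 ≤ 9 * K ^ 2)).trans
    ((mul_assoc _ _ _).symm.le.trans (mul_le_mul_of_nonneg_right absorb dt_nonneg))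
  have dt_zero : ∫ p in slab S, ζ p.1 * ‖dt m₁ p - mt p‖ ^ 2 = 0 := by linarith
  rw [dt_zero, mul_zero] at poincare
  filter_upwards [hζ.ae_eq_zero_of_integral_nonpos int_m (fun _ => sq_nonneg _) poincare,
    hζ.ae_eq_zero_of_integral_nonpos (h.integrableOn_fields_sub W hd hS hST)
      (fun _ => by positivity) (by linarith)] with p hm hEH
  obtain ⟨hE, hH⟩ := (add_eq_zero_iff_of_nonneg (sq_nonneg _) (sq_nonneg _)).1 hEH
  have eq_of_sq : ∀ {a b : R3}, ‖a - b‖ ^ 2 = 0 → b = a := fun hab =>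
    (sub_eq_zero.1 (norm_eq_zero.1 (pow_eq_zero_iff two_ne_zero |>.1 hab))).symm
  exact ⟨eq_of_sq hm, eq_of_sq hE, eq_of_sq hH⟩

end IsSmoothSolution

end RelativeEnergy

lemma ae_slab_of_lt {T : ℝ} (hT : 0 < T) {P : ST → Prop}
    (h : ∀ S, 0 < S → S < T → ∀ᵐ p ∂(volume.restrict (slab S)), P p) :
    ∀ᵐ p ∂(volume.restrict (slab T)), P p := by
  obtain ⟨u, -, hu, hlim⟩ := exists_seq_strictMono_tendsto' hT
  have hsub : slab T ⊆ ⋃ n, slab (u n) := fun p hp => by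
    obtain ⟨n, hn⟩ := (hlim.eventually_const_lt (mem_slab.1 hp).2).exists
    exact mem_iUnion.2 ⟨n, mem_slab.2 ⟨(mem_slab.1 hp).1, hn⟩⟩
  refine ae_restrict_of_ae_restrict_of_subset hsub ?_
  rw [ae_restrict_iUnion_iff]
  exact fun n => h _ (hu n).1 (hu n).2

end

end MLL

theorem theorem2p2 (m₀ E₀ H₀ : MLL.R3 → MLL.R3) (hdata : MLL.IsSmoothData m₀ E₀ H₀)
    (m₂ E₂ H₂ : MLL.ST → MLL.R3) (hweak : MLL.IsWeakSolution m₀ E₀ H₀ m₂ E₂ H₂)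
    (T : ℝ) (hT : 0 < T)
    (m₁ E₁ H₁ : MLL.ST → MLL.R3) (hsmooth : MLL.IsSmoothSolution T m₀ E₀ H₀ m₁ E₁ H₁) :
    ∀ᵐ p ∂(MeasureTheory.volume.restrict (MLL.slab T)),
      m₂ p = m₁ p ∧ E₂ p = E₁ p ∧ H₂ p = H₁ p := by
  obtain ⟨mt, G, W⟩ := hweak
  exact MLL.ae_slab_of_lt hT fun S hS hST => hsmooth.uniqueness_slab W hdata hS hST
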